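/- **Theorem (Regret bound of ORRL-MNL).** *Setting.* Let $\mathcal M$ be an episodic MDP with state space $\mathcal S$, finite action set $\mathcal A$, horizon $H\ge 1$, transition kernels $P_1,\dots,P_H$ and known reward $r:\mathcal S\times\mathcal A\to[0,1]$. For a policy $\pi=(\pi_h)_{h\le H}$, $\pi_h:\mathcal S\to\mathcal A$, let $V^\pi_h(s)$ be the expected sum of the rewards from step $h$ on when $s_h=s$, and $V^*_h(s)=\sup_\pi V^\pi_h(s)$. The set $\mathcal S_{s,a}=\{s': P_h(s'\mid s,a)\neq 0\}$ of reachable states is finite and does not depend on $h$; let $\mathcal U=\max_{s,a}|\mathcal S_{s,a}|$ and assume $\mathcal U\ge 2$. Let $\varphi:\mathcal S\times\mathcal A\times\mathcal S\to\mathbb R^d$, $d\ge 1$, be a known feature map and put, for $s'\in\mathcal S_{s,a}$, $$P_\theta(s'\mid s,a)=\frac{\exp(\varphi(s,a,s')^\top\theta)}{\sum_{\tilde s\in\mathcal S_{s,a}}\exp(\varphi(s,a,\tilde s)^\top\theta)},\qquad \bar\varphi(s,a,s';\theta)=\varphi(s,a,s')-\sum_{\tilde s\in\mathcal S_{s,a}}P_\theta(\tilde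 s\mid s,a)\,\varphi(s,a,\tilde s).$$ Assume: (1) there are unknown $\theta_h^*\in\mathbb R^d$ with $P_h(\cdot\mid s,a)=P_{\theta^*_h}(\cdot\mid s,a)$ for all $h,s,a$; (2) $\|\varphi(s,a,s')\|_2\le L_\varphi$ for $s'\in\mathcal S_{s,a}$ and $\|\theta^*_h\|_2\le L_\theta$, where $L_\varphi,L_\theta>0$; (3) each $\mathcal S_{s,a}$ contains a state $\dot s$ with $\varphi(s,a,\dot s)=0$; (4) $\kappa>0$ and $P_\theta(s'\mid s,a)P_\theta(\tilde s\mid s,a)\ge\kappa$ for all $s,a$, all distinct $s',\tilde s\in\mathcal S_{s,a}$ and all $\|\theta\|_2\le L_\theta$. *Algorithm ORRL-MNL* with inputs $\lambda,\eta,M,(\beta_k),(\sigma_k)$. Start with $\theta^1_h=0$ and $B_{1,h}=\lambda I_d$. In episode $k=1,\dots,K$ observe the initial state $s^k_1$ (which may depend on the past), then sample, independently for $h\le H$ and $m\le M$ given the past, $\xi^{(m)}_{k,h}\sim\mathcal N(0,\sigma_k^2B_{k,h}^{-1})$. Put $\tilde V^k_{H+1}=0$ and, for $h=H,\dots,1$,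 $\tilde V^k_h(s)=\max_a\tilde Q^k_h(s,a)$ with $$\tilde Q^k_h(s,a)=\min\Big\{r(s,a)+\sum_{s'\in\mathcal S_{s,a}}P_{\theta^k_h}(s'\mid s,a)\Big(\tilde V^k_{h+1}(s')+\max_{m\le M}\bar\varphi(s,a,s';\theta^k_h)^\top\xi^{(m)}_{k,h}\Big)+3H\beta_k^2\max_{s'\in\mathcal S_{s,a}}\|\varphi(s,a,s')\|^2_{B_{k,h}^{-1}},\;H\Big\},$$ and play a policy $\pi^k$ that is greedy for $\tilde Q^k$ (ties are broken arbitrarily). With $\ell_{k,h}(\theta)=-\log P_\theta(s^k_{h+1}\mid s^k_h,a^k_h)$ update $$\tilde B_{k,h}=B_{k,h}+\eta\nabla^2\ell_{k,h}(\theta^k_h),\quad \theta^{k+1}_h=\operatorname*{arg\,min}_{\|\theta\|_2\le L_\theta}\tfrac1{2\eta}\|\theta-\theta^k_h\|^2_{\tilde B_{k,h}}+\theta^\top\nabla\ell_{k,h}(\theta^k_h),\quad B_{k+1,h}=B_{k,h}+\nabla^2\ell_{k,h}(\theta^{k+1}_h).$$ *Claim.* Let $\Phi$ be the standard normal distribution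 function. There are absolute constants $C>0$ and $p\in\mathbb N$, constants $c_1,c_2>0$ that depend only on $L_\varphi,L_\theta$, and for every $0<\delta<\Phi(-1)/2$ a constant $c_3>0$ that depends only on $L_\varphi,L_\theta,\delta$, such that ORRL-MNL with $$\lambda=c_1L_\varphi^2d\log\mathcal U,\quad \eta=c_2\log\mathcal U,\quad \beta_k=c_3\sqrt d\,\log\mathcal U\,\log(kH),\quad\sigma_k=H\beta_k,\quad M=\Big\lceil1-\frac{\log(H\mathcal U)}{\log\Phi(1)}\Big\rceil$$ satisfies, for every such MDP and every number $K$ of episodes, with $T=KH$, with probability at least $1-\delta$, $$\sum_{k=1}^K\big(V^*_1-V^{\pi^k}_1\big)(s^k_1)\;\le\; C\Big((1+L_\varphi L_\theta)\big(1+\log\tfrac{dH\mathcal UK}{\delta}\big)\Big)^p\Big(d^{3/2}H^{3/2}\sqrt T+\kappa^{-1}d^2H^2\Big)$$ (for $K=0$ both sides are read with $\log 0=0$). In particular the leading term does not depend on $\kappa$. -/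

import Mathlib

open MeasureTheory ProbabilityTheory

noncomputable section

namespace MNLRL

/-- Feature and parameter space `ℝ^d` with its Euclidean norm. -/
abbrev Vec (d : ℕ) := EuclideanSpace ℝ (Fin d)

/-- The squared weighted norm `‖x‖²_B = xᵀ B x`. -/
def sqNorm {d : ℕ} (B : Matrix (Fin d) (Fin d) ℝ) (x : Vec d) : ℝ :=
  dotProduct x.ofLp (B.mulVec x.ofLp)

/-- The Hessian matrix of a real function on `ℝ^d`. -/
def hessian {d : ℕ} (f : Vec d → ℝ) (x : Vec d) : Matrix (Fin d) (Fin d) ℝ :=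
  Matrix.of fun i j =>
    iteratedFDeriv ℝ 2 f x ![EuclideanSpace.single i (1 : ℝ), EuclideanSpace.single j (1 : ℝ)]

/-- The standard normal distribution function. -/
def stdNormalCDF (x : ℝ) : ℝ := cdf (gaussianReal 0 1) x

/-- An episodic MDP with horizon `H`, inhomogeneous transition kernels `P h`, a deterministic reward
with values in `[0, 1]`, and finite sets `reach s a` of reachable next states. Steps are numbered
from `0` to `H - 1`. -/
structure EpisodicMDP (S : Type*) (A : Type*) (H : ℕ) where
  P : Fin H → S → A → PMF S
  reward : S → A → ℝ
  reward_mem : ∀ s a, reward s a ∈ Set.Icc (0 : ℝ) 1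
  reach : S → A → Finset S
  mem_reach_iff : ∀ h s a s', s' ∈ reach s a ↔ P h s a s' ≠ 0

/-- A (deterministic, step-dependent) policy. -/
abbrev Policy (S : Type*) (A : Type*) (H : ℕ) := Fin H → S → A

section MDP

variable {S A : Type*} {H d : ℕ}

/-- The value `V_h^π(s)`: the expected sum of the rewards collected by `π` from step `h` on when
the state at step `h` is `s`. It vanishes for `h = H`, when the episode is over. -/
def policyValue (𝓜 : EpisodicMDP S A H) (π : Policy S A H) (h : ℕ) (s : S) : ℝ :=
  if hh : h < H then
    𝓜.reward s (π ⟨h, hh⟩ s) +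
      ∑ s' ∈ 𝓜.reach s (π ⟨h, hh⟩ s),
        (𝓜.P ⟨h, hh⟩ s (π ⟨h, hh⟩ s) s').toReal * policyValue 𝓜 π (h + 1) s'
  else 0
termination_by H - h

/-- The optimal value `V_h^*(s)`, the supremum over all policies. -/
def optimalValue (𝓜 : EpisodicMDP S A H) (h : ℕ) (s : S) : ℝ :=
  ⨆ π : Policy S A H, policyValue 𝓜 π h s

/-- The multinomial logistic probability `P_θ(s' ∣ s, a)` of a reachable state `s'`. -/
def mnlProb (𝓜 : EpisodicMDP S A H) (φ : S → A → S → Vec d) (θ : Vec d)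
    (s : S) (a : A) (s' : S) : ℝ :=
  Real.exp (inner ℝ (φ s a s') θ) / ∑ t ∈ 𝓜.reach s a, Real.exp (inner ℝ (φ s a t) θ)

/-- The MDP is an MNL-MDP with feature map `φ` and transition cores `θstar h`. -/
def IsMNL (𝓜 : EpisodicMDP S A H) (φ : S → A → S → Vec d) (θstar : Fin H → Vec d) : Prop :=
  ∀ h s a, ∀ s' ∈ 𝓜.reach s a, (𝓜.P h s a s').toReal = mnlProb 𝓜 φ (θstar h) s a s'

/-- `U` is the maximal number of reachable states. -/
def IsMaxReach (𝓜 : EpisodicMDP S A H) (U : ℕ) : Prop :=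
  IsGreatest {n : ℕ | ∃ s a, n = (𝓜.reach s a).card} U

/-- Features of reachable states and transition cores are bounded by `Lφ` and `Lθ`. -/
def IsBounded (𝓜 : EpisodicMDP S A H) (φ : S → A → S → Vec d) (θstar : Fin H → Vec d)
    (Lφ Lθ : ℝ) : Prop :=
  (∀ s a, ∀ s' ∈ 𝓜.reach s a, ‖φ s a s'‖ ≤ Lφ) ∧ ∀ h, ‖θstar h‖ ≤ Lθ

/-- Every set of reachable states contains a reference state with feature zero. -/
def HasReferenceState (𝓜 : EpisodicMDP S A H) (φ : S → A → S → Vec d) : Prop :=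
  ∀ s a, ∃ s' ∈ 𝓜.reach s a, φ s a s' = 0

/-- `κ` is a lower bound for the products of the probabilities of two reachable states, uniformly
over the parameters in the ball of radius `Lθ`. -/
def IsKappa (𝓜 : EpisodicMDP S A H) (φ : S → A → S → Vec d) (Lθ κ : ℝ) : Prop :=
  ∀ s a, ∀ s' ∈ 𝓜.reach s a, ∀ t ∈ 𝓜.reach s a, s' ≠ t →
    ∀ θ : Vec d, ‖θ‖ ≤ Lθ → κ ≤ mnlProb 𝓜 φ θ s a s' * mnlProb 𝓜 φ θ s a t

/-- The centralized feature `φ(s,a,s') - 𝔼_{t ∼ P_θ(· ∣ s,a)} φ(s,a,t)`. -/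
def centralFeature (𝓜 : EpisodicMDP S A H) (φ : S → A → S → Vec d) (θ : Vec d)
    (s : S) (a : A) (s' : S) : Vec d :=
  φ s a s' - ∑ t ∈ 𝓜.reach s a, mnlProb 𝓜 φ θ s a t • φ s a t

open Classical in
/-- The loss `-∑_{s'} y(s') log P_θ(s' ∣ s, a)` of an observed transition `(s, a) → snext`, where
`y(s')` is the indicator of `snext = s'`. -/
def loss (𝓜 : EpisodicMDP S A H) (φ : S → A → S → Vec d) (s : S) (a : A) (snext : S)
    (θ : Vec d) : ℝ :=
  -∑ s' ∈ 𝓜.reach s a, (if snext = s' then (1 : ℝ) else 0) * Real.log (mnlProb 𝓜 φ θ s a s')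

/-- The input parameters of the algorithm. Episodes are numbered from `0`. -/
structure Params where
  lam : ℝ
  eta : ℝ
  beta : ℕ → ℝ
  sigma : ℕ → ℝ
  M : ℕ

/-- The randomized bonus at `(s, a)` in some episode and step, for the estimate `θ`, the Gram
matrix `B`, the confidence radius `β` and the noise vectors `ξ`. As each reachable state uses the
noise vector that maximizes the product with its centralized feature, that product is the maximum
over the `M` samples. -/
def bonus (𝓜 : EpisodicMDP S A H) (φ : S → A → S → Vec d) {M : ℕ} (β : ℝ) (θ : Vec d)
    (B : Matrix (Fin d) (Fin d) ℝ) (ξ : Fin M → Vec d) (s : S) (a : A) : ℝ :=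
  (∑ s' ∈ 𝓜.reach s a,
      mnlProb 𝓜 φ θ s a s' * (⨆ m : Fin M, inner ℝ (centralFeature 𝓜 φ θ s a s') (ξ m)))
    + 3 * H * β ^ 2 * (⨆ s' : {x // x ∈ 𝓜.reach s a}, sqNorm B⁻¹ (φ s a s'))

/-- One backward step of the optimistic randomized action value: from the value `V` of the next
step to the action value of this step. -/
def qStep (𝓜 : EpisodicMDP S A H) (φ : S → A → S → Vec d) {M : ℕ} (β : ℝ) (θ : Vec d)
    (B : Matrix (Fin d) (Fin d) ℝ) (ξ : Fin M → Vec d) (V : S → ℝ) (s : S) (a : A) : ℝ :=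
  min (𝓜.reward s a + (∑ s' ∈ 𝓜.reach s a, mnlProb 𝓜 φ θ s a s' * V s')
    + bonus 𝓜 φ β θ B ξ s a) H

/-- The optimistic randomized value function `Ṽ_h` of an episode with estimates `θ h`, Gram matrices
`B h` and noise vectors `ξ h m`. -/
def optValue (𝓜 : EpisodicMDP S A H) (φ : S → A → S → Vec d) {M : ℕ} (β : ℝ)
    (θ : Fin H → Vec d) (B : Fin H → Matrix (Fin d) (Fin d) ℝ) (ξ : Fin H → Fin M → Vec d)
    (h : ℕ) (s : S) : ℝ :=
  if hh : h < H then
    ⨆ a : A, qStep 𝓜 φ β (θ ⟨h, hh⟩) (B ⟨h, hh⟩) (ξ ⟨h, hh⟩)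
      (fun s' => optValue 𝓜 φ β θ B ξ (h + 1) s') s a
  else 0
termination_by H - h

/-- The optimistic randomized action value function `Q̃_h` of an episode. -/
def optQ (𝓜 : EpisodicMDP S A H) (φ : S → A → S → Vec d) {M : ℕ} (β : ℝ)
    (θ : Fin H → Vec d) (B : Fin H → Matrix (Fin d) (Fin d) ℝ) (ξ : Fin H → Fin M → Vec d)
    (h : Fin H) (s : S) (a : A) : ℝ :=
  qStep 𝓜 φ β (θ h) (B h) (ξ h) (optValue 𝓜 φ β θ B ξ (h + 1)) s a

/-- The objective of the online mirror descent step from the estimate `θ₀`, for the loss `ℓ` and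
the Gram matrix `B`. -/
def omdObjective (η : ℝ) (B : Matrix (Fin d) (Fin d) ℝ) (ℓ : Vec d → ℝ) (θ₀ θ : Vec d) : ℝ :=
  1 / (2 * η) * sqNorm (B + η • hessian ℓ θ₀) (θ - θ₀) + inner ℝ θ (gradient ℓ θ₀)

end MDP

/-- `X` is a discrete random variable, measurable with respect to `m`. -/
def IsDiscreteRV {Ω S : Type*} (m : MeasurableSpace Ω) (X : Ω → S) : Prop :=
  (Set.range X).Countable ∧ ∀ s, MeasurableSet[m] {ω | X ω = s}

/-- The point of time in the interaction: each episode takes `H + 1` units of time. At time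
`clock H k 0` the initial state of episode `k` is known, but not yet the noise of that episode. At
time `clock H k (h + 1)`, for `h < H`, the noise of episode `k` and its states of the steps `0` to
`h` are known, but not yet the next state. The last state of the episode is known at time
`clock H k (H + 1) = clock H (k + 1) 0`. -/
def clock (H k j : ℕ) : ℕ := k * (H + 1) + j

/-- A run of ORRL-MNL for `K` episodes on a probability space: in episode `k`, `state k h` is the
state at step `h` (the initial state is chosen by the environment, possibly depending on the past),
`noise k h m` are the sampled noise vectors, `theta k h` the estimates, `gram k h` the Gram matrices
and `policy k` the greedy policy that is played. -/
structure ORRLRun {S A Ω : Type*} {H d : ℕ} (𝓜 : EpisodicMDP S A H) (φ : S → A → S → Vec d)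
    (Lθ : ℝ) (prm : Params) (K : ℕ) [mΩ : MeasurableSpace Ω] (μ : Measure Ω) where
  filt : Filtration ℕ mΩ
  state : ℕ → ℕ → Ω → S
  noise : ℕ → Fin H → Fin prm.M → Ω → Vec d
  theta : ℕ → Fin H → Ω → Vec d
  gram : ℕ → Fin H → Ω → Matrix (Fin d) (Fin d) ℝ
  policy : ℕ → Ω → Policy S A H
  /-- Initialization. -/
  theta_zero : ∀ h ω, theta 0 h ω = 0
  gram_zero : ∀ h ω, gram 0 h ω = prm.lam • (1 : Matrix (Fin d) (Fin d) ℝ)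
  /-- The initial state of an episode is observed before the noise of that episode is sampled. -/
  state_initial : ∀ k < K, IsDiscreteRV (filt (clock H k 0)) (state k 0)
  /-- Given the past, the noise vectors of the episode are independent centered Gaussian vectors
  with covariance matrices `σ_k² B_{k,h}⁻¹`. -/
  noise_meas : ∀ k < K, ∀ h m, Measurable[filt (clock H k 1)] (noise k h m)
  noise_law : ∀ k < K, ∀ E : Set (Fin H × Fin prm.M → Vec d), MeasurableSet E →
    μ[({ω | (fun i : Fin H × Fin prm.M => noise k i.1 i.2 ω) ∈ E}).indicator
        (fun _ => (1 : ℝ)) | filt (clock H k 0)]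
      =ᵐ[μ] fun ω => (Measure.pi fun i : Fin H × Fin prm.M =>
        multivariateGaussian (0 : Vec d) (prm.sigma k ^ 2 • (gram k i.1 ω)⁻¹)).real E
  /-- The policy is greedy with respect to the optimistic randomized action values. -/
  policy_meas : ∀ k < K, ∀ h s a, MeasurableSet[filt (clock H k 1)] {ω | policy k ω h s = a}
  policy_greedy : ∀ k < K, ∀ ω h s a,
    optQ 𝓜 φ (prm.beta k) (fun h => theta k h ω) (fun h => gram k h ω)
        (fun h m => noise k h m ω) h s a
      ≤ optQ 𝓜 φ (prm.beta k) (fun h => theta k h ω) (fun h => gram k h ω)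
        (fun h m => noise k h m ω) h s (policy k ω h s)
  /-- Given the past, the next state is drawn from the transition kernel of the MDP. -/
  state_next : ∀ k < K, ∀ h : Fin H, IsDiscreteRV (filt (clock H k (h + 2))) (state k (h + 1))
  state_law : ∀ k < K, ∀ h : Fin H, ∀ s' : S,
    μ[({ω | state k (h + 1) ω = s'}).indicator (fun _ => (1 : ℝ)) | filt (clock H k (h + 1))]
      =ᵐ[μ] fun ω => (𝓜.P h (state k h ω) (policy k ω h (state k h ω)) s').toReal
  /-- The online mirror descent update over the ball of radius `Lθ`. -/
  theta_mem : ∀ k < K, ∀ h ω, theta (k + 1) h ω ∈ Metric.closedBall (0 : Vec d) Lθ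
  theta_min : ∀ k < K, ∀ h ω,
    IsMinOn (omdObjective prm.eta (gram k h ω)
        (loss 𝓜 φ (state k h ω) (policy k ω h (state k h ω)) (state k (h + 1) ω))
        (theta k h ω))
      (Metric.closedBall (0 : Vec d) Lθ) (theta (k + 1) h ω)
  /-- The Gram matrix update with the Hessian of the loss at the new estimate. -/
  gram_succ : ∀ k < K, ∀ h ω,
    gram (k + 1) h ω = gram k h ω +
      hessian (loss 𝓜 φ (state k h ω) (policy k ω h (state k h ω)) (state k (h + 1) ω))
        (theta (k + 1) h ω)

/-- The cumulative regret of the run. -/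
def ORRLRun.regret {S A Ω : Type*} {H d : ℕ} {𝓜 : EpisodicMDP S A H} {φ : S → A → S → Vec d}
    {Lθ : ℝ} {prm : Params} {K : ℕ} [MeasurableSpace Ω] {μ : Measure Ω}
    (R : ORRLRun 𝓜 φ Lθ prm K μ) (ω : Ω) : ℝ :=
  ∑ k ∈ Finset.range K,
    (optimalValue 𝓜 0 (R.state k 0 ω) - policyValue 𝓜 (R.policy k ω) 0 (R.state k 0 ω))

/-- The parameter choice `λ = c₁ Lφ² d log U`, `η = c₂ log U`, `β_k = c₃ √d log U log(kH)`,
`σ_k = H β_k` and `M = ⌈1 - log(HU) / log Φ(1)⌉` for episodes `k = 1, 2, …`. As episodes are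
numbered from `0` here, index `k` stands for the episode `k + 1`. -/
def orrlParams (c₁ c₂ c₃ Lφ : ℝ) (d H U : ℕ) : Params where
  lam := c₁ * (Lφ ^ 2 * d * Real.log U)
  eta := c₂ * Real.log U
  beta k := c₃ * (√d * Real.log U * Real.log ((k + 1) * H))
  sigma k := H * (c₃ * (√d * Real.log U * Real.log ((k + 1) * H)))
  M := ⌈1 - Real.log (H * U) / Real.log (stdNormalCDF 1)⌉₊

end MNLRL

end

/-! The proof rests on a confidence bound for the estimates, optimism with constant probability, and
a potential that converts optimism into regret.

Confidence. A mirror descent step contracts the distance to the true parameter in the Gram norm, up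
to `2η` times an excess loss (`omd_step`). Two facts make this work: the quadratic surrogate differs
from the loss by a Taylor error that `λ` absorbs, and the loss is strongly convex relative to its
own Fisher matrix, with a constant polynomial in `Lφ Lθ`. The excess loss measured at the previous
estimate is a log likelihood ratio. Corrected by the predictable information gain, its exponential
has conditional mean at most one (`sum_mnlProb_exp_logRatio_le`). The total information gain is `O(d
log K)` by growth of the determinant (`OMDPath.sum_infoGain_le`). Together these give the radius
`β/50` with no `κ` in it (`OMDPath.sqNorm_sub_le`, `radius_le`).

Optimism. Expanding the model mean of a value function in the parameter gives a first order error of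
at most `Hβ/100` times `width`, and a second order error governed by `maxSq`
(`abs_modelMean_sub_le`). The deterministic bonus pays the second error; the noise has to pay the
first. At one fixed state it pays twice over, except with probability `1/(4H²)`. A union bound over
all states is not available. Instead, part of the surplus at good states is kept as a reserve, and
the deficits at bad states are costs collected along the comparison policy. The expected costs are
at most half the reserve, so Markov's inequality gives optimism with probability at least `1/4`
(`quarter_le_noiseLaw_optValue`).

Regret. Let `base` be the value computed without noise and `x` the amount by which it falls short of
the optimal value. Then `x` is known before the noise is drawn. On the optimistic event `O` the
noise raises the value by at least `x`, and `O` has conditional probability at least `1/4`, so `x (1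
- 4·1_O)` has nonpositive conditional mean. The rest of the regret is dominated by the potential `4
(opt - base) + (opt - V^π)` (`ORRLRun.episode_regret_le`). This potential telescopes along the
played trajectory with one-step errors in `width` and `maxSq` (`gapValue_le`). The widths are square
summable up to a logarithm and contribute the `√K` term. Only `maxSq` is converted to information
gain at the price `κ⁻¹` (`maxSq_le`), and its sum is merely logarithmic in `K`. Hence the leading
term is free of `κ`.

Measurability. A run says nothing about measurability of its estimates. Since the minimizers are
unique, the estimates are determined by finitely many discrete observations, and conditional
statements can be checked on the fibres of discrete data. -/

open MeasureTheory ProbabilityTheory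

noncomputable section

namespace MNLRL

/-! ### Exponential tilts of finite probability weights -/

section Tilt

variable {ι : Type*}

/-- The exponential tilt of the weights `p` on the finite set `I` by the function `u`. -/
def tilt (I : Finset ι) (p u : ι → ℝ) (i : ι) : ℝ :=
  p i * Real.exp (u i) / ∑ j ∈ I, p j * Real.exp (u j)

/-- The linear term disappears under a nonpositive mean, which leaves a sub-Gaussian bound on the
exponential moment with no second moment computation. -/
lemma exp_le_add_exp_sq (z : ℝ) : Real.exp z ≤ z + Real.exp (z ^ 2) := by
  have h2 := Real.add_one_le_exp (z ^ 2)
  rcases le_or_gt z (-1) with h | h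
  · have : Real.exp z ≤ 1 := Real.exp_le_one_iff.2 (by linarith)
    nlinarith
  rcases le_or_gt z 1 with h' | h'
  · have := Real.abs_exp_sub_one_sub_id_le (abs_le.2 ⟨h.le, h'⟩)
    have := (abs_le.1 this).2
    linarith
  · have : Real.exp z ≤ Real.exp (z ^ 2) := Real.exp_le_exp.2 (by nlinarith)
    linarith

lemma exp_le_one_add_two_mul {x : ℝ} (h0 : 0 ≤ x) (h1 : x ≤ 1) : Real.exp x ≤ 1 + 2 * x := by
  have := (abs_le.1 (Real.abs_exp_sub_one_sub_id_le (abs_le.2 ⟨by linarith, h1⟩))).2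
  nlinarith

/-- The curvature lost on a bounded range is only linear in `R`, not exponential; this keeps the
final constants polynomial in `Lφ Lθ`. For `-2 ≤ y < 0` the bound comes from squaring `1 + y/2 ≤ exp
(y/2)`; for `y < -2` the left side is already negative. -/
lemma quadratic_le_exp {R y : ℝ} (hR : 0 ≤ R) (hy : -R ≤ y) :
    1 + y + y ^ 2 / (4 * (1 + R)) ≤ Real.exp y := by
  have hq : y ^ 2 / (4 * (1 + R)) ≤ y ^ 2 / 4 := by
    apply div_le_div_of_nonneg_left (sq_nonneg y) (by norm_num)
    linarith
  rcases le_or_gt 0 y with h | h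
  · have := Real.quadratic_le_exp_of_nonneg h
    nlinarith [sq_nonneg y]
  rcases le_or_gt (-2) y with h2 | h2
  · have h3 : 1 + y / 2 ≤ Real.exp (y / 2) := by linarith [Real.add_one_le_exp (y / 2)]
    have h4 : Real.exp y = Real.exp (y / 2) * Real.exp (y / 2) := by
      rw [← Real.exp_add]; ring_nf
    have h5 : 0 ≤ 1 + y / 2 := by linarith
    nlinarith [mul_le_mul h3 h3 h5 (Real.exp_pos _).le]
  · have h6 : y ^ 2 / (4 * (1 + R)) ≤ -y / 4 := by
      rw [div_le_iff₀ (by positivity)]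
      nlinarith
    have := Real.exp_pos y
    linarith

variable {I : Finset ι} {p : ι → ℝ}

lemma abs_sum_mul_le (hp : ∀ i ∈ I, 0 ≤ p i) (hs : ∑ i ∈ I, p i = 1) {u : ι → ℝ} {X : ℝ}
    (hu : ∀ i ∈ I, |u i| ≤ X) : |∑ i ∈ I, p i * u i| ≤ X := by
  calc |∑ i ∈ I, p i * u i| ≤ ∑ i ∈ I, |p i * u i| := Finset.abs_sum_le_sum_abs _ _
    _ ≤ ∑ i ∈ I, p i * X := Finset.sum_le_sum fun i hi => by
        rw [abs_mul, abs_of_nonneg (hp i hi)]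
        exact mul_le_mul_of_nonneg_left (hu i hi) (hp i hi)
    _ = X := by rw [← Finset.sum_mul, hs, one_mul]

lemma sum_mul_le_of_le (hp : ∀ i ∈ I, 0 ≤ p i) (hs : ∑ i ∈ I, p i = 1) {u : ι → ℝ} {X : ℝ}
    (hu : ∀ i ∈ I, u i ≤ X) : ∑ i ∈ I, p i * u i ≤ X := by
  calc ∑ i ∈ I, p i * u i ≤ ∑ i ∈ I, p i * X := Finset.sum_le_sum fun i hi =>
        mul_le_mul_of_nonneg_left (hu i hi) (hp i hi)
    _ = X := by rw [← Finset.sum_mul, hs, one_mul]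

lemma le_sum_mul_of_le (hp : ∀ i ∈ I, 0 ≤ p i) (hs : ∑ i ∈ I, p i = 1) {u : ι → ℝ} {X : ℝ}
    (hu : ∀ i ∈ I, X ≤ u i) : X ≤ ∑ i ∈ I, p i * u i := by
  calc X = ∑ i ∈ I, p i * X := by rw [← Finset.sum_mul, hs, one_mul]
    _ ≤ ∑ i ∈ I, p i * u i := Finset.sum_le_sum fun i hi =>
        mul_le_mul_of_nonneg_left (hu i hi) (hp i hi)

lemma sum_mul_exp_pos (hp : ∀ i ∈ I, 0 ≤ p i) (hs : ∑ i ∈ I, p i = 1) (u : ι → ℝ) :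
    0 < ∑ i ∈ I, p i * Real.exp (u i) := by
  obtain ⟨i, hi, hpi⟩ : ∃ i ∈ I, 0 < p i := by
    by_contra! h
    have : ∑ i ∈ I, p i ≤ 0 := Finset.sum_nonpos h
    linarith
  exact Finset.sum_pos' (fun j hj => mul_nonneg (hp j hj) (Real.exp_pos _).le)
    ⟨i, hi, mul_pos hpi (Real.exp_pos _)⟩

lemma tilt_nonneg (hp : ∀ i ∈ I, 0 ≤ p i) (u : ι → ℝ) : ∀ i ∈ I, 0 ≤ tilt I p u i :=
  fun i hi => div_nonneg (mul_nonneg (hp i hi) (Real.exp_pos _).le)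
    (Finset.sum_nonneg fun j hj => mul_nonneg (hp j hj) (Real.exp_pos _).le)

lemma sum_tilt (hp : ∀ i ∈ I, 0 ≤ p i) (hs : ∑ i ∈ I, p i = 1) (u : ι → ℝ) :
    ∑ i ∈ I, tilt I p u i = 1 := by
  unfold tilt
  rw [← Finset.sum_div, div_self (sum_mul_exp_pos hp hs u).ne']

lemma tilt_sub_const (u : ι → ℝ) (m : ℝ) : tilt I p (fun i => u i - m) = tilt I p u := by
  funext i
  unfold tilt
  simp only [Real.exp_sub]
  have : ∑ j ∈ I, p j * (Real.exp (u j) / Real.exp m)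
      = (∑ j ∈ I, p j * Real.exp (u j)) / Real.exp m := by
    rw [Finset.sum_div]; exact Finset.sum_congr rfl fun _ _ => by ring
  rw [this, ← mul_div_assoc, div_div_div_cancel_right₀ (Real.exp_pos m).ne']

lemma one_le_sum_exp (hp : ∀ i ∈ I, 0 ≤ p i) (hs : ∑ i ∈ I, p i = 1) {y : ι → ℝ}
    (hy : ∑ i ∈ I, p i * y i = 0) : 1 ≤ ∑ i ∈ I, p i * Real.exp (y i) := by
  have : ∑ i ∈ I, p i * (y i + 1) ≤ ∑ i ∈ I, p i * Real.exp (y i) :=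
    Finset.sum_le_sum fun i hi => mul_le_mul_of_nonneg_left (Real.add_one_le_exp _) (hp i hi)
  simp only [mul_add, mul_one, Finset.sum_add_distrib, hy, hs] at this
  linarith

lemma sum_mul_sub_mean (hs : ∑ i ∈ I, p i = 1) (u : ι → ℝ) :
    ∑ i ∈ I, p i * (u i - ∑ j ∈ I, p j * u j) = 0 := by
  simp only [mul_sub, Finset.sum_sub_distrib, ← Finset.sum_mul, hs]
  ring

/-- First order expansion of the mean of `V` under an exponential tilt. -/
lemma tilt_taylor (hp : ∀ i ∈ I, 0 ≤ p i) (hs : ∑ i ∈ I, p i = 1) {u V : ι → ℝ} {X b : ℝ}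
    (hX : 0 ≤ X) (hb : 0 ≤ b) (hu : ∀ i ∈ I, |u i| ≤ X) (hV : ∀ i ∈ I, |V i| ≤ b) :
    |∑ i ∈ I, tilt I p u i * V i - ∑ i ∈ I, p i * V i
      - ∑ i ∈ I, p i * ((u i - ∑ j ∈ I, p j * u j) * V i)| ≤ 12 * b * X ^ 2 := by
  set m := ∑ j ∈ I, p j * u j with hm
  have hmX : |m| ≤ X := abs_sum_mul_le hp hs hu
  rw [← tilt_sub_const u m]
  set y : ι → ℝ := fun i => u i - m with hy
  have hyX : ∀ i ∈ I, |y i| ≤ 2 * X := fun i hi => by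
    calc |y i| ≤ |u i| + |m| := abs_sub _ _
      _ ≤ 2 * X := by linarith [hu i hi]
  have hy0 : ∑ i ∈ I, p i * y i = 0 := sum_mul_sub_mean hs u
  change |∑ i ∈ I, tilt I p y i * V i - ∑ i ∈ I, p i * V i
      - ∑ i ∈ I, p i * (y i * V i)| ≤ 12 * b * X ^ 2
  have hyy : ∀ i ∈ I, y i ^ 2 ≤ 4 * X ^ 2 := fun i hi => by
    rw [← sq_abs]
    nlinarith [hyX i hi, abs_nonneg (y i)]
  -- Only small tilts need an expansion. For `X > 1/2` the three terms are bounded separately, and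
  -- the quadratic right side exceeds their sum.
  rcases le_or_gt X (1 / 2) with hX2 | hX2
  · set Z := ∑ i ∈ I, p i * Real.exp (y i) with hZ
    have hZ1 : 1 ≤ Z := one_le_sum_exp hp hs hy0
    have hr : ∀ i ∈ I, |Real.exp (y i) - 1 - y i| ≤ 4 * X ^ 2 := fun i hi =>
      (Real.abs_exp_sub_one_sub_id_le ((hyX i hi).trans (by linarith))).trans (hyy i hi)
    have hZ2 : Z - 1 ≤ 4 * X ^ 2 := by
      have h1 : Z - 1 = ∑ i ∈ I, p i * (Real.exp (y i) - 1 - y i) := by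
        simp only [mul_sub, Finset.sum_sub_distrib, hy0, mul_one, hs, hZ]; ring
      rw [h1]
      exact (le_abs_self _).trans (abs_sum_mul_le hp hs hr)
    -- The remainder of the density is `exp y / Z - 1 - y = ((exp y - 1 - y) - (1 + y)(Z - 1)) / Z`;
    -- both parts are of order `X²`, because centring `y` removes the linear term of `Z`.
    have hterm : ∑ i ∈ I, tilt I p y i * V i - ∑ i ∈ I, p i * V i - ∑ i ∈ I, p i * (y i * V i)
        = ∑ i ∈ I, p i * ((((Real.exp (y i) - 1 - y i) - (1 + y i) * (Z - 1)) / Z) * V i) := by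
      rw [← Finset.sum_sub_distrib, ← Finset.sum_sub_distrib]
      refine Finset.sum_congr rfl fun i _ => ?_
      have : Z ≠ 0 := by linarith
      unfold tilt
      rw [← hZ]
      field_simp
      ring
    rw [hterm]
    apply abs_sum_mul_le hp hs
    intro i hi
    rw [abs_mul, abs_div, abs_of_pos (by linarith : 0 < Z)]
    have h1 : |(Real.exp (y i) - 1 - y i) - (1 + y i) * (Z - 1)| ≤ 12 * X ^ 2 := by
      have h2 : |(1 + y i) * (Z - 1)| ≤ 2 * (4 * X ^ 2) := by
        rw [abs_mul, abs_of_nonneg (by linarith : 0 ≤ Z - 1)]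
        have : |1 + y i| ≤ 2 := (abs_add_le _ _).trans (by
          rw [abs_one]; linarith [hyX i hi])
        exact mul_le_mul this hZ2 (by linarith) (by norm_num)
      calc _ ≤ |Real.exp (y i) - 1 - y i| + |(1 + y i) * (Z - 1)| := abs_sub _ _
        _ ≤ 12 * X ^ 2 := by linarith [hr i hi]
    have h3 : |(Real.exp (y i) - 1 - y i) - (1 + y i) * (Z - 1)| / Z ≤ 12 * X ^ 2 :=
      (div_le_self (abs_nonneg _) hZ1).trans h1
    calc _ ≤ 12 * X ^ 2 * b := mul_le_mul h3 (hV i hi) (abs_nonneg _) (by positivity)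
      _ = 12 * b * X ^ 2 := by ring
  · have h1 : |∑ i ∈ I, tilt I p y i * V i| ≤ b :=
      abs_sum_mul_le (tilt_nonneg hp y) (sum_tilt hp hs y) hV
    have h2 : |∑ i ∈ I, p i * V i| ≤ b := abs_sum_mul_le hp hs hV
    have h3 : |∑ i ∈ I, p i * (y i * V i)| ≤ 2 * X * b :=
      abs_sum_mul_le hp hs fun i hi => by
        rw [abs_mul]; exact mul_le_mul (hyX i hi) (hV i hi) (abs_nonneg _) (by linarith)
    have h4 := abs_sub (∑ i ∈ I, tilt I p y i * V i - ∑ i ∈ I, p i * V i)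
      (∑ i ∈ I, p i * (y i * V i))
    have h5 := abs_sub (∑ i ∈ I, tilt I p y i * V i) (∑ i ∈ I, p i * V i)
    have h6 : 2 * b + 2 * X * b ≤ 12 * b * X ^ 2 := by
      have : 2 + 2 * X ≤ 12 * X ^ 2 := by nlinarith
      nlinarith
    linarith

/-- The cumulant generating function of a bounded centred variable dominates its variance. -/
lemma variance_le_log_sum_exp (hp : ∀ i ∈ I, 0 ≤ p i) (hs : ∑ i ∈ I, p i = 1) {y : ι → ℝ} {R : ℝ}
    (hR : 0 ≤ R) (hy : ∑ i ∈ I, p i * y i = 0) (hyR : ∀ i ∈ I, |y i| ≤ R) :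
    (∑ i ∈ I, p i * y i ^ 2) / (4 * (1 + R) ^ 2) ≤ Real.log (∑ i ∈ I, p i * Real.exp (y i)) := by
  set v := ∑ i ∈ I, p i * y i ^ 2 with hv
  have hv0 : 0 ≤ v := Finset.sum_nonneg fun i hi => mul_nonneg (hp i hi) (sq_nonneg _)
  have hvR : v ≤ R ^ 2 := sum_mul_le_of_le hp hs fun i hi => by
    rw [← sq_abs]; exact pow_le_pow_left₀ (abs_nonneg _) (hyR i hi) 2
  have h1 : 1 + v / (4 * (1 + R)) ≤ ∑ i ∈ I, p i * Real.exp (y i) := by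
    have h2 : ∑ i ∈ I, p i * (1 + y i + y i ^ 2 / (4 * (1 + R)))
        ≤ ∑ i ∈ I, p i * Real.exp (y i) := Finset.sum_le_sum fun i hi =>
      mul_le_mul_of_nonneg_left (quadratic_le_exp hR (abs_le.1 (hyR i hi)).1) (hp i hi)
    have h3 : ∑ i ∈ I, p i * (1 + y i + y i ^ 2 / (4 * (1 + R))) = 1 + v / (4 * (1 + R)) := by
      simp only [mul_add, Finset.sum_add_distrib, mul_one, hs, hy, hv, Finset.sum_div,
        mul_div_assoc]
      ring
    linarith
  set z := v / (4 * (1 + R)) with hz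
  have hz0 : 0 ≤ z := by positivity
  have hzR : z ≤ R := by
    rw [hz, div_le_iff₀ (by positivity)]; nlinarith
  have h4 : Real.log (1 + z) ≤ Real.log (∑ i ∈ I, p i * Real.exp (y i)) :=
    Real.log_le_log (by linarith) h1
  have h5 : 1 - (1 + z)⁻¹ ≤ Real.log (1 + z) := Real.one_sub_inv_le_log_of_pos (by linarith)
  have h6 : v / (4 * (1 + R) ^ 2) = z / (1 + R) := by
    rw [hz]; field_simp
  -- The logarithm is bounded below by `z / (1 + z)`, and `z ≤ R` makes this linear in `z`.
  have h7 : z / (1 + R) ≤ 1 - (1 + z)⁻¹ := by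
    have : 1 - (1 + z)⁻¹ = z / (1 + z) := by
      field_simp; ring
    rw [this]
    exact div_le_div_of_nonneg_left hz0 (by linarith) (by linarith)
  linarith

/-- The mean minimizes the quadratic deviation, so recentring at the tilted mean only increases the
left side; then the densities are compared pointwise, each of numerator and normalizer costing `exp
X`. -/
lemma variance_le_tilt_variance (hp : ∀ i ∈ I, 0 ≤ p i) (hs : ∑ i ∈ I, p i = 1) {u v : ι → ℝ}
    {X : ℝ} (hu : ∀ i ∈ I, |u i| ≤ X) :
    ∑ i ∈ I, p i * (v i - ∑ j ∈ I, p j * v j) ^ 2 ≤ Real.exp (2 * X) *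
      ∑ i ∈ I, tilt I p u i * (v i - ∑ j ∈ I, tilt I p u j * v j) ^ 2 := by
  set c := ∑ j ∈ I, tilt I p u j * v j
  set m := ∑ j ∈ I, p j * v j with hm
  have h1 : ∑ i ∈ I, p i * (v i - m) ^ 2 ≤ ∑ i ∈ I, p i * (v i - c) ^ 2 := by
    have : ∑ i ∈ I, p i * (v i - c) ^ 2 = ∑ i ∈ I, p i * (v i - m) ^ 2 + (m - c) ^ 2 := by
      have h : ∀ i ∈ I, p i * (v i - c) ^ 2 = p i * (v i - m) ^ 2
          + 2 * (m - c) * (p i * (v i - m)) + (m - c) ^ 2 * p i := fun i _ => by ring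
      rw [Finset.sum_congr rfl h, Finset.sum_add_distrib, Finset.sum_add_distrib,
        ← Finset.mul_sum, ← Finset.mul_sum, hs, sum_mul_sub_mean hs v]
      ring
    rw [this]; nlinarith [sq_nonneg (m - c)]
  refine h1.trans ?_
  rw [Finset.mul_sum]
  refine Finset.sum_le_sum fun i hi => ?_
  rw [← mul_assoc]
  refine mul_le_mul_of_nonneg_right ?_ (sq_nonneg _)
  have hZ := sum_mul_exp_pos hp hs u
  have hZX : ∑ j ∈ I, p j * Real.exp (u j) ≤ Real.exp X :=
    sum_mul_le_of_le hp hs fun j hj => Real.exp_le_exp.2 (abs_le.1 (hu j hj)).2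
  have h2 : Real.exp (-X) ≤ Real.exp (u i) := Real.exp_le_exp.2 (abs_le.1 (hu i hi)).1
  unfold tilt
  rw [← mul_div_assoc, le_div_iff₀ hZ]
  have h3 : Real.exp (2 * X) * Real.exp (-X) = Real.exp X := by rw [← Real.exp_add]; ring_nf
  calc p i * ∑ j ∈ I, p j * Real.exp (u j) ≤ p i * Real.exp X :=
        mul_le_mul_of_nonneg_left hZX (hp i hi)
    _ = Real.exp (2 * X) * (p i * Real.exp (-X)) := by rw [← h3]; ring
    _ ≤ Real.exp (2 * X) * (p i * Real.exp (u i)) :=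
        mul_le_mul_of_nonneg_left (mul_le_mul_of_nonneg_left h2 (hp i hi)) (Real.exp_pos _).le

/-- Exponential moment of a bounded variable with nonpositive mean. -/
lemma sum_exp_le (hp : ∀ i ∈ I, 0 ≤ p i) (hs : ∑ i ∈ I, p i = 1) {z : ι → ℝ} {c : ℝ}
    (hz : ∀ i ∈ I, |z i| ≤ c) (hz0 : ∑ i ∈ I, p i * z i ≤ 0) :
    ∑ i ∈ I, p i * Real.exp (z i) ≤ Real.exp (c ^ 2) := by
  have h : ∑ i ∈ I, p i * Real.exp (z i) ≤ ∑ i ∈ I, p i * (z i + Real.exp (c ^ 2)) := by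
    refine Finset.sum_le_sum fun i hi => mul_le_mul_of_nonneg_left ?_ (hp i hi)
    have h1 : z i ^ 2 ≤ c ^ 2 := by
      rw [← sq_abs]; exact pow_le_pow_left₀ (abs_nonneg _) (hz i hi) 2
    linarith [exp_le_add_exp_sq (z i), Real.exp_le_exp.2 h1]
  simp only [mul_add, Finset.sum_add_distrib, ← Finset.sum_mul, hs] at h
  linarith

end Tilt

/-! ### Weighted norms, traces and determinants -/

section QuadraticForms

open Matrix
open scoped MatrixOrder

variable {d : ℕ}

/-- The bilinear form `xᵀ B y`. -/
def bilForm (B : Matrix (Fin d) (Fin d) ℝ) (x y : Vec d) : ℝ :=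
  dotProduct x.ofLp (B.mulVec y.ofLp)

lemma inner_eq_dotProduct (x y : Vec d) : inner ℝ x y = x.ofLp ⬝ᵥ y.ofLp := by
  rw [EuclideanSpace.inner_eq_star_dotProduct, star_trivial, dotProduct_comm]

lemma bilForm_add_matrix (A B : Matrix (Fin d) (Fin d) ℝ) (x y : Vec d) :
    bilForm (A + B) x y = bilForm A x y + bilForm B x y := by
  simp [bilForm, Matrix.add_mulVec]

lemma bilForm_smul_matrix (c : ℝ) (A : Matrix (Fin d) (Fin d) ℝ) (x y : Vec d) :
    bilForm (c • A) x y = c * bilForm A x y := by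
  simp [bilForm, Matrix.smul_mulVec]

lemma bilForm_add_left (B : Matrix (Fin d) (Fin d) ℝ) (x y z : Vec d) :
    bilForm B (x + y) z = bilForm B x z + bilForm B y z := by
  simp [bilForm]

lemma bilForm_add_right (B : Matrix (Fin d) (Fin d) ℝ) (x y z : Vec d) :
    bilForm B x (y + z) = bilForm B x y + bilForm B x z := by
  simp [bilForm, Matrix.mulVec_add]

lemma bilForm_smul_left (B : Matrix (Fin d) (Fin d) ℝ) (c : ℝ) (x y : Vec d) :
    bilForm B (c • x) y = c * bilForm B x y := by
  simp [bilForm]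

lemma bilForm_smul_right (B : Matrix (Fin d) (Fin d) ℝ) (c : ℝ) (x y : Vec d) :
    bilForm B x (c • y) = c * bilForm B x y := by
  simp [bilForm, Matrix.mulVec_smul]

lemma bilForm_neg_right (B : Matrix (Fin d) (Fin d) ℝ) (x y : Vec d) :
    bilForm B x (-y) = -bilForm B x y := by
  simp [bilForm, Matrix.mulVec_neg]

lemma bilForm_sub_left (B : Matrix (Fin d) (Fin d) ℝ) (x y z : Vec d) :
    bilForm B (x - y) z = bilForm B x z - bilForm B y z := by
  simp [bilForm]

lemma bilForm_sub_right (B : Matrix (Fin d) (Fin d) ℝ) (x y z : Vec d) :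
    bilForm B x (y - z) = bilForm B x y - bilForm B x z := by
  simp [bilForm, Matrix.mulVec_sub]

lemma bilForm_self (B : Matrix (Fin d) (Fin d) ℝ) (x : Vec d) : bilForm B x x = sqNorm B x := rfl

lemma bilForm_symm {B : Matrix (Fin d) (Fin d) ℝ} (hB : B.IsHermitian) (x y : Vec d) :
    bilForm B x y = bilForm B y x := by
  have hT : Bᵀ = B := by simpa [Matrix.IsHermitian, conjTranspose_eq_transpose_of_trivial] using hB
  unfold bilForm
  rw [dotProduct_mulVec, ← mulVec_transpose, hT, dotProduct_comm]

lemma sqNorm_add_matrix (A B : Matrix (Fin d) (Fin d) ℝ) (x : Vec d) :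
    sqNorm (A + B) x = sqNorm A x + sqNorm B x := bilForm_add_matrix A B x x

lemma sqNorm_smul_matrix (c : ℝ) (A : Matrix (Fin d) (Fin d) ℝ) (x : Vec d) :
    sqNorm (c • A) x = c * sqNorm A x := bilForm_smul_matrix c A x x

lemma sqNorm_one (x : Vec d) : sqNorm (1 : Matrix (Fin d) (Fin d) ℝ) x = ‖x‖ ^ 2 := by
  rw [← real_inner_self_eq_norm_sq, inner_eq_dotProduct]
  simp [sqNorm]

lemma sqNorm_nonneg {B : Matrix (Fin d) (Fin d) ℝ} (hB : B.PosSemidef) (x : Vec d) :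
    0 ≤ sqNorm B x := by
  simpa [sqNorm] using hB.dotProduct_mulVec_nonneg x.ofLp

lemma sqNorm_pos {B : Matrix (Fin d) (Fin d) ℝ} (hB : B.PosDef) {x : Vec d} (hx : x ≠ 0) :
    0 < sqNorm B x := by
  have : x.ofLp ≠ 0 := fun h => hx (by ext i; simp [h])
  simpa [sqNorm] using hB.dotProduct_mulVec_pos this

lemma sqNorm_add {B : Matrix (Fin d) (Fin d) ℝ} (hB : B.IsHermitian) (x y : Vec d) :
    sqNorm B (x + y) = sqNorm B x + 2 * bilForm B x y + sqNorm B y := by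
  simp only [← bilForm_self, bilForm_add_left, bilForm_add_right, bilForm_symm hB y x]
  ring

lemma sqNorm_sub {B : Matrix (Fin d) (Fin d) ℝ} (hB : B.IsHermitian) (x y : Vec d) :
    sqNorm B (x - y) = sqNorm B x - 2 * bilForm B x y + sqNorm B y := by
  simp only [← bilForm_self, bilForm_sub_left, bilForm_sub_right, bilForm_symm hB y x]
  ring

lemma sqNorm_smul (B : Matrix (Fin d) (Fin d) ℝ) (c : ℝ) (x : Vec d) :
    sqNorm B (c • x) = c ^ 2 * sqNorm B x := by
  simp only [← bilForm_self, bilForm_smul_left, bilForm_smul_right]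
  ring

/-- The vector `B⁻¹ x`. -/
def invMul (B : Matrix (Fin d) (Fin d) ℝ) (x : Vec d) : Vec d :=
  WithLp.toLp 2 (B⁻¹.mulVec x.ofLp)

lemma bilForm_invMul {B : Matrix (Fin d) (Fin d) ℝ} (hB : B.PosDef) (x y : Vec d) :
    bilForm B y (invMul B x) = inner ℝ y x := by
  have hu : IsUnit B.det := (Matrix.isUnit_iff_isUnit_det B).1 hB.isUnit
  rw [inner_eq_dotProduct]
  simp [bilForm, invMul, Matrix.mulVec_mulVec, Matrix.mul_nonsing_inv B hu]

lemma inner_invMul (B : Matrix (Fin d) (Fin d) ℝ) (x : Vec d) :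
    inner ℝ x (invMul B x) = sqNorm B⁻¹ x := by
  rw [inner_eq_dotProduct]; rfl

lemma sqNorm_invMul {B : Matrix (Fin d) (Fin d) ℝ} (hB : B.PosDef) (x : Vec d) :
    sqNorm B (invMul B x) = sqNorm B⁻¹ x := by
  rw [← bilForm_self, bilForm_invMul hB, real_inner_comm, inner_invMul]

/-- This is the nonnegativity of the `B`-norm of `y - c B⁻¹x`. As a quadratic in `c` it gives
Cauchy–Schwarz for the dual norms through the discriminant. -/
lemma two_mul_inner_le {B : Matrix (Fin d) (Fin d) ℝ} (hB : B.PosDef) (c : ℝ) (x y : Vec d) :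
    2 * c * inner ℝ x y ≤ c ^ 2 * sqNorm B⁻¹ x + sqNorm B y := by
  have h := sqNorm_nonneg hB.posSemidef (y - c • invMul B x)
  rw [sqNorm_sub hB.isHermitian, sqNorm_smul, bilForm_smul_right, bilForm_invMul hB,
    sqNorm_invMul hB, real_inner_comm] at h
  linarith

lemma sq_inner_le {B : Matrix (Fin d) (Fin d) ℝ} (hB : B.PosDef) (x y : Vec d) :
    inner ℝ x y ^ 2 ≤ sqNorm B⁻¹ x * sqNorm B y := by
  have h0 := sqNorm_nonneg hB.inv.posSemidef x
  have h1 := sqNorm_nonneg hB.posSemidef y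
  have := discrim_le_zero (a := sqNorm B⁻¹ x) (b := -2 * inner ℝ x y) (c := sqNorm B y)
    (fun c => by have := two_mul_inner_le hB c x y; nlinarith)
  unfold discrim at this
  nlinarith

lemma abs_inner_le {B : Matrix (Fin d) (Fin d) ℝ} (hB : B.PosDef) (x y : Vec d) :
    |inner ℝ x y| ≤ √(sqNorm B⁻¹ x) * √(sqNorm B y) := by
  rw [← Real.sqrt_mul (sqNorm_nonneg hB.inv.posSemidef x)]
  exact Real.abs_le_sqrt (sq_inner_le hB x y)

/-- Apply the lower bound to `B⁻¹x`, whose squared `B`-norm is `xᵀB⁻¹x ≤ ‖x‖ ‖B⁻¹x‖`, and eliminate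
`‖B⁻¹x‖`. -/
lemma sqNorm_inv_le {B : Matrix (Fin d) (Fin d) ℝ} (hB : B.PosDef) {l : ℝ} (hl : 0 < l)
    (h : ∀ y : Vec d, l * ‖y‖ ^ 2 ≤ sqNorm B y) (x : Vec d) :
    sqNorm B⁻¹ x ≤ ‖x‖ ^ 2 / l := by
  have h1 := h (invMul B x)
  rw [sqNorm_invMul hB] at h1
  have h2 : sqNorm B⁻¹ x ≤ ‖x‖ * ‖invMul B x‖ := by
    rw [← inner_invMul]; exact real_inner_le_norm _ _
  rw [le_div_iff₀ hl]
  have h3 := sqNorm_nonneg hB.inv.posSemidef x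
  set q := sqNorm B⁻¹ x
  set n := ‖invMul B x‖
  rcases eq_or_lt_of_le h3 with h4 | h4
  · rw [← h4]; nlinarith [sq_nonneg ‖x‖]
  · by_contra! hc
    have h5 : q ^ 2 ≤ (‖x‖ * n) ^ 2 := pow_le_pow_left₀ h3 h2 2
    have h6 : ‖x‖ ^ 2 * (l * n ^ 2) ≤ ‖x‖ ^ 2 * q := mul_le_mul_of_nonneg_left h1 (sq_nonneg _)
    nlinarith

/-- The weighted sum of outer products `∑ p i • v i (v i)ᵀ`. -/
def outerSum {ι : Type*} (I : Finset ι) (p : ι → ℝ) (v : ι → Vec d) :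
    Matrix (Fin d) (Fin d) ℝ :=
  ∑ i ∈ I, p i • Matrix.vecMulVec (v i).ofLp (v i).ofLp

lemma bilForm_zero_matrix (x y : Vec d) : bilForm (0 : Matrix (Fin d) (Fin d) ℝ) x y = 0 := by
  simp [bilForm]

lemma bilForm_vecMulVec (v x y : Vec d) :
    bilForm (Matrix.vecMulVec v.ofLp v.ofLp) x y = inner ℝ v x * inner ℝ v y := by
  simp only [bilForm, inner_eq_dotProduct, Matrix.vecMulVec_mulVec, op_smul_eq_smul,
    dotProduct_comm x.ofLp, smul_dotProduct, smul_eq_mul]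
  ring

lemma bilForm_outerSum {ι : Type*} (I : Finset ι) (p : ι → ℝ) (v : ι → Vec d) (x y : Vec d) :
    bilForm (outerSum I p v) x y = ∑ i ∈ I, p i * (inner ℝ (v i) x * inner ℝ (v i) y) := by
  classical
  unfold outerSum
  induction I using Finset.induction_on with
  | empty => simp [bilForm_zero_matrix]
  | insert a s ha ih =>
    rw [Finset.sum_insert ha, bilForm_add_matrix, ih, Finset.sum_insert ha, bilForm_smul_matrix,
      bilForm_vecMulVec]

lemma sqNorm_outerSum {ι : Type*} (I : Finset ι) (p : ι → ℝ) (v : ι → Vec d) (x : Vec d) :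
    sqNorm (outerSum I p v) x = ∑ i ∈ I, p i * inner ℝ (v i) x ^ 2 := by
  rw [← bilForm_self, bilForm_outerSum]
  simp only [sq]

lemma posSemidef_outerSum {ι : Type*} {I : Finset ι} {p : ι → ℝ} (hp : ∀ i ∈ I, 0 ≤ p i)
    (v : ι → Vec d) : (outerSum I p v).PosSemidef := by
  refine Matrix.posSemidef_sum _ fun i hi => Matrix.PosSemidef.smul ?_ (hp i hi)
  simpa using Matrix.posSemidef_vecMulVec_self_star (v i).ofLp

lemma trace_inv_mul_outerSum {ι : Type*} (B : Matrix (Fin d) (Fin d) ℝ) (I : Finset ι)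
    (p : ι → ℝ) (v : ι → Vec d) :
    (B⁻¹ * outerSum I p v).trace = ∑ i ∈ I, p i * sqNorm B⁻¹ (v i) := by
  unfold outerSum
  rw [Matrix.mul_sum, Matrix.trace_sum]
  refine Finset.sum_congr rfl fun i _ => ?_
  rw [Matrix.mul_smul, Matrix.trace_smul, Matrix.mul_vecMulVec, Matrix.trace_vecMulVec, smul_eq_mul,
    dotProduct_comm]
  rfl

/-- A positive definite matrix is normalized by some congruence. -/
lemma exists_congr_one {B : Matrix (Fin d) (Fin d) ℝ} (hB : B.PosDef) :
    ∃ C : Matrix (Fin d) (Fin d) ℝ, B⁻¹ = Cᵀ * C ∧ C * B * Cᵀ = 1 := by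
  obtain ⟨C, hC⟩ := CStarAlgebra.nonneg_iff_eq_star_mul_self.mp hB.inv.posSemidef.nonneg
  rw [star_eq_conjTranspose, conjTranspose_eq_transpose_of_trivial] at hC
  have hu : IsUnit B.det := (Matrix.isUnit_iff_isUnit_det B).1 hB.isUnit
  refine ⟨C, hC, ?_⟩
  have h1 : (B * Cᵀ) * C = 1 := by
    rw [mul_assoc, ← hC, Matrix.mul_nonsing_inv B hu]
  rw [mul_assoc]
  exact mul_eq_one_comm.1 h1

/-- With `B⁻¹ = CᵀC` the vectors are the rows of `C`. They do not depend on `A`, so comparisons of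
quadratic forms pass to traces. -/
lemma trace_inv_mul_eq_sum {B : Matrix (Fin d) (Fin d) ℝ} (hB : B.PosDef) :
    ∃ w : Fin d → Vec d, ∀ A : Matrix (Fin d) (Fin d) ℝ,
      (B⁻¹ * A).trace = ∑ j, sqNorm A (w j) := by
  obtain ⟨C, hC, -⟩ := exists_congr_one hB
  refine ⟨fun j => WithLp.toLp 2 (C j), fun A => ?_⟩
  rw [hC, mul_assoc, Matrix.trace_mul_comm, Matrix.trace]
  refine Finset.sum_congr rfl fun j _ => ?_
  simp only [Matrix.diag, sqNorm, mul_assoc, dotProduct, mulVec]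
  simp only [Matrix.mul_apply, Matrix.transpose_apply, Finset.mul_sum]

lemma trace_inv_mul_mono {B A A' : Matrix (Fin d) (Fin d) ℝ} (hB : B.PosDef) {c : ℝ}
    (h : ∀ x, sqNorm A x ≤ c * sqNorm A' x) : (B⁻¹ * A).trace ≤ c * (B⁻¹ * A').trace := by
  obtain ⟨w, hw⟩ := trace_inv_mul_eq_sum hB
  rw [hw, hw, Finset.mul_sum]
  exact Finset.sum_le_sum fun j _ => h _

lemma one_add_sum_le_prod {ι : Type*} (s : Finset ι) {f : ι → ℝ} (hf : ∀ i ∈ s, 1 ≤ f i) :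
    1 + ∑ i ∈ s, (f i - 1) ≤ ∏ i ∈ s, f i := by
  classical
  induction s using Finset.induction_on with
  | empty => simp
  | insert a s ha ih =>
    rw [Finset.sum_insert ha, Finset.prod_insert ha]
    have h1 := ih fun i hi => hf i (Finset.mem_insert_of_mem hi)
    have h2 := hf a (Finset.mem_insert_self _ _)
    have h3 : 0 ≤ ∑ i ∈ s, (f i - 1) := Finset.sum_nonneg fun i hi => by
      linarith [hf i (Finset.mem_insert_of_mem hi)]
    nlinarith

lemma eigenvalues_eq_sqNorm {A : Matrix (Fin d) (Fin d) ℝ} (hA : A.IsHermitian) (i : Fin d) :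
    hA.eigenvalues i = sqNorm A (hA.eigenvectorBasis i) := by
  rw [hA.eigenvalues_eq]
  simp [sqNorm]

lemma det_le_pow {A : Matrix (Fin d) (Fin d) ℝ} (hA : A.PosSemidef) {l : ℝ}
    (h : ∀ x, sqNorm A x ≤ l * ‖x‖ ^ 2) : A.det ≤ l ^ d := by
  rw [hA.isHermitian.det_eq_prod_eigenvalues]
  calc ∏ i, ((hA.isHermitian.eigenvalues i : ℝ)) ≤ ∏ _i : Fin d, l :=
        Finset.prod_le_prod (fun i _ => hA.eigenvalues_nonneg i) fun i _ => by
          rw [eigenvalues_eq_sqNorm]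
          refine (h _).trans ?_
          rw [(hA.isHermitian.eigenvectorBasis).norm_eq_one]; simp
    _ = l ^ d := by simp

/-- The eigenvalues of `1 + A` are at least one, and a product of such numbers dominates one plus
the sum of their excesses. -/
lemma one_add_trace_le_det {A : Matrix (Fin d) (Fin d) ℝ} (hA : A.PosSemidef) :
    1 + A.trace ≤ (1 + A).det := by
  have hA1 : (1 + A).IsHermitian := Matrix.isHermitian_one.add hA.isHermitian
  have h1 : ∀ i ∈ Finset.univ, 1 ≤ hA1.eigenvalues i := fun i _ => by
    rw [eigenvalues_eq_sqNorm, sqNorm_add_matrix, sqNorm_one,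
      hA1.eigenvectorBasis.norm_eq_one]
    linarith [sqNorm_nonneg hA (hA1.eigenvectorBasis i)]
  have h2 := one_add_sum_le_prod _ h1
  have h3 : (1 + A).det = ∏ i, hA1.eigenvalues i := by
    simpa using hA1.det_eq_prod_eigenvalues
  have h4 : (1 + A).trace = ∑ i, hA1.eigenvalues i := by
    simpa using hA1.trace_eq_sum_eigenvalues
  rw [h3]
  rw [Matrix.trace_add, Matrix.trace_one] at h4
  simp only [Finset.sum_sub_distrib, ← h4] at h2
  simp at h2
  linarith

/-- The determinant grows by at least the relative trace of a positive semidefinite update. -/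
lemma det_mul_one_add_trace_le {A B : Matrix (Fin d) (Fin d) ℝ} (hB : B.PosDef)
    (hA : A.PosSemidef) : B.det * (1 + (B⁻¹ * A).trace) ≤ (B + A).det := by
  obtain ⟨C, hC, hC1⟩ := exists_congr_one hB
  have h1 : C * (B + A) * Cᵀ = 1 + C * A * Cᵀ := by
    rw [mul_add, add_mul, hC1]
  have h2 : (C * A * Cᵀ).PosSemidef := by
    simpa [conjTranspose_eq_transpose_of_trivial] using hA.mul_mul_conjTranspose_same C
  have h3 := one_add_trace_le_det h2
  have h4 : (C * A * Cᵀ).trace = (B⁻¹ * A).trace := by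
    rw [hC, Matrix.trace_mul_comm, ← mul_assoc]
  have h5 : (C.det) ^ 2 * (B + A).det = (1 + C * A * Cᵀ).det := by
    rw [← h1, Matrix.det_mul, Matrix.det_mul, Matrix.det_transpose]; ring
  have h6 : C.det ^ 2 * B.det = 1 := by
    have := congrArg Matrix.det hC1
    rw [Matrix.det_mul, Matrix.det_mul, Matrix.det_transpose, Matrix.det_one] at this
    linarith
  have h7 := hB.det_pos
  rw [h4, ← h5] at h3
  calc B.det * (1 + (B⁻¹ * A).trace) ≤ B.det * (C.det ^ 2 * (B + A).det) :=
        mul_le_mul_of_nonneg_left h3 h7.le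
    _ = (C.det ^ 2 * B.det) * (B + A).det := by ring
    _ = (B + A).det := by rw [h6, one_mul]

end QuadraticForms

/-! ### The multinomial logistic loss and its derivatives -/

section Loss

variable {S A : Type*} {H d : ℕ} {𝓜 : EpisodicMDP S A H} {φ : S → A → S → Vec d}

lemma sum_exp_inner_pos {s : S} {a : A} (hne : (𝓜.reach s a).Nonempty) (θ : Vec d) :
    0 < ∑ t ∈ 𝓜.reach s a, Real.exp (inner ℝ (φ s a t) θ) :=
  Finset.sum_pos (fun _ _ => Real.exp_pos _) hne

lemma mnlProb_pos {s : S} {a : A} (hne : (𝓜.reach s a).Nonempty) (θ : Vec d) (s' : S) :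
    0 < mnlProb 𝓜 φ θ s a s' :=
  div_pos (Real.exp_pos _) (sum_exp_inner_pos hne θ)

lemma mnlProb_nonneg (θ : Vec d) (s : S) (a : A) (s' : S) : 0 ≤ mnlProb 𝓜 φ θ s a s' :=
  div_nonneg (Real.exp_pos _).le (Finset.sum_nonneg fun _ _ => (Real.exp_pos _).le)

lemma sum_mnlProb {s : S} {a : A} (hne : (𝓜.reach s a).Nonempty) (θ : Vec d) :
    ∑ s' ∈ 𝓜.reach s a, mnlProb 𝓜 φ θ s a s' = 1 := by
  unfold mnlProb
  rw [← Finset.sum_div, div_self (sum_exp_inner_pos hne θ).ne']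

/-- A change of parameter is an exponential tilt of the transition probabilities, so the tilt
estimates apply to the model. -/
lemma mnlProb_eq_tilt {s : S} {a : A} (hne : (𝓜.reach s a).Nonempty) (θ θ' : Vec d) :
    mnlProb 𝓜 φ θ' s a
      = tilt (𝓜.reach s a) (mnlProb 𝓜 φ θ s a) (fun i => inner ℝ (φ s a i) (θ' - θ)) := by
  funext s'
  have hZ := sum_exp_inner_pos (φ := φ) hne θ
  have hZ' := sum_exp_inner_pos (φ := φ) hne θ'
  unfold tilt mnlProb
  have h : ∀ t, Real.exp (inner ℝ (φ s a t) θ) / (∑ t ∈ 𝓜.reach s a,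
        Real.exp (inner ℝ (φ s a t) θ)) * Real.exp (inner ℝ (φ s a t) (θ' - θ))
      = Real.exp (inner ℝ (φ s a t) θ') / ∑ t ∈ 𝓜.reach s a, Real.exp (inner ℝ (φ s a t) θ) :=
    fun t => by
      rw [div_mul_eq_mul_div, ← Real.exp_add, inner_sub_right]; ring_nf
  simp only [h]
  rw [← Finset.sum_div, div_div_div_cancel_right₀ hZ.ne']

lemma inner_centralFeature (θ : Vec d) (s : S) (a : A) (s' : S) (x : Vec d) :
    inner ℝ (centralFeature 𝓜 φ θ s a s') x = inner ℝ (φ s a s') x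
      - ∑ t ∈ 𝓜.reach s a, mnlProb 𝓜 φ θ s a t * inner ℝ (φ s a t) x := by
  unfold centralFeature
  rw [inner_sub_left, sum_inner]
  simp only [real_inner_smul_left]

lemma sum_mnlProb_inner_centralFeature {s : S} {a : A} (hne : (𝓜.reach s a).Nonempty)
    (θ x : Vec d) :
    ∑ s' ∈ 𝓜.reach s a, mnlProb 𝓜 φ θ s a s' * inner ℝ (centralFeature 𝓜 φ θ s a s') x = 0 := by
  simp only [inner_centralFeature]
  exact sum_mul_sub_mean (sum_mnlProb hne θ) _

lemma norm_centralFeature_le {s : S} {a : A} (hne : (𝓜.reach s a).Nonempty) {L : ℝ}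
    (hL : ∀ s' ∈ 𝓜.reach s a, ‖φ s a s'‖ ≤ L) (θ : Vec d) :
    ∀ s' ∈ 𝓜.reach s a, ‖centralFeature 𝓜 φ θ s a s'‖ ≤ 2 * L := by
  intro s' hs'
  have h1 : ‖∑ t ∈ 𝓜.reach s a, mnlProb 𝓜 φ θ s a t • φ s a t‖ ≤ L := by
    calc _ ≤ ∑ t ∈ 𝓜.reach s a, ‖mnlProb 𝓜 φ θ s a t • φ s a t‖ := norm_sum_le _ _
      _ = ∑ t ∈ 𝓜.reach s a, mnlProb 𝓜 φ θ s a t * ‖φ s a t‖ :=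
          Finset.sum_congr rfl fun t _ => by
            rw [norm_smul, Real.norm_of_nonneg (mnlProb_nonneg _ _ _ _)]
      _ ≤ L := sum_mul_le_of_le (fun t _ => mnlProb_nonneg _ _ _ _) (sum_mnlProb hne θ) hL
  unfold centralFeature
  calc _ ≤ ‖φ s a s'‖ + ‖∑ t ∈ 𝓜.reach s a, mnlProb 𝓜 φ θ s a t • φ s a t‖ := norm_sub_le _ _
    _ ≤ 2 * L := by linarith [hL s' hs']

lemma loss_of_mem {s : S} {a : A} {y : S} (hy : y ∈ 𝓜.reach s a) :
    loss 𝓜 φ s a y = fun θ => Real.log (∑ t ∈ 𝓜.reach s a, Real.exp (inner ℝ (φ s a t) θ))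
      - inner ℝ (φ s a y) θ := by
  classical
  funext θ
  have hZ := sum_exp_inner_pos (φ := φ) ⟨y, hy⟩ θ
  have h : loss 𝓜 φ s a y θ = -Real.log (mnlProb 𝓜 φ θ s a y) := by
    simp [loss, hy]
  rw [h, mnlProb, Real.log_div (Real.exp_pos _).ne' hZ.ne', Real.log_exp]
  ring

/-- A run performs its updates on every outcome, including the null set on which an unreachable
state is observed. Since the loss vanishes there, the Gram matrices stay positive definite
everywhere. -/
lemma loss_of_notMem {s : S} {a : A} {y : S} (hy : y ∉ 𝓜.reach s a) :
    loss 𝓜 φ s a y = fun _ => 0 := by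
  classical
  funext θ
  simp [loss, hy]

lemma loss_eq_neg_log {s : S} {a : A} {y : S} (hy : y ∈ 𝓜.reach s a) (θ : Vec d) :
    loss 𝓜 φ s a y θ = -Real.log (mnlProb 𝓜 φ θ s a y) := by
  classical
  simp [loss, hy]

/-- The Bregman divergence of the loss is a cumulant generating function. -/
lemma loss_sub_loss {s : S} {a : A} {y : S} (hy : y ∈ 𝓜.reach s a) (θ θ' : Vec d) :
    loss 𝓜 φ s a y θ' - loss 𝓜 φ s a y θ + inner ℝ (centralFeature 𝓜 φ θ s a y) (θ' - θ)
      = Real.log (∑ i ∈ 𝓜.reach s a, mnlProb 𝓜 φ θ s a i *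
          Real.exp (inner ℝ (centralFeature 𝓜 φ θ s a i) (θ' - θ))) := by
  have hne : (𝓜.reach s a).Nonempty := ⟨y, hy⟩
  have hp : ∀ i ∈ 𝓜.reach s a, 0 ≤ mnlProb 𝓜 φ θ s a i := fun i _ => mnlProb_nonneg _ _ _ _
  have hs := sum_mnlProb (φ := φ) hne θ
  set u : S → ℝ := fun i => inner ℝ (φ s a i) (θ' - θ) with hu
  set m := ∑ t ∈ 𝓜.reach s a, mnlProb 𝓜 φ θ s a t * u t with hm
  have hc : ∀ i, inner ℝ (centralFeature 𝓜 φ θ s a i) (θ' - θ) = u i - m := fun i =>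
    inner_centralFeature _ _ _ _ _
  simp only [hc]
  have hW := sum_mul_exp_pos hp hs (fun i => u i - m)
  have ht : mnlProb 𝓜 φ θ' s a y = tilt (𝓜.reach s a) (mnlProb 𝓜 φ θ s a) (fun i => u i - m) y := by
    rw [tilt_sub_const, mnlProb_eq_tilt hne θ θ']
  rw [loss_eq_neg_log hy, loss_eq_neg_log hy, ht, tilt,
    Real.log_div (mul_pos (mnlProb_pos hne θ y) (Real.exp_pos _)).ne' hW.ne',
    Real.log_mul (mnlProb_pos hne θ y).ne' (Real.exp_pos _).ne', Real.log_exp]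
  ring

lemma hasFDerivAt_sum_exp (s : S) (a : A) (θ : Vec d) :
    HasFDerivAt (fun θ : Vec d => ∑ t ∈ 𝓜.reach s a, Real.exp (inner ℝ (φ s a t) θ))
      (∑ t ∈ 𝓜.reach s a, Real.exp (inner ℝ (φ s a t) θ) • innerSL ℝ (φ s a t)) θ := by
  refine HasFDerivAt.fun_sum fun t _ => ?_
  exact ((innerSL ℝ (φ s a t)).hasFDerivAt (x := θ)).exp

lemma hasFDerivAt_loss {s : S} {a : A} {y : S} (hy : y ∈ 𝓜.reach s a) (θ : Vec d) :
    HasFDerivAt (loss 𝓜 φ s a y)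
      (∑ t ∈ 𝓜.reach s a, mnlProb 𝓜 φ θ s a t • innerSL ℝ (φ s a t) - innerSL ℝ (φ s a y)) θ := by
  have hZ := sum_exp_inner_pos (φ := φ) ⟨y, hy⟩ θ
  rw [loss_of_mem hy]
  have h := (hasFDerivAt_sum_exp (𝓜 := 𝓜) (φ := φ) s a θ).log hZ.ne'
  refine (h.sub ((innerSL ℝ (φ s a y)).hasFDerivAt (x := θ))).congr_fderiv ?_
  rw [Finset.smul_sum]
  congr 1
  refine Finset.sum_congr rfl fun t _ => ?_
  rw [smul_smul, mnlProb]
  congr 1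
  ring

lemma gradient_loss {s : S} {a : A} {y : S} (hy : y ∈ 𝓜.reach s a) (θ : Vec d) :
    gradient (loss 𝓜 φ s a y) θ = -centralFeature 𝓜 φ θ s a y := by
  refine HasGradientAt.gradient ?_
  rw [hasGradientAt_iff_hasFDerivAt]
  refine (hasFDerivAt_loss hy θ).congr_fderiv ?_
  ext x
  simp only [sub_apply, sum_apply,
    smul_apply, innerSL_apply_apply, InnerProductSpace.toDual_apply_apply,
    inner_neg_left, inner_centralFeature, smul_eq_mul]
  ring

lemma hasFDerivAt_mnlProb {s : S} {a : A} (hne : (𝓜.reach s a).Nonempty) (θ : Vec d) (t : S) :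
    HasFDerivAt (fun θ => mnlProb 𝓜 φ θ s a t)
      (mnlProb 𝓜 φ θ s a t • innerSL ℝ (centralFeature 𝓜 φ θ s a t)) θ := by
  have hZ := sum_exp_inner_pos (φ := φ) hne θ
  have h0 : (fun θ => mnlProb 𝓜 φ θ s a t) = fun θ => Real.exp (inner ℝ (φ s a t) θ
      - Real.log (∑ t ∈ 𝓜.reach s a, Real.exp (inner ℝ (φ s a t) θ))) := funext fun θ => by
    rw [Real.exp_sub, Real.exp_log (sum_exp_inner_pos hne θ), mnlProb]
  have h1 := (((innerSL ℝ (φ s a t)).hasFDerivAt (x := θ)).sub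
    ((hasFDerivAt_sum_exp (𝓜 := 𝓜) (φ := φ) s a θ).log hZ.ne')).exp
  rw [h0]
  refine h1.congr_fderiv ?_
  ext x
  simp only [Pi.sub_apply, sub_apply, sum_apply, smul_apply, innerSL_apply_apply,
    inner_centralFeature, smul_eq_mul, mnlProb, Real.exp_sub, Real.exp_log hZ, Finset.mul_sum]
  congr 2
  exact Finset.sum_congr rfl fun _ _ => by ring

/-- The Fisher information matrix of the transition model at `(s, a)`. -/
def fisher (𝓜 : EpisodicMDP S A H) (φ : S → A → S → Vec d) (θ : Vec d) (s : S) (a : A) :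
    Matrix (Fin d) (Fin d) ℝ :=
  outerSum (𝓜.reach s a) (mnlProb 𝓜 φ θ s a) (centralFeature 𝓜 φ θ s a)

/-- The observed state enters the loss only through a linear term, so the second derivative is that
of the log-partition function, the covariance of the features. -/
lemma hessian_loss {s : S} {a : A} {y : S} (hy : y ∈ 𝓜.reach s a) (θ : Vec d) :
    hessian (loss 𝓜 φ s a y) θ = fisher 𝓜 φ θ s a := by
  have hne : (𝓜.reach s a).Nonempty := ⟨y, hy⟩
  have h1 : fderiv ℝ (loss 𝓜 φ s a y) = fun θ =>
      ∑ t ∈ 𝓜.reach s a, mnlProb 𝓜 φ θ s a t • innerSL ℝ (φ s a t) - innerSL ℝ (φ s a y) :=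
    funext fun θ => (hasFDerivAt_loss hy θ).fderiv
  have h2 : HasFDerivAt (fun θ : Vec d =>
      ∑ t ∈ 𝓜.reach s a, mnlProb 𝓜 φ θ s a t • innerSL ℝ (φ s a t) - innerSL ℝ (φ s a y))
      (∑ t ∈ 𝓜.reach s a, (mnlProb 𝓜 φ θ s a t •
        innerSL ℝ (centralFeature 𝓜 φ θ s a t)).smulRight (innerSL ℝ (φ s a t))) θ := by
    refine HasFDerivAt.sub_const _ (HasFDerivAt.fun_sum fun t _ => ?_)
    exact (hasFDerivAt_mnlProb hne θ t).smul_const (innerSL ℝ (φ s a t))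
  ext i j
  rw [hessian, Matrix.of_apply, iteratedFDeriv_two_apply, h1, h2.fderiv]
  simp only [sum_apply, ContinuousLinearMap.smulRight_apply,
    smul_apply, innerSL_apply_apply, smul_eq_mul, Matrix.cons_val_zero,
    Matrix.cons_val_one]
  -- Differentiation centralizes only one of the two features; the other may be centralized as well
  -- because the first has mean zero.
  have h3 : ∑ t ∈ 𝓜.reach s a, mnlProb 𝓜 φ θ s a t *
      inner ℝ (centralFeature 𝓜 φ θ s a t) (EuclideanSpace.single i (1 : ℝ)) *
        inner ℝ (φ s a t) (EuclideanSpace.single j (1 : ℝ))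
      = ∑ t ∈ 𝓜.reach s a, mnlProb 𝓜 φ θ s a t *
      inner ℝ (centralFeature 𝓜 φ θ s a t) (EuclideanSpace.single i (1 : ℝ)) *
        inner ℝ (centralFeature 𝓜 φ θ s a t) (EuclideanSpace.single j (1 : ℝ)) := by
    have h4 := sum_mnlProb_inner_centralFeature (φ := φ) hne θ (EuclideanSpace.single i (1 : ℝ))
    simp only [inner_centralFeature θ s a _ (EuclideanSpace.single j (1 : ℝ)), mul_sub,
      Finset.sum_sub_distrib, ← Finset.sum_mul, h4]
    ring
  rw [h3]
  simp only [fisher, outerSum, Matrix.sum_apply, Matrix.smul_apply, Matrix.vecMulVec_apply,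
    smul_eq_mul, EuclideanSpace.inner_single_right]
  refine Finset.sum_congr rfl fun t _ => ?_
  simp
  ring

lemma hessian_loss_of_notMem {s : S} {a : A} {y : S} (hy : y ∉ 𝓜.reach s a) (θ : Vec d) :
    hessian (loss 𝓜 φ s a y) θ = 0 := by
  ext i j
  rw [hessian, Matrix.of_apply, loss_of_notMem hy, iteratedFDeriv_two_apply]
  simp

lemma posSemidef_fisher (θ : Vec d) (s : S) (a : A) : (fisher 𝓜 φ θ s a).PosSemidef :=
  posSemidef_outerSum (fun _ _ => mnlProb_nonneg _ _ _ _) _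

lemma posSemidef_hessian_loss (s : S) (a : A) (y : S) (θ : Vec d) :
    (hessian (loss 𝓜 φ s a y) θ).PosSemidef := by
  by_cases hy : y ∈ 𝓜.reach s a
  · rw [hessian_loss hy]; exact posSemidef_fisher θ s a
  · rw [hessian_loss_of_notMem hy]; exact Matrix.PosSemidef.zero

lemma sqNorm_fisher_le_exp_mul {s : S} {a : A} (hne : (𝓜.reach s a).Nonempty) {θ θ' : Vec d}
    {X : ℝ} (hX : ∀ i ∈ 𝓜.reach s a, |inner ℝ (φ s a i) (θ' - θ)| ≤ X) (x : Vec d) :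
    sqNorm (fisher 𝓜 φ θ s a) x ≤ Real.exp (2 * X) * sqNorm (fisher 𝓜 φ θ' s a) x := by
  have h := variance_le_tilt_variance (fun i _ => mnlProb_nonneg (𝓜 := 𝓜) (φ := φ) θ s a i)
    (sum_mnlProb hne θ) (v := fun i => inner ℝ (φ s a i) x) hX
  rw [← mnlProb_eq_tilt hne θ θ'] at h
  simpa only [fisher, sqNorm_outerSum, inner_centralFeature] using h

end Loss

/-! ### One step of online mirror descent -/

section MirrorDescent

variable {S A : Type*} {H d : ℕ} {𝓜 : EpisodicMDP S A H} {φ : S → A → S → Vec d}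

lemma nonneg_of_forall_add_mul_nonneg {l c : ℝ}
    (h : ∀ t : ℝ, 0 < t → t ≤ 1 → 0 ≤ l + t * c) : 0 ≤ l := by
  by_contra! hl
  have hc : 0 < |c| + 1 := by positivity
  have ht : 0 < min 1 (-l / (|c| + 1)) := lt_min one_pos (div_pos (by linarith) hc)
  have h1 := h _ ht (min_le_left _ _)
  set t := min 1 (-l / (|c| + 1))
  have h2 : t * (|c| + 1) ≤ -l := by
    rw [← le_div_iff₀ hc]; exact min_le_right _ _
  have h3 : t * c ≤ t * |c| := mul_le_mul_of_nonneg_left (le_abs_self c) ht.le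
  nlinarith

/-- Optimality condition of the mirror descent step. -/
lemma omd_variational {η : ℝ} (hη : 0 < η) {B : Matrix (Fin d) (Fin d) ℝ} {ℓ : Vec d → ℝ}
    {θ₀ θ₁ : Vec d} {Lθ : ℝ} (hB : (B + η • hessian ℓ θ₀).IsHermitian)
    (h1 : θ₁ ∈ Metric.closedBall (0 : Vec d) Lθ)
    (hmin : IsMinOn (omdObjective η B ℓ θ₀) (Metric.closedBall (0 : Vec d) Lθ) θ₁)
    {u : Vec d} (hu : u ∈ Metric.closedBall (0 : Vec d) Lθ) :
    0 ≤ bilForm (B + η • hessian ℓ θ₀) (θ₁ - θ₀) (u - θ₁)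
      + η * inner ℝ (u - θ₁) (gradient ℓ θ₀) := by
  set Bt := B + η • hessian ℓ θ₀ with hBt
  -- The objective along the segment from `θ₁` to `u` is quadratic in `t`. Its increment divided by
  -- `t/η` is the claimed expression plus `t` times this constant.
  apply nonneg_of_forall_add_mul_nonneg (c := sqNorm Bt (u - θ₁) / 2)
  intro t ht ht1
  have hmem : θ₁ + t • (u - θ₁) ∈ Metric.closedBall (0 : Vec d) Lθ :=
    (convex_closedBall (0 : Vec d) Lθ).add_smul_sub_mem h1 hu ⟨ht.le, ht1⟩
  have h2 := isMinOn_iff.1 hmin _ hmem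
  unfold omdObjective at h2
  rw [← hBt, show θ₁ + t • (u - θ₁) - θ₀ = (θ₁ - θ₀) + t • (u - θ₁) by abel,
    sqNorm_add hB, sqNorm_smul, bilForm_smul_right, inner_add_left, real_inner_smul_left] at h2
  have h3 : 0 ≤ 1 / (2 * η) * (2 * (t * bilForm Bt (θ₁ - θ₀) (u - θ₁))
      + t ^ 2 * sqNorm Bt (u - θ₁)) + t * inner ℝ (u - θ₁) (gradient ℓ θ₀) := by
    nlinarith
  have h4 : 1 / (2 * η) * (2 * (t * bilForm Bt (θ₁ - θ₀) (u - θ₁))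
      + t ^ 2 * sqNorm Bt (u - θ₁)) + t * inner ℝ (u - θ₁) (gradient ℓ θ₀)
      = (t / η) * (bilForm Bt (θ₁ - θ₀) (u - θ₁) + η * inner ℝ (u - θ₁) (gradient ℓ θ₀)
        + t * (sqNorm Bt (u - θ₁) / 2)) := by
    field_simp
    ring
  rw [h4] at h3
  exact nonneg_of_mul_nonneg_right h3 (div_pos ht hη)

/-- Adding the two optimality conditions forces the distance to vanish. Uniqueness is what makes the
estimates functions of the observed transitions, and hence measurable. -/
lemma omd_unique {η : ℝ} (hη : 0 < η) {B : Matrix (Fin d) (Fin d) ℝ} {ℓ : Vec d → ℝ}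
    {θ₀ θ₁ θ₂ : Vec d} {Lθ : ℝ} (hB : (B + η • hessian ℓ θ₀).PosDef)
    (h1 : θ₁ ∈ Metric.closedBall (0 : Vec d) Lθ) (h2 : θ₂ ∈ Metric.closedBall (0 : Vec d) Lθ)
    (hmin1 : IsMinOn (omdObjective η B ℓ θ₀) (Metric.closedBall (0 : Vec d) Lθ) θ₁)
    (hmin2 : IsMinOn (omdObjective η B ℓ θ₀) (Metric.closedBall (0 : Vec d) Lθ) θ₂) :
    θ₁ = θ₂ := by
  have e1 := omd_variational hη hB.isHermitian h1 hmin1 h2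
  have e2 := omd_variational hη hB.isHermitian h2 hmin2 h1
  by_contra hne
  have hpos := sqNorm_pos hB (sub_ne_zero.2 hne)
  rw [← bilForm_self] at hpos
  have e3 : θ₂ - θ₁ = -(θ₁ - θ₂) := by abel
  rw [e3, bilForm_neg_right, inner_neg_left] at e1
  have e4 : θ₁ - θ₀ = (θ₂ - θ₀) + (θ₁ - θ₂) := by abel
  rw [e4, bilForm_add_left] at e1
  linarith

lemma abs_inner_le_of_norm {x y : Vec d} {a b : ℝ} (hx : ‖x‖ ≤ a) (hy : ‖y‖ ≤ b) :
    |inner ℝ x y| ≤ a * b :=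
  (abs_real_inner_le_norm x y).trans
    (mul_le_mul hx hy (norm_nonneg _) ((norm_nonneg _).trans hx))

/-- Second order lower bound for the loss, with a constant that is polynomial in the diameter. -/
lemma loss_strong_convexity {s : S} {a : A} {y : S} (hy : y ∈ 𝓜.reach s a) {L Lθ : ℝ}
    (hL0 : 0 ≤ L) (hLθ : 0 ≤ Lθ) (hL : ∀ s' ∈ 𝓜.reach s a, ‖φ s a s'‖ ≤ L) {θ θ' : Vec d}
    (hθ : ‖θ‖ ≤ Lθ) (hθ' : ‖θ'‖ ≤ Lθ) :
    sqNorm (fisher 𝓜 φ θ s a) (θ' - θ) / (4 * (1 + 4 * L * Lθ) ^ 2)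
      ≤ loss 𝓜 φ s a y θ' - loss 𝓜 φ s a y θ
        + inner ℝ (centralFeature 𝓜 φ θ s a y) (θ' - θ) := by
  have hne : (𝓜.reach s a).Nonempty := ⟨y, hy⟩
  rw [loss_sub_loss hy, fisher, sqNorm_outerSum]
  refine variance_le_log_sum_exp (fun i _ => mnlProb_nonneg _ _ _ _) (sum_mnlProb hne θ)
    (by positivity) (sum_mnlProb_inner_centralFeature hne θ _) fun i hi => ?_
  have h1 : ‖θ' - θ‖ ≤ 2 * Lθ := (norm_sub_le _ _).trans (by linarith)
  calc _ ≤ 2 * L * (2 * Lθ) := abs_inner_le_of_norm (norm_centralFeature_le hne hL θ i hi) h1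
    _ = 4 * L * Lθ := by ring

lemma loss_convexity {s : S} {a : A} {y : S} (hy : y ∈ 𝓜.reach s a) (θ θ' : Vec d) :
    0 ≤ loss 𝓜 φ s a y θ' - loss 𝓜 φ s a y θ
        + inner ℝ (centralFeature 𝓜 φ θ s a y) (θ' - θ) := by
  have hne : (𝓜.reach s a).Nonempty := ⟨y, hy⟩
  rw [loss_sub_loss hy]
  exact Real.log_nonneg (one_le_sum_exp (fun i _ => mnlProb_nonneg _ _ _ _) (sum_mnlProb hne θ)
    (sum_mnlProb_inner_centralFeature hne θ _))

lemma bilForm_fisher {s : S} {a : A} (hne : (𝓜.reach s a).Nonempty) (θ x z : Vec d) :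
    bilForm (fisher 𝓜 φ θ s a) x z = ∑ i ∈ 𝓜.reach s a, mnlProb 𝓜 φ θ s a i *
      (inner ℝ (centralFeature 𝓜 φ θ s a i) x * inner ℝ (φ s a i) z) := by
  have h4 := sum_mnlProb_inner_centralFeature (φ := φ) hne θ x
  simp only [fisher, bilForm_outerSum, inner_centralFeature θ s a _ z, mul_sub,
      Finset.sum_sub_distrib, ← mul_assoc, ← Finset.sum_mul, h4]
  ring

/-- The gradient of the loss agrees with its linearization up to a quadratic error. -/
lemma abs_centralFeature_sub_le {s : S} {a : A} (hne : (𝓜.reach s a).Nonempty) (y : S)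
    {L b : ℝ} (hL0 : 0 ≤ L) (hb : 0 ≤ b) (hL : ∀ s' ∈ 𝓜.reach s a, ‖φ s a s'‖ ≤ L)
    {θ₀ θ₁ z : Vec d} (hz : ‖z‖ ≤ b) :
    |inner ℝ (centralFeature 𝓜 φ θ₀ s a y) z - inner ℝ (centralFeature 𝓜 φ θ₁ s a y) z
      - bilForm (fisher 𝓜 φ θ₀ s a) (θ₁ - θ₀) z| ≤ 12 * (L * b) * (L * ‖θ₁ - θ₀‖) ^ 2 := by
  have h := tilt_taylor (fun i _ => mnlProb_nonneg (𝓜 := 𝓜) (φ := φ) θ₀ s a i)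
    (sum_mnlProb hne θ₀) (u := fun i => inner ℝ (φ s a i) (θ₁ - θ₀))
    (V := fun i => inner ℝ (φ s a i) z) (X := L * ‖θ₁ - θ₀‖) (b := L * b)
    (by positivity) (by positivity) (fun i hi => abs_inner_le_of_norm (hL i hi) le_rfl)
    (fun i hi => abs_inner_le_of_norm (hL i hi) hz)
  rw [← mnlProb_eq_tilt hne θ₀ θ₁] at h
  rw [bilForm_fisher hne]
  convert h using 2
  simp only [inner_centralFeature]
  ring

variable {L Lθ lam η : ℝ}

/-- One step of mirror descent contracts the weighted distance up to the excess loss. -/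
lemma omd_step {s : S} {a : A} {y : S} (hy : y ∈ 𝓜.reach s a)
    (hL0 : 0 < L) (hLθ : 0 < Lθ) (hη : 0 < η) (hL : ∀ s' ∈ 𝓜.reach s a, ‖φ s a s'‖ ≤ L)
    (hη1 : 2 * (1 + 4 * L * Lθ) ^ 2 ≤ η) (hlam : 96 * η * L ^ 3 * Lθ ≤ lam)
    {B : Matrix (Fin d) (Fin d) ℝ} (hB : B.PosDef) (hBl : ∀ x, lam * ‖x‖ ^ 2 ≤ sqNorm B x)
    {θ₀ θ₁ θs : Vec d} (h1 : ‖θ₁‖ ≤ Lθ) (hs : ‖θs‖ ≤ Lθ)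
    (hmin : IsMinOn (omdObjective η B (loss 𝓜 φ s a y) θ₀)
      (Metric.closedBall (0 : Vec d) Lθ) θ₁) :
    sqNorm (B + fisher 𝓜 φ θ₁ s a) (θ₁ - θs) ≤ sqNorm B (θ₀ - θs)
      + 2 * η * (loss 𝓜 φ s a y θs - loss 𝓜 φ s a y θ₁) - sqNorm B (θ₁ - θ₀) / 2 := by
  have hne : (𝓜.reach s a).Nonempty := ⟨y, hy⟩
  have hBt : (B + η • hessian (loss 𝓜 φ s a y) θ₀).IsHermitian :=
    (hB.add_posSemidef ((posSemidef_hessian_loss s a y θ₀).smul hη.le)).isHermitian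
  have hv := omd_variational hη hBt (by simpa using h1) hmin (u := θs) (by simpa using hs)
  rw [hessian_loss hy, gradient_loss hy, bilForm_add_matrix, bilForm_smul_matrix,
    show θs - θ₁ = -(θ₁ - θs) by abel, bilForm_neg_right, bilForm_neg_right, inner_neg_left,
    inner_neg_right, real_inner_comm] at hv
  have hΔ : ‖θ₁ - θs‖ ≤ 2 * Lθ := (norm_sub_le _ _).trans (by linarith)
  have ht := (abs_le.1 (abs_centralFeature_sub_le hne y hL0.le (by positivity) hL
    (θ₀ := θ₀) (θ₁ := θ₁) hΔ)).2
  have hc := loss_strong_convexity hy hL0.le hLθ.le hL h1 hs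
  have e1 : sqNorm B (θ₀ - θs) = sqNorm B (θ₁ - θs) - 2 * bilForm B (θ₁ - θ₀) (θ₁ - θs)
      + sqNorm B (θ₁ - θ₀) := by
    rw [show θ₀ - θs = (θ₁ - θs) - (θ₁ - θ₀) by abel, sqNorm_sub hB.isHermitian,
      bilForm_symm hB.isHermitian (θ₁ - θs)]
  have e2 : sqNorm (fisher 𝓜 φ θ₁ s a) (θs - θ₁) = sqNorm (fisher 𝓜 φ θ₁ s a) (θ₁ - θs) := by
    rw [show θs - θ₁ = (-1 : ℝ) • (θ₁ - θs) by rw [neg_one_smul]; abel, sqNorm_smul]; ring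
  rw [e2, show θs - θ₁ = -(θ₁ - θs) by abel, inner_neg_right] at hc
  have hF := sqNorm_nonneg (posSemidef_fisher (𝓜 := 𝓜) (φ := φ) θ₁ s a) (θ₁ - θs)
  -- The lower bound on `η` makes the strong convexity, multiplied by `2η`, pay for the whole new
  -- Fisher term in the Gram matrix.
  have e3 : sqNorm (fisher 𝓜 φ θ₁ s a) (θ₁ - θs) ≤ 2 * η *
      (sqNorm (fisher 𝓜 φ θ₁ s a) (θ₁ - θs) / (4 * (1 + 4 * L * Lθ) ^ 2)) := by
    rw [← mul_div_assoc, le_div_iff₀ (by positivity)]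
    nlinarith
  -- The optimality condition contains the gradient linearized at `θ₀`, whereas convexity is used at
  -- `θ₁`. The discrepancy `48 η L³ Lθ ‖θ₁ - θ₀‖²` is absorbed by half of the proximal term.
  have e4 : 2 * η * (12 * (L * (2 * Lθ)) * (L * ‖θ₁ - θ₀‖) ^ 2) ≤ sqNorm B (θ₁ - θ₀) / 2 := by
    have := hBl (θ₁ - θ₀)
    have h5 := mul_le_mul_of_nonneg_right hlam (sq_nonneg ‖θ₁ - θ₀‖)
    nlinarith
  rw [sqNorm_add_matrix]
  have hc' := mul_le_mul_of_nonneg_left hc (by positivity : 0 ≤ 2 * η)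
  have ht' := mul_le_mul_of_nonneg_left ht (by positivity : 0 ≤ 2 * η)
  linarith

/-- Convexity at `θ₀`, then Young's inequality. It moves the loss from the new estimate to the old
one, which is known before the transition. The weight `1/(4η)` is chosen so that, after
multiplication by `2η`, the proximal term left over in `omd_step` cancels it. -/
lemma loss_sub_le {s : S} {a : A} {y : S} (hy : y ∈ 𝓜.reach s a) (hη : 0 < η)
    {B : Matrix (Fin d) (Fin d) ℝ} (hB : B.PosDef) (θ₀ θ₁ : Vec d) :
    loss 𝓜 φ s a y θ₀ - loss 𝓜 φ s a y θ₁ ≤ η * sqNorm B⁻¹ (centralFeature 𝓜 φ θ₀ s a y)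
      + sqNorm B (θ₁ - θ₀) / (4 * η) := by
  have h1 := loss_convexity (φ := φ) hy θ₀ θ₁
  have h2 := two_mul_inner_le hB (2 * η) (centralFeature 𝓜 φ θ₀ s a y) (θ₁ - θ₀)
  have h3 : inner ℝ (centralFeature 𝓜 φ θ₀ s a y) (θ₁ - θ₀)
      ≤ η * sqNorm B⁻¹ (centralFeature 𝓜 φ θ₀ s a y) + sqNorm B (θ₁ - θ₀) / (4 * η) := by
    have : sqNorm B (θ₁ - θ₀) / (4 * η) * (4 * η) = sqNorm B (θ₁ - θ₀) := by field_simp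
    by_contra! hc
    have := mul_lt_mul_of_pos_right hc (by positivity : 0 < 4 * η)
    nlinarith
  linarith

/-- Test the optimality condition with `u = θ₀`: the squared step length is at most the step length
times the gradient norm, which is at most `2L`. -/
lemma omd_step_norm_le {s : S} {a : A} {y : S} (hy : y ∈ 𝓜.reach s a)
    (hη : 0 < η) (hL : ∀ s' ∈ 𝓜.reach s a, ‖φ s a s'‖ ≤ L)
    {B : Matrix (Fin d) (Fin d) ℝ} (hB : B.PosDef) (hBl : ∀ x, lam * ‖x‖ ^ 2 ≤ sqNorm B x)
    {θ₀ θ₁ : Vec d} (h0 : ‖θ₀‖ ≤ Lθ) (h1 : ‖θ₁‖ ≤ Lθ)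
    (hmin : IsMinOn (omdObjective η B (loss 𝓜 φ s a y) θ₀)
      (Metric.closedBall (0 : Vec d) Lθ) θ₁) :
    lam * ‖θ₁ - θ₀‖ ≤ 2 * η * L := by
  have hne : (𝓜.reach s a).Nonempty := ⟨y, hy⟩
  have hBt : (B + η • hessian (loss 𝓜 φ s a y) θ₀).IsHermitian :=
    (hB.add_posSemidef ((posSemidef_hessian_loss s a y θ₀).smul hη.le)).isHermitian
  have hv := omd_variational hη hBt (by simpa using h1) hmin (u := θ₀) (by simpa using h0)
  rw [hessian_loss hy, gradient_loss hy, bilForm_add_matrix, bilForm_smul_matrix,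
    show θ₀ - θ₁ = -(θ₁ - θ₀) by abel, bilForm_neg_right, bilForm_neg_right, inner_neg_left,
    inner_neg_right, real_inner_comm, bilForm_self, bilForm_self] at hv
  have hF := sqNorm_nonneg (posSemidef_fisher (𝓜 := 𝓜) (φ := φ) θ₀ s a) (θ₁ - θ₀)
  have hi := (abs_le.1 (abs_inner_le_of_norm (norm_centralFeature_le hne hL θ₀ y hy)
    (le_refl ‖θ₁ - θ₀‖))).2
  have hb := hBl (θ₁ - θ₀)
  rcases eq_or_lt_of_le (norm_nonneg (θ₁ - θ₀)) with hz | hz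
  · have hL' : 0 ≤ L := (norm_nonneg _).trans (hL y hy)
    rw [← hz]; simp only [mul_zero]; positivity
  · have h5 : lam * ‖θ₁ - θ₀‖ ^ 2 ≤ 2 * η * L * ‖θ₁ - θ₀‖ := by
      have := mul_le_mul_of_nonneg_left hi hη.le
      have := mul_nonneg hη.le hF
      nlinarith
    have : lam * ‖θ₁ - θ₀‖ * ‖θ₁ - θ₀‖ ≤ 2 * η * L * ‖θ₁ - θ₀‖ := by nlinarith
    exact le_of_mul_le_mul_right this hz

/-- The sum of the information gains of a transition, `∑ P_θ ‖φ̄‖²_{B⁻¹}`. -/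
def infoGain (𝓜 : EpisodicMDP S A H) (φ : S → A → S → Vec d) (B : Matrix (Fin d) (Fin d) ℝ)
    (θ : Vec d) (s : S) (a : A) : ℝ :=
  ∑ s' ∈ 𝓜.reach s a, mnlProb 𝓜 φ θ s a s' * sqNorm B⁻¹ (centralFeature 𝓜 φ θ s a s')

lemma infoGain_eq_trace (B : Matrix (Fin d) (Fin d) ℝ) (θ : Vec d) (s : S) (a : A) :
    infoGain 𝓜 φ B θ s a = (B⁻¹ * fisher 𝓜 φ θ s a).trace :=
  (trace_inv_mul_outerSum _ _ _ _).symm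

lemma infoGain_nonneg {B : Matrix (Fin d) (Fin d) ℝ} (hB : B.PosDef) (θ : Vec d) (s : S) (a : A) :
    0 ≤ infoGain 𝓜 φ B θ s a :=
  Finset.sum_nonneg fun _ _ => mul_nonneg (mnlProb_nonneg _ _ _ _)
    (sqNorm_nonneg hB.inv.posSemidef _)

lemma sqNorm_inv_centralFeature_le {s : S} {a : A} (hne : (𝓜.reach s a).Nonempty)
    (hL : ∀ s' ∈ 𝓜.reach s a, ‖φ s a s'‖ ≤ L) (hlam : 0 < lam)
    {B : Matrix (Fin d) (Fin d) ℝ} (hB : B.PosDef) (hBl : ∀ x, lam * ‖x‖ ^ 2 ≤ sqNorm B x)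
    (θ : Vec d) : ∀ s' ∈ 𝓜.reach s a,
      sqNorm B⁻¹ (centralFeature 𝓜 φ θ s a s') ≤ 4 * L ^ 2 / lam := by
  intro s' hs'
  refine (sqNorm_inv_le hB hlam hBl _).trans (div_le_div_of_nonneg_right ?_ hlam.le)
  calc _ ≤ (2 * L) ^ 2 :=
        pow_le_pow_left₀ (norm_nonneg _) (norm_centralFeature_le hne hL θ s' hs') 2
    _ = 4 * L ^ 2 := by ring

lemma infoGain_le {s : S} {a : A} (hne : (𝓜.reach s a).Nonempty)
    (hL : ∀ s' ∈ 𝓜.reach s a, ‖φ s a s'‖ ≤ L) (hlam : 0 < lam)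
    {B : Matrix (Fin d) (Fin d) ℝ} (hB : B.PosDef) (hBl : ∀ x, lam * ‖x‖ ^ 2 ≤ sqNorm B x)
    (θ : Vec d) : infoGain 𝓜 φ B θ s a ≤ 4 * L ^ 2 / lam :=
  sum_mul_le_of_le (fun _ _ => mnlProb_nonneg _ _ _ _) (sum_mnlProb hne θ)
    (sqNorm_inv_centralFeature_le hne hL hlam hB hBl θ)

/-- Short steps move each exponent by at most `1/4`, which changes the Fisher matrix by a factor of
at most `exp (1/2) ≤ 2`. -/
lemma infoGain_le_two_mul {s : S} {a : A} (hne : (𝓜.reach s a).Nonempty) (hL0 : 0 < L)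
    (hL : ∀ s' ∈ 𝓜.reach s a, ‖φ s a s'‖ ≤ L) (hlam : 8 * η * L ^ 2 ≤ lam) (hlam0 : 0 < lam)
    {B : Matrix (Fin d) (Fin d) ℝ} (hB : B.PosDef)
    {θ₀ θ₁ : Vec d} (hstep : lam * ‖θ₁ - θ₀‖ ≤ 2 * η * L) :
    infoGain 𝓜 φ B θ₀ s a ≤ 2 * infoGain 𝓜 φ B θ₁ s a := by
  rw [infoGain_eq_trace, infoGain_eq_trace]
  refine trace_inv_mul_mono hB fun x => ?_
  have hX : ∀ i ∈ 𝓜.reach s a, |inner ℝ (φ s a i) (θ₁ - θ₀)| ≤ 1 / 4 := fun i hi => by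
    refine (abs_inner_le_of_norm (hL i hi) le_rfl).trans ?_
    have h1 : lam * (L * ‖θ₁ - θ₀‖) ≤ lam * (1 / 4) := by nlinarith
    exact le_of_mul_le_mul_left h1 hlam0
  refine (sqNorm_fisher_le_exp_mul hne hX x).trans ?_
  refine mul_le_mul_of_nonneg_right ?_ (sqNorm_nonneg (posSemidef_fisher θ₁ s a) x)
  have := exp_le_one_add_two_mul (x := 2 * (1 / 4)) (by norm_num) (by norm_num)
  linarith

end MirrorDescent

/-! ### Deterministic analysis of a mirror descent path -/

section Path

variable {S A : Type*} {H d : ℕ} {𝓜 : EpisodicMDP S A H} {φ : S → A → S → Vec d}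
  {L Lθ lam η : ℝ} {K : ℕ} {θ : ℕ → Vec d} {B : ℕ → Matrix (Fin d) (Fin d) ℝ}
  {s : ℕ → S} {a : ℕ → A} {y : ℕ → S}

/-- The estimates `θ k` and Gram matrices `B k` that online mirror descent computes from the
observed transitions `(s k, a k) → y k`, `k < K`. -/
structure OMDPath (𝓜 : EpisodicMDP S A H) (φ : S → A → S → Vec d) (Lθ lam η : ℝ) (K : ℕ)
    (θ : ℕ → Vec d) (B : ℕ → Matrix (Fin d) (Fin d) ℝ) (s : ℕ → S) (a : ℕ → A) (y : ℕ → S) :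
    Prop where
  theta_zero : θ 0 = 0
  gram_zero : B 0 = lam • (1 : Matrix (Fin d) (Fin d) ℝ)
  theta_mem : ∀ k < K, θ (k + 1) ∈ Metric.closedBall (0 : Vec d) Lθ
  theta_min : ∀ k < K, IsMinOn (omdObjective η (B k) (loss 𝓜 φ (s k) (a k) (y k)) (θ k))
    (Metric.closedBall (0 : Vec d) Lθ) (θ (k + 1))
  gram_succ : ∀ k < K, B (k + 1) = B k + hessian (loss 𝓜 φ (s k) (a k) (y k)) (θ (k + 1))

lemma OMDPath.posDef (P : OMDPath 𝓜 φ Lθ lam η K θ B s a y) (hlam : 0 < lam) :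
    ∀ k ≤ K, (B k).PosDef ∧ ∀ x, lam * ‖x‖ ^ 2 ≤ sqNorm (B k) x := by
  intro k
  induction k with
  | zero =>
    intro _
    rw [P.gram_zero]
    exact ⟨Matrix.PosDef.one.smul hlam, fun x => by rw [sqNorm_smul_matrix, sqNorm_one]⟩
  | succ k ih =>
    intro hk
    obtain ⟨h1, h2⟩ := ih (by omega)
    rw [P.gram_succ k (by omega)]
    have hp := posSemidef_hessian_loss (𝓜 := 𝓜) (φ := φ) (s k) (a k) (y k) (θ (k + 1))
    refine ⟨h1.add_posSemidef hp, fun x => ?_⟩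
    rw [sqNorm_add_matrix]
    linarith [h2 x, sqNorm_nonneg hp x]

lemma OMDPath.norm_theta_le (P : OMDPath 𝓜 φ Lθ lam η K θ B s a y) (hLθ : 0 ≤ Lθ) :
    ∀ k ≤ K, ‖θ k‖ ≤ Lθ := by
  intro k hk
  cases k with
  | zero => rw [P.theta_zero, norm_zero]; exact hLθ
  | succ k => simpa using P.theta_mem k (by omega)

/-- Two runs of mirror descent on the same transitions agree. -/
lemma OMDPath.unique {θ' : ℕ → Vec d} {B' : ℕ → Matrix (Fin d) (Fin d) ℝ}
    {s' : ℕ → S} {a' : ℕ → A} {y' : ℕ → S}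
    (P : OMDPath 𝓜 φ Lθ lam η K θ B s a y) (P' : OMDPath 𝓜 φ Lθ lam η K θ' B' s' a' y')
    (hlam : 0 < lam) (hη : 0 < η) {n : ℕ} (hn : n ≤ K)
    (h : ∀ k < n, s k = s' k ∧ a k = a' k ∧ y k = y' k) : θ n = θ' n ∧ B n = B' n := by
  induction n with
  | zero => rw [P.theta_zero, P'.theta_zero, P.gram_zero, P'.gram_zero]; exact ⟨rfl, rfl⟩
  | succ n ih =>
    obtain ⟨i1, i2⟩ := ih (by omega) fun k hk => h k (by omega)
    obtain ⟨e1, e2, e3⟩ := h n (by omega)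
    have m1 := P.theta_min n (by omega)
    have m2 := P'.theta_min n (by omega)
    rw [← e1, ← e2, ← e3, ← i1, ← i2] at m2
    have hθ : θ (n + 1) = θ' (n + 1) := omd_unique hη
      ((P.posDef hlam n (by omega)).1.add_posSemidef ((posSemidef_hessian_loss _ _ _ _).smul hη.le))
      (P.theta_mem n (by omega)) (P'.theta_mem n (by omega)) m1 m2
    refine ⟨hθ, ?_⟩
    rw [P.gram_succ n (by omega), P'.gram_succ n (by omega), hθ, i2, e1, e2, e3]

lemma half_le_log_one_add {x : ℝ} (h0 : 0 ≤ x) (h1 : x ≤ 1) : x / 2 ≤ Real.log (1 + x) := by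
  have h := Real.one_sub_inv_le_log_of_pos (by linarith : 0 < 1 + x)
  have h2 : 1 - (1 + x)⁻¹ = x / (1 + x) := by field_simp; ring
  have h3 : x / 2 ≤ x / (1 + x) := div_le_div_of_nonneg_left h0 (by linarith) (by linarith)
  linarith

lemma sqNorm_fisher_le {s : S} {a : A} (hne : (𝓜.reach s a).Nonempty)
    (hL : ∀ s' ∈ 𝓜.reach s a, ‖φ s a s'‖ ≤ L) (θ x : Vec d) :
    sqNorm (fisher 𝓜 φ θ s a) x ≤ 4 * L ^ 2 * ‖x‖ ^ 2 := by
  rw [fisher, sqNorm_outerSum]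
  refine sum_mul_le_of_le (fun _ _ => mnlProb_nonneg _ _ _ _) (sum_mnlProb hne θ) fun i hi => ?_
  have h := abs_inner_le_of_norm (norm_centralFeature_le hne hL θ i hi) (le_refl ‖x‖)
  rw [← sq_abs]
  calc _ ≤ (2 * L * ‖x‖) ^ 2 := pow_le_pow_left₀ (abs_nonneg _) h 2
    _ = _ := by ring

/-- Elliptical potential: the total information gain is logarithmic. -/
lemma OMDPath.sum_infoGain_le (P : OMDPath 𝓜 φ Lθ lam η K θ B s a y)
    (hy : ∀ k < K, y k ∈ 𝓜.reach (s k) (a k))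
    (hL : ∀ s a, ∀ s' ∈ 𝓜.reach s a, ‖φ s a s'‖ ≤ L) (hlam : 0 < lam) (hlam2 : 4 * L ^ 2 ≤ lam)
    {n : ℕ} (hn : n ≤ K) :
    ∑ k ∈ Finset.range n, infoGain 𝓜 φ (B k) (θ (k + 1)) (s k) (a k)
      ≤ 2 * d * Real.log (1 + n) := by
  -- The gain is the relative trace of the Gram update, so each one is at most twice the increment
  -- of `log det`; gains are at most `1` because `4L² ≤ lam`.
  have hdet : ∀ m ≤ K, ∑ k ∈ Finset.range m, infoGain 𝓜 φ (B k) (θ (k + 1)) (s k) (a k)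
      ≤ 2 * (Real.log (B m).det - Real.log (B 0).det) := by
    intro m
    induction m with
    | zero => intro _; simp
    | succ m ih =>
      intro hm
      have ih := ih (by omega)
      obtain ⟨hB, hBl⟩ := P.posDef hlam m (by omega)
      rw [Finset.sum_range_succ]
      have hym := hy m (by omega)
      set x := infoGain 𝓜 φ (B m) (θ (m + 1)) (s m) (a m) with hx
      have hx0 : 0 ≤ x := infoGain_nonneg hB _ _ _
      have hx1 : x ≤ 1 := (infoGain_le ⟨_, hym⟩ (hL _ _) hlam hB hBl _).trans
        ((div_le_one hlam).2 hlam2)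
      have h1 := det_mul_one_add_trace_le hB
        (posSemidef_fisher (𝓜 := 𝓜) (φ := φ) (θ (m + 1)) (s m) (a m))
      rw [← infoGain_eq_trace, ← hx, ← hessian_loss hym, ← P.gram_succ m (by omega)] at h1
      have h2 := Real.log_le_log (mul_pos hB.det_pos (by linarith)) h1
      rw [Real.log_mul hB.det_pos.ne' (by linarith)] at h2
      have := half_le_log_one_add hx0 hx1
      linarith
  have hup : ∀ m ≤ K, ∀ x, sqNorm (B m) x ≤ lam * (1 + m) * ‖x‖ ^ 2 := by
    intro m
    induction m with
    | zero => intro _ x; rw [P.gram_zero, sqNorm_smul_matrix, sqNorm_one]; simp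
    | succ m ih =>
      intro hm x
      have hym := hy m (by omega)
      have h1 := ih (by omega) x
      have h2 := sqNorm_fisher_le ⟨_, hym⟩ (hL (s m) (a m)) (θ (m + 1)) x
      rw [P.gram_succ m (by omega), hessian_loss hym, sqNorm_add_matrix]
      have h3 := mul_le_mul_of_nonneg_right hlam2 (sq_nonneg ‖x‖)
      push_cast
      nlinarith
  have h1 := hdet n hn
  have hB := (P.posDef hlam n hn).1
  have h2 := Real.log_le_log hB.det_pos (det_le_pow hB.posSemidef (hup n hn))
  have h3 : Real.log (B 0).det = d * Real.log lam := by
    rw [P.gram_zero, Matrix.det_smul, Matrix.det_one, mul_one, Real.log_pow]; simp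
  have hn0 : (0 : ℝ) < 1 + n := by positivity
  rw [Real.log_pow, Real.log_mul hlam.ne' hn0.ne'] at h2
  rw [h3] at h1
  linarith

lemma OMDPath.step_norm_le (P : OMDPath 𝓜 φ Lθ lam η K θ B s a y)
    (hy : ∀ k < K, y k ∈ 𝓜.reach (s k) (a k)) (hLθ : 0 ≤ Lθ) (hη : 0 < η)
    (hL : ∀ s a, ∀ s' ∈ 𝓜.reach s a, ‖φ s a s'‖ ≤ L) (hlam : 0 < lam) {k : ℕ} (hk : k < K) :
    lam * ‖θ (k + 1) - θ k‖ ≤ 2 * η * L :=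
  omd_step_norm_le (hy k hk) hη (hL _ _) (P.posDef hlam k hk.le).1 (P.posDef hlam k hk.le).2
    (P.norm_theta_le hLθ k hk.le) (P.norm_theta_le hLθ (k + 1) hk) (P.theta_min k hk)

/-- The Gram matrix grows by the Fisher matrix at the new estimate, but the likelihood process and
the widths involve the predictable old estimate; the exchange costs a factor two. -/
lemma OMDPath.sum_infoGain_old_le (P : OMDPath 𝓜 φ Lθ lam η K θ B s a y)
    (hy : ∀ k < K, y k ∈ 𝓜.reach (s k) (a k)) (hL0 : 0 < L) (hLθ : 0 ≤ Lθ) (hη : 0 < η)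
    (hL : ∀ s a, ∀ s' ∈ 𝓜.reach s a, ‖φ s a s'‖ ≤ L) (hlam : 0 < lam) (hlam2 : 4 * L ^ 2 ≤ lam)
    (hlam8 : 8 * η * L ^ 2 ≤ lam) {n : ℕ} (hn : n ≤ K) :
    ∑ k ∈ Finset.range n, infoGain 𝓜 φ (B k) (θ k) (s k) (a k)
      ≤ 4 * d * Real.log (1 + n) := by
  calc _ ≤ ∑ k ∈ Finset.range n, 2 * infoGain 𝓜 φ (B k) (θ (k + 1)) (s k) (a k) := by
        refine Finset.sum_le_sum fun k hk => ?_
        have hk : k < K := by have := Finset.mem_range.1 hk; omega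
        exact infoGain_le_two_mul ⟨_, hy k hk⟩ hL0 (hL _ _) hlam8 hlam
          (P.posDef hlam k hk.le).1 (P.step_norm_le hy hLθ hη hL hlam hk)
    _ ≤ _ := by
        rw [← Finset.mul_sum]
        linarith [P.sum_infoGain_le hy hL hlam hlam2 hn]

/-- The logarithm of a factor of the likelihood ratio process for the true parameter `θs`. -/
def logRatio (𝓜 : EpisodicMDP S A H) (φ : S → A → S → Vec d) (η : ℝ) (θs : Vec d)
    (B : Matrix (Fin d) (Fin d) ℝ) (θ : Vec d) (s : S) (a : A) (y : S) : ℝ :=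
  Real.log (mnlProb 𝓜 φ θ s a y) - Real.log (mnlProb 𝓜 φ θs s a y)
    + η * sqNorm B⁻¹ (centralFeature 𝓜 φ θ s a y) - 2 * η * infoGain 𝓜 φ B θ s a

/-- The distance to the true parameter is controlled by the likelihood ratio process. -/
lemma OMDPath.sqNorm_sub_le (P : OMDPath 𝓜 φ Lθ lam η K θ B s a y)
    (hy : ∀ k < K, y k ∈ 𝓜.reach (s k) (a k)) (hL0 : 0 < L) (hLθ : 0 < Lθ)
    (hL : ∀ s a, ∀ s' ∈ 𝓜.reach s a, ‖φ s a s'‖ ≤ L) (hlam2 : 4 * L ^ 2 ≤ lam)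
    (hlam8 : 8 * η * L ^ 2 ≤ lam) (hlam96 : 96 * η * L ^ 3 * Lθ ≤ lam)
    (hη1 : 2 * (1 + 4 * L * Lθ) ^ 2 ≤ η) {θs : Vec d} (hs : ‖θs‖ ≤ Lθ) {n : ℕ} (hn : n ≤ K) :
    sqNorm (B n) (θ n - θs) ≤ lam * Lθ ^ 2
      + 2 * η * ∑ k ∈ Finset.range n, logRatio 𝓜 φ η θs (B k) (θ k) (s k) (a k) (y k)
      + 16 * η ^ 2 * d * Real.log (1 + n) := by
  have hlam : 0 < lam := by nlinarith [pow_pos hL0 2]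
  have hη : 0 < η := by
    have : 0 < 2 * (1 + 4 * L * Lθ) ^ 2 := by positivity
    linarith
  have hmain : ∀ m ≤ K, sqNorm (B m) (θ m - θs) ≤ lam * Lθ ^ 2
      + 2 * η * ∑ k ∈ Finset.range m, logRatio 𝓜 φ η θs (B k) (θ k) (s k) (a k) (y k)
      + 4 * η ^ 2 * ∑ k ∈ Finset.range m, infoGain 𝓜 φ (B k) (θ k) (s k) (a k) := by
    intro m
    induction m with
    | zero =>
      intro _
      rw [P.gram_zero, P.theta_zero, sqNorm_smul_matrix, sqNorm_one, zero_sub, norm_neg]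
      simp only [Finset.range_zero, Finset.sum_empty, mul_zero, add_zero]
      exact mul_le_mul_of_nonneg_left (pow_le_pow_left₀ (norm_nonneg _) hs 2) hlam.le
    | succ m ih =>
      intro hm
      have ih := ih (by omega)
      have hmK : m < K := by omega
      obtain ⟨hB, hBl⟩ := P.posDef hlam m hmK.le
      have hym := hy m hmK
      have h1 := omd_step hym hL0 hLθ hη (hL _ _) hη1 hlam96 hB hBl
        (P.norm_theta_le hLθ.le (m + 1) hm) hs (P.theta_min m hmK)
      rw [← hessian_loss hym, ← P.gram_succ m hmK] at h1
      have h2 := loss_sub_le (φ := φ) hym hη hB (θ m) (θ (m + 1))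
      have h3 : 2 * η * (loss 𝓜 φ (s m) (a m) (y m) (θ m)
          - loss 𝓜 φ (s m) (a m) (y m) (θ (m + 1))) ≤
          2 * η * (η * sqNorm (B m)⁻¹ (centralFeature 𝓜 φ (θ m) (s m) (a m) (y m)))
          + sqNorm (B m) (θ (m + 1) - θ m) / 2 := by
        refine (mul_le_mul_of_nonneg_left h2 (by positivity)).trans_eq ?_
        field_simp
        ring
      rw [Finset.sum_range_succ, Finset.sum_range_succ]
      -- The excess loss over the true parameter, plus the random Young term, minus twice its
      -- conditional mean under the estimated model. The subtracted part is the information gain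
      -- that is added back separately.
      have h4 : logRatio 𝓜 φ η θs (B m) (θ m) (s m) (a m) (y m)
          = loss 𝓜 φ (s m) (a m) (y m) θs - loss 𝓜 φ (s m) (a m) (y m) (θ m)
          + η * sqNorm (B m)⁻¹ (centralFeature 𝓜 φ (θ m) (s m) (a m) (y m))
          - 2 * η * infoGain 𝓜 φ (B m) (θ m) (s m) (a m) := by
        rw [logRatio, loss_eq_neg_log hym, loss_eq_neg_log hym]; ring
      rw [h4]
      linarith
  have h5 := P.sum_infoGain_old_le hy hL0 hLθ.le hη hL hlam hlam2 hlam8 hn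
  have h6 := mul_le_mul_of_nonneg_left h5 (by positivity : 0 ≤ 4 * η ^ 2)
  linarith [hmain n hn]

/-- The likelihood ratio factors have conditional mean at most one. -/
lemma sum_mnlProb_exp_logRatio_le {s : S} {a : A} (hne : (𝓜.reach s a).Nonempty)
    (hL : ∀ s' ∈ 𝓜.reach s a, ‖φ s a s'‖ ≤ L) (hη : 0 ≤ η) (hlam : 0 < lam)
    (hlam4 : 4 * η * L ^ 2 ≤ lam) {B : Matrix (Fin d) (Fin d) ℝ} (hB : B.PosDef)
    (hBl : ∀ x, lam * ‖x‖ ^ 2 ≤ sqNorm B x) (θs θ : Vec d) :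
    ∑ y ∈ 𝓜.reach s a, mnlProb 𝓜 φ θs s a y * Real.exp (logRatio 𝓜 φ η θs B θ s a y) ≤ 1 := by
  have h1 : ∀ y ∈ 𝓜.reach s a,
      mnlProb 𝓜 φ θs s a y * Real.exp (logRatio 𝓜 φ η θs B θ s a y)
      ≤ (mnlProb 𝓜 φ θ s a y + 2 * η * (mnlProb 𝓜 φ θ s a y *
        sqNorm B⁻¹ (centralFeature 𝓜 φ θ s a y))) * Real.exp (-(2 * η * infoGain 𝓜 φ B θ s a)) := by
    intro y hy
    have p1 := mnlProb_pos (φ := φ) hne θ y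
    have p2 := mnlProb_pos (φ := φ) hne θs y
    have q0 : 0 ≤ η * sqNorm B⁻¹ (centralFeature 𝓜 φ θ s a y) :=
      mul_nonneg hη (sqNorm_nonneg hB.inv.posSemidef _)
    have q1 : η * sqNorm B⁻¹ (centralFeature 𝓜 φ θ s a y) ≤ 1 := by
      have := mul_le_mul_of_nonneg_left
        (sqNorm_inv_centralFeature_le hne hL hlam hB hBl θ y hy) hη
      refine this.trans ?_
      rw [← mul_div_assoc, div_le_one hlam]; linarith
    have q2 := exp_le_one_add_two_mul q0 q1
    -- The true probability cancels against the likelihood ratio. What remains is a mean under the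
    -- estimated model, at most `1 + 2η·infoGain`, and the factor `exp (-2η·infoGain)` compensates
    -- it.
    rw [logRatio, sub_eq_add_neg, Real.exp_add, Real.exp_add, Real.exp_sub, Real.exp_log p1,
      Real.exp_log p2, ← mul_assoc, ← mul_assoc, mul_div_cancel₀ _ p2.ne']
    refine mul_le_mul_of_nonneg_right ?_ (Real.exp_pos _).le
    nlinarith [mul_le_mul_of_nonneg_left q2 p1.le]
  refine (Finset.sum_le_sum h1).trans ?_
  rw [← Finset.sum_mul, Finset.sum_add_distrib, sum_mnlProb hne, ← Finset.mul_sum]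
  change (1 + 2 * η * infoGain 𝓜 φ B θ s a) * _ ≤ 1
  rw [Real.exp_neg, ← div_eq_mul_inv, div_le_one (Real.exp_pos _)]
  linarith [Real.add_one_le_exp (2 * η * infoGain 𝓜 φ B θ s a)]

end Path

/-! ### Gaussian tails and the number of noise samples -/

section Gaussian

open Matrix
open scoped MatrixOrder

lemma inv_sqrt_two_pi_bounds : 0.398 ≤ (√(2 * Real.pi))⁻¹ ∧ (√(2 * Real.pi))⁻¹ ≤ 0.4 := by
  have h1 := Real.pi_gt_d2
  have h2 := Real.pi_lt_d2
  constructor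
  · rw [le_inv_comm₀ (by norm_num) (by positivity)]
    rw [Real.sqrt_le_left (by norm_num)]
    norm_num
    linarith
  · rw [inv_le_comm₀ (by positivity) (by norm_num)]
    apply Real.le_sqrt_of_sq_le
    norm_num
    linarith

lemma stdNormalCDF_zero : stdNormalCDF 0 = 1 / 2 := by
  have hna : (gaussianReal 0 1) {0} = 0 := by
    have := nullSingletonClass_gaussianReal (μ := 0) (v := 1) one_ne_zero
    exact measure_singleton 0
  have h1 : (gaussianReal 0 1).real (Set.Ici 0) = (gaussianReal 0 1).real (Set.Iic 0) := by
    have h := gaussianReal_map_neg (μ := 0) (v := 1)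
    rw [neg_zero] at h
    conv_rhs => rw [← h]
    rw [map_measureReal_apply (by fun_prop) measurableSet_Iic]
    congr 1
    ext x; simp
  have h2 : (gaussianReal 0 1).real (Set.Iic 0) + (gaussianReal 0 1).real (Set.Ioi 0) = 1 := by
    rw [← measureReal_union (by
      rw [Set.disjoint_left]; intro x hx hx'; simp at hx hx'; linarith) measurableSet_Ioi]
    simp
  have h3 : (gaussianReal 0 1).real (Set.Ici 0) = (gaussianReal 0 1).real (Set.Ioi 0) := by
    rw [measureReal_def, measureReal_def]
    congr 1
    rw [← Set.Ioi_union_left]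
    refine le_antisymm ((measure_union_le _ _).trans ?_) (measure_mono Set.subset_union_left)
    rw [hna, add_zero]
  rw [stdNormalCDF, cdf_eq_real]
  linarith

lemma stdNormalCDF_eq {x : ℝ} (hx : 0 ≤ x) :
    stdNormalCDF x = 1 / 2 + ∫ t in Set.Ioc 0 x, gaussianPDFReal 0 1 t := by
  have h1 : Set.Iic x = Set.Iic 0 ∪ Set.Ioc 0 x := (Set.Iic_union_Ioc_eq_Iic hx).symm
  rw [stdNormalCDF, cdf_eq_real, h1, measureReal_union (by
    rw [Set.disjoint_left]; intro y hy hy'; simp at hy hy'; linarith) measurableSet_Ioc,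
    ← cdf_eq_real, ← stdNormalCDF, stdNormalCDF_zero, measureReal_def (s := Set.Ioc 0 x),
    gaussianReal_apply_eq_integral 0 one_ne_zero, ENNReal.toReal_ofReal]
  exact integral_nonneg fun t => gaussianPDFReal_nonneg _ _ _

lemma stdNormalCDF_le {x : ℝ} (hx : 0 ≤ x) : stdNormalCDF x ≤ 1 / 2 + 0.4 * x := by
  rw [stdNormalCDF_eq hx]
  have h : ∫ t in Set.Ioc 0 x, gaussianPDFReal 0 1 t ≤ ∫ _t in Set.Ioc 0 x, (0.4 : ℝ) := by
    refine setIntegral_mono_on (integrable_gaussianPDFReal 0 1).integrableOn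
      (integrableOn_const (by simp)) measurableSet_Ioc fun t _ => ?_
    rw [gaussianPDFReal_def]
    simp only [NNReal.coe_one, mul_one, sub_zero]
    have h1 : Real.exp (-t ^ 2 / 2) ≤ 1 := Real.exp_le_one_iff.2 (by nlinarith [sq_nonneg t])
    calc _ ≤ (√(2 * Real.pi))⁻¹ * 1 := mul_le_mul_of_nonneg_left h1 (by positivity)
      _ ≤ 0.4 := by linarith [inv_sqrt_two_pi_bounds.2]
  rw [setIntegral_const, smul_eq_mul] at h
  simp only [measureReal_def, Real.volume_Ioc, sub_zero, ENNReal.toReal_ofReal hx] at h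
  linarith

lemma four_fifths_le_stdNormalCDF_one : 4 / 5 ≤ stdNormalCDF 1 := by
  rw [stdNormalCDF_eq zero_le_one]
  have h : ∫ t in Set.Ioc (0 : ℝ) 1, (0.398 * (1 - t ^ 2 / 2) : ℝ)
      ≤ ∫ t in Set.Ioc (0 : ℝ) 1, gaussianPDFReal 0 1 t := by
    refine setIntegral_mono_on ?_ (integrable_gaussianPDFReal 0 1).integrableOn
      measurableSet_Ioc fun t ht => ?_
    · exact (Continuous.integrableOn_Icc (by fun_prop)).mono_set Set.Ioc_subset_Icc_self
    rw [gaussianPDFReal_def]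
    simp only [NNReal.coe_one, mul_one, sub_zero]
    have h1 := Real.add_one_le_exp (-t ^ 2 / 2)
    have h2 : 0 ≤ 1 - t ^ 2 / 2 := by nlinarith [ht.1, ht.2]
    exact mul_le_mul inv_sqrt_two_pi_bounds.1 (by linarith) h2 (by positivity)
  rw [← intervalIntegral.integral_of_le zero_le_one] at h
  have h2 : ∫ t in (0 : ℝ)..1, (0.398 * (1 - t ^ 2 / 2) : ℝ) = 0.398 * (5 / 6) := by
    rw [intervalIntegral.integral_const_mul, intervalIntegral.integral_sub (by simp)
      (by apply Continuous.intervalIntegrable; fun_prop), intervalIntegral.integral_div,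
      integral_pow]
    norm_num
  rw [h2] at h
  norm_num at h ⊢
  linarith

lemma stdNormalCDF_one_le : stdNormalCDF 1 ≤ 9 / 10 := by
  have := stdNormalCDF_le zero_le_one
  norm_num at this ⊢
  linarith

/-- The number of samples is tuned to `Φ(1)^M ≤ 1/(HU)`. Since the confidence radius is only `β/50`,
a sample need only exceed `1/50` standard deviation, and the failure probability is the cube of
this. Numerically `0.508 ≤ 0.8³ = 0.512`. -/
lemma stdNormalCDF_fiftieth_le : stdNormalCDF (1 / 50) ≤ stdNormalCDF 1 ^ 3 := by
  have h1 := stdNormalCDF_le (x := 1 / 50) (by norm_num)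
  have h2 := pow_le_pow_left₀ (by norm_num) four_fifths_le_stdNormalCDF_one 3
  norm_num at h1 h2 ⊢
  linarith

lemma stdNormalCDF_nonneg (x : ℝ) : 0 ≤ stdNormalCDF x := cdf_nonneg _ _

/-- The number of noise samples. -/
def numSamples (H U : ℕ) : ℕ := ⌈1 - Real.log (H * U) / Real.log (stdNormalCDF 1)⌉₊

lemma log_stdNormalCDF_one_le : Real.log (stdNormalCDF 1) ≤ -(1 / 10) := by
  have h1 := four_fifths_le_stdNormalCDF_one
  have h2 := Real.log_le_sub_one_of_pos (by linarith : 0 < stdNormalCDF 1)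
  linarith [stdNormalCDF_one_le]

lemma pow_numSamples_le {H U : ℕ} (hH : 0 < H) (hU : 0 < U) :
    stdNormalCDF 1 ^ numSamples H U ≤ ((H : ℝ) * U)⁻¹ := by
  have h1 := four_fifths_le_stdNormalCDF_one
  have hq : 0 < stdNormalCDF 1 := by linarith
  have hl := log_stdNormalCDF_one_le
  have hM := Nat.le_ceil (1 - Real.log (H * U) / Real.log (stdNormalCDF 1))
  have hHU : (0 : ℝ) < H * U := by positivity
  change _ ≤ (numSamples H U : ℝ) at hM
  rw [← Real.log_le_log_iff (by positivity) (by positivity), Real.log_pow, Real.log_inv]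
  have h2 := mul_le_mul_of_nonpos_right hM (by linarith : Real.log (stdNormalCDF 1) ≤ 0)
  rw [sub_mul, div_mul_cancel₀ _ (by linarith)] at h2
  linarith

/-- The cube leaves `U (HU)⁻³`. The order `H⁻²` is what the reserve argument for optimism needs, and
`U ≥ 2` supplies the factor `1/4`. -/
lemma mul_pow_numSamples_le {H U : ℕ} (hH : 0 < H) (hU : 2 ≤ U) :
    (U : ℝ) * stdNormalCDF (1 / 50) ^ numSamples H U ≤ 1 / (4 * (H : ℝ) ^ 2) := by
  have h1 := pow_numSamples_le hH (by omega : 0 < U)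
  have h2 : stdNormalCDF (1 / 50) ^ numSamples H U ≤ (((H : ℝ) * U)⁻¹) ^ 3 := by
    calc _ ≤ (stdNormalCDF 1 ^ 3) ^ numSamples H U :=
          pow_le_pow_left₀ (stdNormalCDF_nonneg _) stdNormalCDF_fiftieth_le _
      _ = (stdNormalCDF 1 ^ numSamples H U) ^ 3 := by rw [← pow_mul, ← pow_mul, mul_comm]
      _ ≤ _ := pow_le_pow_left₀ (pow_nonneg (stdNormalCDF_nonneg _) _) h1 3
  have hH' : (1 : ℝ) ≤ H := by exact_mod_cast hH
  have hU' : (2 : ℝ) ≤ U := by exact_mod_cast hU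
  refine (mul_le_mul_of_nonneg_left h2 (by positivity)).trans ?_
  rw [inv_pow, ← div_eq_mul_inv, div_le_div_iff₀ (by positivity) (by positivity)]
  have h3 : (2 : ℝ) * 2 * 1 ≤ U * U * H := by gcongr
  have h4 : 0 ≤ (H : ℝ) ^ 2 * U := by positivity
  nlinarith [mul_le_mul_of_nonneg_left h3 h4]

lemma numSamples_pos {H U : ℕ} (hH : 0 < H) (hU : 0 < U) : 0 < numSamples H U := by
  unfold numSamples
  rw [Nat.ceil_pos]
  have h0 : 0 ≤ Real.log (H * U) := Real.log_nonneg (by exact_mod_cast Nat.mul_pos hH hU)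
  have : Real.log (H * U) / Real.log (stdNormalCDF 1) ≤ 0 :=
    div_nonpos_of_nonneg_of_nonpos h0 (by linarith [log_stdNormalCDF_one_le])
  linarith

/-- Used to show that a union bound over all noise vectors costs only a logarithmic factor. -/
lemma numSamples_le {H U : ℕ} (hH : 0 < H) (hU : 0 < U) :
    (numSamples H U : ℝ) ≤ 2 + 10 * Real.log (H * U) := by
  have h0 : 0 ≤ Real.log (H * U) := Real.log_nonneg (by exact_mod_cast Nat.mul_pos hH hU)
  have hl := log_stdNormalCDF_one_le
  have h1 : -(Real.log (H * U) / Real.log (stdNormalCDF 1)) ≤ 10 * Real.log (H * U) := by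
    rw [← div_neg, div_le_iff₀ (by linarith)]
    nlinarith
  have h2 : 0 ≤ -(Real.log (H * U) / Real.log (stdNormalCDF 1)) := by
    rw [← div_neg]; exact div_nonneg h0 (by linarith)
  have := Nat.ceil_lt_add_one (a := 1 - Real.log (H * U) / Real.log (stdNormalCDF 1))
    (by linarith)
  change (numSamples H U : ℝ) < _ at this
  linarith

variable {d : ℕ}

lemma gaussianReal_Iic_mul_sqrt {v : ℝ} (hv : 0 < v) (c : ℝ) :
    (gaussianReal 0 v.toNNReal).real (Set.Iic (c * √v)) = stdNormalCDF c := by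
  have h := gaussianReal_map_const_mul (μ := 0) (v := 1) (√v)
  have hv' : (.mk ((√v) ^ 2) (sq_nonneg _) * 1 : NNReal) = v.toNNReal := by
    ext; simp [Real.sq_sqrt hv.le, Real.coe_toNNReal _ hv.le]
  rw [mul_zero, hv'] at h
  rw [← h, map_measureReal_apply (by fun_prop) measurableSet_Iic, stdNormalCDF, cdf_eq_real]
  congr 1
  ext x
  simp only [Set.mem_preimage, Set.mem_Iic]
  rw [mul_comm c, mul_le_mul_iff_right₀ (Real.sqrt_pos.2 hv)]

/-- A one-dimensional projection of a Gaussian vector exceeds a multiple of its standard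
deviation with the probability of a standard normal variable. -/
lemma multivariateGaussian_inner_lt_le {B : Matrix (Fin d) (Fin d) ℝ} (hB : B.PosDef) {σ : ℝ}
    (hσ : 0 < σ) {x : Vec d} (hx : 0 < sqNorm B⁻¹ x) (c : ℝ) :
    (multivariateGaussian (0 : Vec d) (σ ^ 2 • B⁻¹)).real
      {ξ | inner ℝ x ξ < c * (σ * √(sqNorm B⁻¹ x))} ≤ stdNormalCDF c := by
  have hS : (σ ^ 2 • B⁻¹).PosSemidef := hB.inv.posSemidef.smul (sq_nonneg σ)
  set ν := multivariateGaussian (0 : Vec d) (σ ^ 2 • B⁻¹) with hν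
  have hvar : Var[innerSL ℝ x; ν] = σ ^ 2 * sqNorm B⁻¹ x := by
    have h1 := covarianceBilin_self (μ := ν) IsGaussian.memLp_two_id x
    rw [hν, covarianceBilin_multivariateGaussian hS] at h1
    rw [hν, ← sqNorm_smul_matrix]
    exact h1.symm
  have hmean : ∫ ξ, innerSL ℝ x ξ ∂ν = 0 := by
    have := ContinuousLinearMap.integral_comp_id_comm (μ := ν) IsGaussian.integrable_id
      (innerSL ℝ x)
    simpa [hν] using this
  have hmap : ν.map (innerSL ℝ x) = gaussianReal 0 (σ ^ 2 * sqNorm B⁻¹ x).toNNReal := by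
    rw [IsGaussian.map_eq_gaussianReal, hvar, hmean]
  have hv : 0 < σ ^ 2 * sqNorm B⁻¹ x := by positivity
  have hsq : √(σ ^ 2 * sqNorm B⁻¹ x) = σ * √(sqNorm B⁻¹ x) := by
    rw [Real.sqrt_mul (sq_nonneg σ), Real.sqrt_sq hσ.le]
  rw [← gaussianReal_Iic_mul_sqrt hv c, ← hmap, hsq,
    map_measureReal_apply (by fun_prop) measurableSet_Iic]
  refine measureReal_mono fun ξ hξ => ?_
  simp only [Set.mem_ofPred_eq] at hξ
  simpa using hξ.le

lemma gaussianReal_abs_gt_le {r : ℝ} (hr : 0 ≤ r) :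
    (gaussianReal 0 1).real {x | r ≤ |x|} ≤ 2 * Real.exp (-r ^ 2 / 2) := by
  have h1 : (gaussianReal 0 1).real {x | r ≤ id x} ≤ Real.exp (-r ^ 2 / 2) := by
    refine (measure_ge_le_exp_mul_mgf r hr (integrable_exp_mul_gaussianReal r)).trans_eq ?_
    rw [mgf_fun_id_gaussianReal, ← Real.exp_add]
    congr 1
    simp
    ring
  have h2 : (gaussianReal 0 1).real (Set.Iic (-r)) = (gaussianReal 0 1).real {x | r ≤ id x} := by
    have h := gaussianReal_map_neg (μ := 0) (v := 1)
    rw [neg_zero] at h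
    conv_lhs => rw [← h]
    rw [map_measureReal_apply (by fun_prop) measurableSet_Iic]
    congr 1
    ext x; simp
  calc (gaussianReal 0 1).real {x | r ≤ |x|}
      ≤ (gaussianReal 0 1).real ({x | r ≤ id x} ∪ Set.Iic (-r)) := by
        refine measureReal_mono fun x hx => ?_
        rcases le_abs.1 (show r ≤ |x| from hx) with h | h
        · exact Or.inl h
        · exact Or.inr (by simp only [Set.mem_Iic]; linarith)
    _ ≤ _ := (measureReal_union_le _ _).trans (by rw [h2]; linarith)

/-- A union bound over coordinates: a norm above `√d r` forces some coordinate to be at least `r`.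
-/
lemma stdGaussian_norm_gt_le {r : ℝ} (hr : 0 ≤ r) :
    (stdGaussian (Vec d)).real {z | d * r ^ 2 < ‖z‖ ^ 2} ≤ 2 * d * Real.exp (-r ^ 2 / 2) := by
  have hsub : {z : Vec d | d * r ^ 2 < ‖z‖ ^ 2} ⊆ ⋃ i : Fin d, {z | r ≤ |z i|} := by
    intro z hz
    by_contra hc
    simp only [Set.mem_iUnion, Set.mem_ofPred_eq, not_exists, not_le] at hc hz
    rw [EuclideanSpace.real_norm_sq_eq] at hz
    have : ∑ i, z.ofLp i ^ 2 ≤ ∑ _i : Fin d, r ^ 2 := Finset.sum_le_sum fun i _ => by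
      rw [← sq_abs]; exact pow_le_pow_left₀ (abs_nonneg _) (hc i).le 2
    simp at this
    linarith
  refine (measureReal_mono hsub).trans ((measureReal_iUnion_fintype_le _).trans ?_)
  have hi : ∀ i : Fin d, (stdGaussian (Vec d)).real {z | r ≤ |z i|}
      ≤ 2 * Real.exp (-r ^ 2 / 2) := by
    intro i
    have hp := measurePreserving_eval_multivariateGaussian (μ := (0 : Vec d))
      (S := (1 : Matrix (Fin d) (Fin d) ℝ)) Matrix.PosSemidef.one (i := i)
    rw [multivariateGaussian_zero_one] at hp
    simp only [PiLp.zero_apply, Matrix.one_apply_eq, Real.toNNReal_one] at hp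
    have hm : MeasurableSet {x : ℝ | r ≤ |x|} := measurableSet_le measurable_const (by fun_prop)
    have := hp.measureReal_preimage hm.nullMeasurableSet
    exact this.trans_le (gaussianReal_abs_gt_le hr)
  refine (Finset.sum_le_sum fun i _ => hi i).trans_eq ?_
  simp
  ring

/-- The Gaussian vector is the image of a standard one under `R = σ B^{-1/2}`, and `R B R = σ² I`;
so its `B`-norm is `σ` times a standard Gaussian norm. -/
lemma sqNorm_sqrt {B : Matrix (Fin d) (Fin d) ℝ} (hB : B.PosDef) (σ : ℝ) (hσ : 0 < σ) (z : Vec d) :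
    sqNorm B (toEuclideanCLM (𝕜 := ℝ) (CFC.sqrt (σ ^ 2 • B⁻¹)) z) = σ ^ 2 * ‖z‖ ^ 2 := by
  have hS : (σ ^ 2 • B⁻¹).PosSemidef := hB.inv.posSemidef.smul (sq_nonneg σ)
  have hu : IsUnit B.det := (Matrix.isUnit_iff_isUnit_det B).1 hB.isUnit
  set R := CFC.sqrt (σ ^ 2 • B⁻¹) with hR
  have hRR : R * R = σ ^ 2 • B⁻¹ := CFC.sqrt_mul_sqrt_self _ hS.nonneg
  have hRT : Rᵀ = R := by
    have := (CFC.sqrt_nonneg (σ ^ 2 • B⁻¹)).posSemidef.isHermitian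
    simpa [Matrix.IsHermitian, conjTranspose_eq_transpose_of_trivial] using this
  have h1 : R * ((σ ^ 2)⁻¹ • (R * B)) = 1 := by
    rw [Matrix.mul_smul, ← mul_assoc, hRR, Matrix.smul_mul, Matrix.nonsing_inv_mul B hu, smul_smul,
      inv_mul_cancel₀ (by positivity), one_smul]
  have h2 : R * B * R = σ ^ 2 • (1 : Matrix (Fin d) (Fin d) ℝ) := by
    have h3 := mul_eq_one_comm.1 h1
    rw [Matrix.smul_mul] at h3
    rw [← h3, smul_smul, mul_inv_cancel₀ (by positivity), one_smul]
  have h4 : sqNorm B (toEuclideanCLM (𝕜 := ℝ) R z) = sqNorm (R * B * R) z := by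
    unfold sqNorm
    rw [ofLp_toEuclideanCLM]
    have h5 : R *ᵥ z.ofLp = z.ofLp ᵥ* R := by rw [← Matrix.mulVec_transpose, hRT]
    nth_rewrite 1 [h5]
    rw [← Matrix.dotProduct_mulVec, Matrix.mulVec_mulVec, Matrix.mulVec_mulVec]
  rw [h4, h2, sqNorm_smul_matrix, sqNorm_one]

lemma measurable_sqNorm (B : Matrix (Fin d) (Fin d) ℝ) : Measurable (sqNorm B) := by
  unfold sqNorm
  simp only [dotProduct, Matrix.mulVec]
  fun_prop

lemma multivariateGaussian_sqNorm_gt_le {B : Matrix (Fin d) (Fin d) ℝ} (hB : B.PosDef)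
    {σ : ℝ} (hσ : 0 < σ) {r : ℝ} (hr : 0 ≤ r) :
    (multivariateGaussian (0 : Vec d) (σ ^ 2 • B⁻¹)).real
      {ξ | σ ^ 2 * (d * r ^ 2) < sqNorm B ξ} ≤ 2 * d * Real.exp (-r ^ 2 / 2) := by
  have hm : MeasurableSet {ξ : Vec d | σ ^ 2 * (d * r ^ 2) < sqNorm B ξ} :=
    measurableSet_lt measurable_const (measurable_sqNorm B)
  rw [multivariateGaussian, map_measureReal_apply (by fun_prop) hm]
  refine le_trans (measureReal_mono fun z hz => ?_) (stdGaussian_norm_gt_le hr)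
  simp only [zero_add, Set.mem_preimage, Set.mem_ofPred_eq, sqNorm_sqrt hB σ hσ] at hz
  exact lt_of_mul_lt_mul_left hz (sq_nonneg σ)

end Gaussian

/-! ### Value functions, bonuses and the one-step inequalities -/

section Values

variable {S A : Type*} {H d : ℕ} {𝓜 : EpisodicMDP S A H} {φ : S → A → S → Vec d}

/-- The expectation of `V` at the next state under the transition model `P_θ`. -/
def modelMean (𝓜 : EpisodicMDP S A H) (φ : S → A → S → Vec d) (θ : Vec d) (s : S) (a : A)
    (V : S → ℝ) : ℝ :=
  ∑ s' ∈ 𝓜.reach s a, mnlProb 𝓜 φ θ s a s' * V s'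

lemma modelMean_mono (θ : Vec d) (s : S) (a : A) {V W : S → ℝ} (h : ∀ s', V s' ≤ W s') :
    modelMean 𝓜 φ θ s a V ≤ modelMean 𝓜 φ θ s a W :=
  Finset.sum_le_sum fun s' _ => mul_le_mul_of_nonneg_left (h s') (mnlProb_nonneg _ _ _ _)

lemma modelMean_sub (θ : Vec d) (s : S) (a : A) (V W : S → ℝ) :
    modelMean 𝓜 φ θ s a (fun s' => V s' - W s')
      = modelMean 𝓜 φ θ s a V - modelMean 𝓜 φ θ s a W := by
  simp [modelMean, mul_sub]

lemma modelMean_add (θ : Vec d) (s : S) (a : A) (V W : S → ℝ) :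
    modelMean 𝓜 φ θ s a (fun s' => V s' + W s')
      = modelMean 𝓜 φ θ s a V + modelMean 𝓜 φ θ s a W := by
  simp [modelMean, mul_add, Finset.sum_add_distrib]

lemma modelMean_const_mul (θ : Vec d) (s : S) (a : A) (c : ℝ) (V : S → ℝ) :
    modelMean 𝓜 φ θ s a (fun s' => c * V s') = c * modelMean 𝓜 φ θ s a V := by
  simp only [modelMean, Finset.mul_sum]
  exact Finset.sum_congr rfl fun _ _ => by ring

lemma modelMean_nonneg (θ : Vec d) (s : S) (a : A) {V : S → ℝ} (h : ∀ s', 0 ≤ V s') :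
    0 ≤ modelMean 𝓜 φ θ s a V :=
  Finset.sum_nonneg fun s' _ => mul_nonneg (mnlProb_nonneg _ _ _ _) (h s')

lemma modelMean_le (hne : ∀ s a, (𝓜.reach s a).Nonempty) (θ : Vec d) (s : S) (a : A) {V : S → ℝ}
    {b : ℝ} (h : ∀ s', V s' ≤ b) : modelMean 𝓜 φ θ s a V ≤ b :=
  sum_mul_le_of_le (fun _ _ => mnlProb_nonneg _ _ _ _) (sum_mnlProb (hne s a) θ) fun s' _ => h s'

lemma le_modelMean (hne : ∀ s a, (𝓜.reach s a).Nonempty) (θ : Vec d) (s : S) (a : A) {V : S → ℝ}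
    {b : ℝ} (h : ∀ s', b ≤ V s') : b ≤ modelMean 𝓜 φ θ s a V :=
  le_sum_mul_of_le (fun _ _ => mnlProb_nonneg _ _ _ _) (sum_mnlProb (hne s a) θ) fun s' _ => h s'

lemma policyValue_of_lt {θs : Fin H → Vec d} (hM : IsMNL 𝓜 φ θs) (π : Policy S A H) {h : ℕ}
    (hh : h < H) (s : S) :
    policyValue 𝓜 π h s = 𝓜.reward s (π ⟨h, hh⟩ s)
      + modelMean 𝓜 φ (θs ⟨h, hh⟩) s (π ⟨h, hh⟩ s) (policyValue 𝓜 π (h + 1)) := by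
  rw [policyValue, dif_pos hh, modelMean]
  congr 1
  exact Finset.sum_congr rfl fun s' hs' => by rw [hM _ _ _ _ hs']

lemma policyValue_of_ge (π : Policy S A H) {h : ℕ} (hh : H ≤ h) (s : S) :
    policyValue 𝓜 π h s = 0 := by
  rw [policyValue, dif_neg (by omega)]

lemma policyValue_mem {θs : Fin H → Vec d} (hM : IsMNL 𝓜 φ θs)
    (hne : ∀ s a, (𝓜.reach s a).Nonempty) (π : Policy S A H) (h : ℕ) (hh : h ≤ H) (s : S) :
    0 ≤ policyValue 𝓜 π h s ∧ policyValue 𝓜 π h s ≤ (H : ℝ) - h := by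
  induction hh using Nat.decreasingInduction generalizing s with
  | self => rw [policyValue_of_ge π le_rfl]; simp
  | of_succ k hk ih =>
    rw [policyValue_of_lt hM π hk]
    have h1 := 𝓜.reward_mem s (π ⟨k, hk⟩ s)
    have h2 := modelMean_nonneg (𝓜 := 𝓜) (φ := φ) (θs ⟨k, hk⟩) s (π ⟨k, hk⟩ s) fun s' => (ih s').1
    have h3 := modelMean_le (φ := φ) hne (θs ⟨k, hk⟩) s (π ⟨k, hk⟩ s) fun s' => (ih s').2
    push_cast at h3
    exact ⟨by linarith [h1.1], by linarith [h1.2]⟩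

/-- The value computed by backward induction. -/
def bellmanValue (𝓜 : EpisodicMDP S A H) (h : ℕ) (s : S) : ℝ :=
  if hh : h < H then
    ⨆ a : A, (𝓜.reward s a + ∑ s' ∈ 𝓜.reach s a,
      (𝓜.P ⟨h, hh⟩ s a s').toReal * bellmanValue 𝓜 (h + 1) s')
  else 0
termination_by H - h

/-- Backward induction attains the supremum simultaneously for all steps and states, so the regret
can be measured against one fixed policy. -/
lemma exists_optimal_policy [Finite A] [Nonempty A] (𝓜 : EpisodicMDP S A H) :
    ∃ π : Policy S A H, ∀ h s, optimalValue 𝓜 h s ≤ policyValue 𝓜 π h s := by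
  have hmax : ∀ (h : Fin H) (s : S), ∃ a : A, ∀ b : A,
      (𝓜.reward s b + ∑ s' ∈ 𝓜.reach s b, (𝓜.P h s b s').toReal * bellmanValue 𝓜 (h + 1) s')
      ≤ 𝓜.reward s a + ∑ s' ∈ 𝓜.reach s a, (𝓜.P h s a s').toReal * bellmanValue 𝓜 (h + 1) s' :=
    fun h s => Finite.exists_max _
  choose π hπ using hmax
  have hub : ∀ (π' : Policy S A H) (h : ℕ) (s : S), h ≤ H →
      policyValue 𝓜 π' h s ≤ bellmanValue 𝓜 h s := by
    intro π' h s hh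
    induction hh using Nat.decreasingInduction generalizing s with
    | self => rw [policyValue_of_ge π' le_rfl, bellmanValue, dif_neg (by omega)]
    | of_succ k hk ih =>
      rw [policyValue, dif_pos hk, bellmanValue, dif_pos hk]
      refine le_trans ?_ (le_ciSup (Set.finite_range _).bddAbove (π' ⟨k, hk⟩ s))
      gcongr with s' _
      exact ih s'
  have hlb : ∀ (h : ℕ) (s : S), h ≤ H → bellmanValue 𝓜 h s ≤ policyValue 𝓜 π h s := by
    intro h s hh
    induction hh using Nat.decreasingInduction generalizing s with
    | self => rw [policyValue_of_ge π le_rfl, bellmanValue, dif_neg (by omega)]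
    | of_succ k hk ih =>
      rw [policyValue, dif_pos hk, bellmanValue, dif_pos hk]
      refine ciSup_le fun a => (hπ ⟨k, hk⟩ s a).trans ?_
      gcongr with s' _
      exact ih s'
  refine ⟨π, fun h s => ciSup_le fun π' => ?_⟩
  rcases le_or_gt h H with hh | hh
  · exact (hub π' h s hh).trans (hlb h s hh)
  · rw [policyValue_of_ge π' hh.le, policyValue_of_ge π hh.le]

/-- The mean width `∑ P_θ ‖φ̄‖_{B⁻¹}` of the confidence set at `(s, a)`. -/
def width (𝓜 : EpisodicMDP S A H) (φ : S → A → S → Vec d) (B : Matrix (Fin d) (Fin d) ℝ)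
    (θ : Vec d) (s : S) (a : A) : ℝ :=
  ∑ s' ∈ 𝓜.reach s a, mnlProb 𝓜 φ θ s a s' * √(sqNorm B⁻¹ (centralFeature 𝓜 φ θ s a s'))

/-- The maximal squared feature norm `max ‖φ‖²_{B⁻¹}` at `(s, a)`. -/
def maxSq (𝓜 : EpisodicMDP S A H) (φ : S → A → S → Vec d) (B : Matrix (Fin d) (Fin d) ℝ)
    (s : S) (a : A) : ℝ :=
  ⨆ s' : {x // x ∈ 𝓜.reach s a}, sqNorm B⁻¹ (φ s a s')

/-- The random part of the exploration bonus. -/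
def noiseBonus (𝓜 : EpisodicMDP S A H) (φ : S → A → S → Vec d) {M : ℕ} (θ : Vec d)
    (ξ : Fin M → Vec d) (s : S) (a : A) : ℝ :=
  ∑ s' ∈ 𝓜.reach s a,
    mnlProb 𝓜 φ θ s a s' * (⨆ m : Fin M, inner ℝ (centralFeature 𝓜 φ θ s a s') (ξ m))

lemma qStep_eq {M : ℕ} (β : ℝ) (θ : Vec d) (B : Matrix (Fin d) (Fin d) ℝ) (ξ : Fin M → Vec d)
    (V : S → ℝ) (s : S) (a : A) : qStep 𝓜 φ β θ B ξ V s a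
      = min (𝓜.reward s a + modelMean 𝓜 φ θ s a V
        + (noiseBonus 𝓜 φ θ ξ s a + 3 * H * β ^ 2 * maxSq 𝓜 φ B s a)) (H : ℝ) := rfl

lemma width_nonneg (B : Matrix (Fin d) (Fin d) ℝ) (θ : Vec d) (s : S) (a : A) :
    0 ≤ width 𝓜 φ B θ s a :=
  Finset.sum_nonneg fun _ _ => mul_nonneg (mnlProb_nonneg _ _ _ _) (Real.sqrt_nonneg _)

lemma maxSq_nonneg {B : Matrix (Fin d) (Fin d) ℝ} (hB : B.PosDef) (s : S) (a : A) :
    0 ≤ maxSq 𝓜 φ B s a :=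
  Real.iSup_nonneg fun _ => sqNorm_nonneg hB.inv.posSemidef _

lemma le_maxSq (B : Matrix (Fin d) (Fin d) ℝ) {s : S} {a : A} {s' : S} (hs' : s' ∈ 𝓜.reach s a) :
    sqNorm B⁻¹ (φ s a s') ≤ maxSq 𝓜 φ B s a :=
  le_ciSup (f := fun s' : {x // x ∈ 𝓜.reach s a} => sqNorm B⁻¹ (φ s a s'))
    (Set.finite_range _).bddAbove ⟨s', hs'⟩

/-- The maximum over samples dominates any single sample, and a single vector averages to zero
against the centralized features. Hence noise never lowers a value. -/
lemma noiseBonus_nonneg {M : ℕ} (hM : 0 < M) (hne : ∀ s a, (𝓜.reach s a).Nonempty) (θ : Vec d)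
    (ξ : Fin M → Vec d) (s : S) (a : A) : 0 ≤ noiseBonus 𝓜 φ θ ξ s a := by
  rw [← sum_mnlProb_inner_centralFeature (φ := φ) (hne s a) θ (ξ ⟨0, hM⟩)]
  refine Finset.sum_le_sum fun s' _ => mul_le_mul_of_nonneg_left ?_ (mnlProb_nonneg _ _ _ _)
  exact le_ciSup (f := fun m => inner ℝ (centralFeature 𝓜 φ θ s a s') (ξ m))
    (Set.finite_range _).bddAbove _

lemma noiseBonus_zero {M : ℕ} (θ : Vec d) (s : S) (a : A) :
    noiseBonus 𝓜 φ θ (fun _ : Fin M => (0 : Vec d)) s a = 0 := by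
  simp [noiseBonus]

lemma noiseBonus_le {M : ℕ} (hM : 0 < M) {B : Matrix (Fin d) (Fin d) ℝ} (hB : B.PosDef)
    (θ : Vec d) {ξ : Fin M → Vec d} {c : ℝ} (hξ : ∀ m, √(sqNorm B (ξ m)) ≤ c) (s : S) (a : A) :
    noiseBonus 𝓜 φ θ ξ s a ≤ c * width 𝓜 φ B θ s a := by
  have : Nonempty (Fin M) := ⟨⟨0, hM⟩⟩
  rw [width, Finset.mul_sum]
  refine Finset.sum_le_sum fun s' _ => ?_
  rw [mul_left_comm]
  refine mul_le_mul_of_nonneg_left (ciSup_le fun m => ?_) (mnlProb_nonneg _ _ _ _)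
  calc _ ≤ √(sqNorm B⁻¹ (centralFeature 𝓜 φ θ s a s')) * √(sqNorm B (ξ m)) :=
        (le_abs_self _).trans (abs_inner_le hB _ _)
    _ ≤ _ := by rw [mul_comm]; exact mul_le_mul_of_nonneg_right (hξ m) (Real.sqrt_nonneg _)

/-- The error of the estimated transition model on a bounded function. -/
lemma abs_modelMean_sub_le (hne : ∀ s a, (𝓜.reach s a).Nonempty)
    {B : Matrix (Fin d) (Fin d) ℝ} (hB : B.PosDef) {θ θs : Vec d} {β : ℝ} (hβ : 0 ≤ β)
    (hconf : √(sqNorm B (θ - θs)) ≤ β / 50) (s : S) (a : A) {V : S → ℝ}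
    (hV : ∀ s', 0 ≤ V s' ∧ V s' ≤ H) :
    |modelMean 𝓜 φ θs s a V - modelMean 𝓜 φ θ s a V|
      ≤ 1 / 100 * (H * β * width 𝓜 φ B θ s a) + 3 * H * β ^ 2 * maxSq 𝓜 φ B s a := by
  set p := mnlProb 𝓜 φ θ s a with hp
  have hp0 : ∀ i ∈ 𝓜.reach s a, 0 ≤ p i := fun i _ => mnlProb_nonneg _ _ _ _
  have hps : ∑ i ∈ 𝓜.reach s a, p i = 1 := sum_mnlProb (hne s a) θ
  have hqs : ∑ i ∈ 𝓜.reach s a, mnlProb 𝓜 φ θs s a i = 1 := sum_mnlProb (hne s a) θs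
  have hconf' : √(sqNorm B (θs - θ)) ≤ β / 50 := by
    rwa [show θs - θ = (-1 : ℝ) • (θ - θs) by rw [neg_one_smul]; abel, sqNorm_smul, neg_one_sq,
      one_mul]
  have hmS := maxSq_nonneg (𝓜 := 𝓜) (φ := φ) hB s a
  have hinner : ∀ x : Vec d, |inner ℝ x (θs - θ)| ≤ √(sqNorm B⁻¹ x) * (β / 50) := fun x =>
    (abs_inner_le hB x _).trans (mul_le_mul_of_nonneg_left hconf' (Real.sqrt_nonneg _))
  have hH : (0 : ℝ) ≤ H := Nat.cast_nonneg H
  -- Subtracting the constant `H/2` does not change the difference of the means and halves the sup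
  -- norm; this makes the first order constant `(1/50)(1/2) = 1/100`, half of what the noise
  -- provides.
  have hVb : ∀ i ∈ 𝓜.reach s a, |V i - H / 2| ≤ H / 2 := fun i _ =>
    abs_le.2 ⟨by linarith [(hV i).1], by linarith [(hV i).2]⟩
  have ht := tilt_taylor hp0 hps (u := fun i => inner ℝ (φ s a i) (θs - θ))
    (V := fun i => V i - H / 2) (X := √(maxSq 𝓜 φ B s a) * (β / 50)) (b := H / 2)
    (by positivity) (by positivity)
    (fun i hi => (hinner _).trans (mul_le_mul_of_nonneg_right
      (Real.sqrt_le_sqrt (le_maxSq B hi)) (by positivity))) hVb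
  rw [hp, ← mnlProb_eq_tilt (hne s a) θ θs, ← hp] at ht
  have hfirst : |∑ i ∈ 𝓜.reach s a, p i * ((inner ℝ (φ s a i) (θs - θ)
      - ∑ j ∈ 𝓜.reach s a, p j * inner ℝ (φ s a j) (θs - θ)) * (V i - H / 2))|
      ≤ 1 / 100 * (H * β * width 𝓜 φ B θ s a) := by
    refine (Finset.abs_sum_le_sum_abs _ _).trans ?_
    rw [width, Finset.mul_sum, Finset.mul_sum]
    refine Finset.sum_le_sum fun i hi => ?_
    rw [hp, ← inner_centralFeature, ← hp, abs_mul, abs_mul, abs_of_nonneg (hp0 i hi)]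
    have h1 := mul_le_mul (hinner (centralFeature 𝓜 φ θ s a i)) (hVb i hi) (abs_nonneg _)
      (by positivity)
    calc _ ≤ p i * (√(sqNorm B⁻¹ (centralFeature 𝓜 φ θ s a i)) * (β / 50) * (H / 2)) :=
          mul_le_mul_of_nonneg_left h1 (hp0 i hi)
      _ = _ := by ring
  have hd : modelMean 𝓜 φ θs s a V - modelMean 𝓜 φ θ s a V
      = ∑ i ∈ 𝓜.reach s a, mnlProb 𝓜 φ θs s a i * (V i - H / 2)
        - ∑ i ∈ 𝓜.reach s a, p i * (V i - H / 2) := by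
    simp only [modelMean, mul_sub, Finset.sum_sub_distrib, ← Finset.sum_mul, hqs, hps]
    ring
  have h12 : 12 * ((H : ℝ) / 2) * (√(maxSq 𝓜 φ B s a) * (β / 50)) ^ 2
      ≤ 3 * H * β ^ 2 * maxSq 𝓜 φ B s a := by
    rw [mul_pow, Real.sq_sqrt hmS]
    have : 0 ≤ H * β ^ 2 * maxSq 𝓜 φ B s a := by positivity
    nlinarith
  rw [hd]
  have h3 := abs_sub_abs_le_abs_sub (∑ i ∈ 𝓜.reach s a, mnlProb 𝓜 φ θs s a i * (V i - H / 2)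
        - ∑ i ∈ 𝓜.reach s a, p i * (V i - H / 2))
    (∑ i ∈ 𝓜.reach s a, p i * ((inner ℝ (φ s a i) (θs - θ)
      - ∑ j ∈ 𝓜.reach s a, p j * inner ℝ (φ s a j) (θs - θ)) * (V i - H / 2)))
  linarith

variable {M : ℕ} {β : ℝ} {θ : Fin H → Vec d} {B : Fin H → Matrix (Fin d) (Fin d) ℝ}

lemma optValue_of_lt (ξ : Fin H → Fin M → Vec d) {h : ℕ} (hh : h < H) (s : S) :
    optValue 𝓜 φ β θ B ξ h s = ⨆ a : A, qStep 𝓜 φ β (θ ⟨h, hh⟩) (B ⟨h, hh⟩) (ξ ⟨h, hh⟩)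
      (optValue 𝓜 φ β θ B ξ (h + 1)) s a := by
  rw [optValue, dif_pos hh]

lemma optValue_of_ge (ξ : Fin H → Fin M → Vec d) {h : ℕ} (hh : H ≤ h) (s : S) :
    optValue 𝓜 φ β θ B ξ h s = 0 := by
  rw [optValue, dif_neg (by omega)]

lemma qStep_le_optValue [Finite A] (ξ : Fin H → Fin M → Vec d) {h : ℕ} (hh : h < H) (s : S)
    (a : A) : qStep 𝓜 φ β (θ ⟨h, hh⟩) (B ⟨h, hh⟩) (ξ ⟨h, hh⟩)
      (optValue 𝓜 φ β θ B ξ (h + 1)) s a ≤ optValue 𝓜 φ β θ B ξ h s := by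
  rw [optValue_of_lt ξ hh]
  exact le_ciSup (f := fun a => qStep 𝓜 φ β (θ ⟨h, hh⟩) (B ⟨h, hh⟩) (ξ ⟨h, hh⟩)
      (optValue 𝓜 φ β θ B ξ (h + 1)) s a) (Set.finite_range _).bddAbove a

lemma optValue_le [Nonempty A] (ξ : Fin H → Fin M → Vec d) (h : ℕ) (s : S) :
    optValue 𝓜 φ β θ B ξ h s ≤ H := by
  rcases lt_or_ge h H with hh | hh
  · rw [optValue_of_lt ξ hh]
    exact ciSup_le fun a => min_le_right _ _
  · rw [optValue_of_ge ξ hh]; exact Nat.cast_nonneg H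

lemma optValue_mono [Finite A] [Nonempty A] {ξ ξ' : Fin H → Fin M → Vec d}
    (hξ : ∀ h s a, noiseBonus 𝓜 φ (θ h) (ξ h) s a ≤ noiseBonus 𝓜 φ (θ h) (ξ' h) s a)
    (h : ℕ) (s : S) : optValue 𝓜 φ β θ B ξ h s ≤ optValue 𝓜 φ β θ B ξ' h s := by
  rcases le_or_gt h H with hh | hh
  · induction hh using Nat.decreasingInduction generalizing s with
    | self => rw [optValue_of_ge ξ le_rfl, optValue_of_ge ξ' le_rfl]
    | of_succ k hk ih =>
      rw [optValue_of_lt ξ hk]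
      refine ciSup_le fun a => le_trans ?_ (qStep_le_optValue ξ' hk s a)
      rw [qStep_eq, qStep_eq]
      have h1 := modelMean_mono (𝓜 := 𝓜) (φ := φ) (θ ⟨k, hk⟩) s a ih
      have h2 := hξ ⟨k, hk⟩ s a
      exact min_le_min (by linarith) le_rfl
  · rw [optValue_of_ge ξ hh.le, optValue_of_ge ξ' hh.le]

lemma optValue_nonneg [Finite A] [Nonempty A] (hM : 0 < M)
    (hne : ∀ s a, (𝓜.reach s a).Nonempty) (hB : ∀ h, (B h).PosDef)
    (ξ : Fin H → Fin M → Vec d) (h : ℕ) (s : S) : 0 ≤ optValue 𝓜 φ β θ B ξ h s := by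
  rcases le_or_gt h H with hh | hh
  · induction hh using Nat.decreasingInduction generalizing s with
    | self => rw [optValue_of_ge ξ le_rfl]
    | of_succ k hk ih =>
      obtain ⟨a⟩ := ‹Nonempty A›
      refine le_trans ?_ (qStep_le_optValue ξ hk s a)
      rw [qStep_eq]
      have h1 := modelMean_nonneg (𝓜 := 𝓜) (φ := φ) (θ ⟨k, hk⟩) s a ih
      have h2 := noiseBonus_nonneg (φ := φ) hM hne (θ ⟨k, hk⟩) (ξ ⟨k, hk⟩) s a
      have h3 := maxSq_nonneg (𝓜 := 𝓜) (φ := φ) (hB ⟨k, hk⟩) s a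
      have h4 := (𝓜.reward_mem s a).1
      have h5 : 0 ≤ 3 * H * β ^ 2 * maxSq 𝓜 φ (B ⟨k, hk⟩) s a := by positivity
      exact le_min (by linarith) (Nat.cast_nonneg H)
  · rw [optValue_of_ge ξ hh.le]

/-- The value function without exploration noise. -/
def baseValue (𝓜 : EpisodicMDP S A H) (φ : S → A → S → Vec d) (M : ℕ) (β : ℝ)
    (θ : Fin H → Vec d) (B : Fin H → Matrix (Fin d) (Fin d) ℝ) (h : ℕ) (s : S) : ℝ :=
  optValue 𝓜 φ β θ B (fun _ (_ : Fin M) => 0) h s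

lemma baseValue_le_optValue [Finite A] [Nonempty A] (hM : 0 < M)
    (hne : ∀ s a, (𝓜.reach s a).Nonempty) (ξ : Fin H → Fin M → Vec d) (h : ℕ) (s : S) :
    baseValue 𝓜 φ M β θ B h s ≤ optValue 𝓜 φ β θ B ξ h s :=
  optValue_mono (fun h s a => by
    rw [noiseBonus_zero]; exact noiseBonus_nonneg hM hne _ _ _ _) h s

/-- The potential of the regret decomposition. -/
def gapValue (𝓜 : EpisodicMDP S A H) (φ : S → A → S → Vec d) {M : ℕ} (β : ℝ)
    (θ : Fin H → Vec d) (B : Fin H → Matrix (Fin d) (Fin d) ℝ) (ξ : Fin H → Fin M → Vec d)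
    (π : Policy S A H) (h : ℕ) (s : S) : ℝ :=
  4 * (optValue 𝓜 φ β θ B ξ h s - baseValue 𝓜 φ M β θ B h s)
    + (optValue 𝓜 φ β θ B ξ h s - policyValue 𝓜 π h s)

lemma abs_gapValue_le [Finite A] [Nonempty A] (hM : 0 < M)
    (hne : ∀ s a, (𝓜.reach s a).Nonempty) {θs : Fin H → Vec d} (hMNL : IsMNL 𝓜 φ θs)
    (hB : ∀ h, (B h).PosDef) (ξ : Fin H → Fin M → Vec d) (π : Policy S A H) {h : ℕ} (hh : h ≤ H)
    (s : S) : |gapValue 𝓜 φ β θ B ξ π h s| ≤ 5 * H := by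
  have h1 := optValue_le (𝓜 := 𝓜) (φ := φ) (β := β) (θ := θ) (B := B) ξ h s
  have h2 := optValue_nonneg (φ := φ) (β := β) (θ := θ) hM hne hB ξ h s
  have h3 := baseValue_le_optValue (φ := φ) (β := β) (θ := θ) (B := B) hM hne ξ h s
  have h4 : 0 ≤ baseValue 𝓜 φ M β θ B h s := optValue_nonneg hM hne hB _ h s
  have h5 := policyValue_mem hMNL hne π h hh s
  have h6 : (0 : ℝ) ≤ h := Nat.cast_nonneg h
  rw [gapValue, abs_le]
  constructor <;> linarith [h5.1, h5.2]

/-- One step of the regret decomposition along the played policy. -/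
lemma gapValue_le [Finite A] [Nonempty A] (hM : 0 < M)
    (hne : ∀ s a, (𝓜.reach s a).Nonempty) {θs : Fin H → Vec d} (hMNL : IsMNL 𝓜 φ θs)
    (hB : ∀ h, (B h).PosDef) (hβ : 0 ≤ β)
    (hconf : ∀ h, √(sqNorm (B h) (θ h - θs h)) ≤ β / 50) (ξ : Fin H → Fin M → Vec d)
    {π : Policy S A H} (hπ : ∀ h s a, optQ 𝓜 φ β θ B ξ h s a ≤ optQ 𝓜 φ β θ B ξ h s (π h s))
    (h : Fin H) (s : S) :
    gapValue 𝓜 φ β θ B ξ π h s ≤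
      modelMean 𝓜 φ (θs h) s (π h s) (gapValue 𝓜 φ β θ B ξ π (h + 1))
      + 5 * noiseBonus 𝓜 φ (θ h) (ξ h) s (π h s)
      + H * β * width 𝓜 φ (B h) (θ h) s (π h s)
      + 18 * H * β ^ 2 * maxSq 𝓜 φ (B h) s (π h s) := by
  set a := π h s with ha
  set V := optValue 𝓜 φ β θ B ξ (h + 1) with hV
  set W := baseValue 𝓜 φ M β θ B (h + 1) with hW
  have hVal : optValue 𝓜 φ β θ B ξ h s = qStep 𝓜 φ β (θ h) (B h) (ξ h) V s a := by
    refine le_antisymm ?_ (qStep_le_optValue ξ h.2 s a)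
    rw [optValue_of_lt ξ h.2]
    exact ciSup_le fun b => hπ h s b
  have hBase : qStep 𝓜 φ β (θ h) (B h) (fun _ : Fin M => 0) W s a
      ≤ baseValue 𝓜 φ M β θ B h s :=
    qStep_le_optValue (fun _ (_ : Fin M) => (0 : Vec d)) h.2 s a
  rw [qStep_eq, noiseBonus_zero, zero_add] at hBase
  rw [qStep_eq] at hVal
  have hnb := noiseBonus_nonneg (φ := φ) hM hne (θ h) (ξ h) s a
  have hmS := maxSq_nonneg (𝓜 := 𝓜) (φ := φ) (hB h) s a
  have hw := width_nonneg (𝓜 := 𝓜) (φ := φ) (B h) (θ h) s a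
  have hWV : ∀ s', W s' ≤ V s' := baseValue_le_optValue hM hne ξ (h + 1)
  have hV0 : ∀ s', 0 ≤ V s' := optValue_nonneg hM hne hB ξ (h + 1)
  have hVH : ∀ s', V s' ≤ H := optValue_le ξ (h + 1)
  have hW0 : ∀ s', 0 ≤ W s' := optValue_nonneg hM hne hB _ (h + 1)
  have e1 := (abs_le.1 (abs_modelMean_sub_le (φ := φ) hne (hB h) hβ (hconf h) s a
    (V := fun s' => V s' - W s') fun s' => ⟨by linarith [hWV s'], by linarith [hVH s', hW0 s']⟩)).1
  have e2 := (abs_le.1 (abs_modelMean_sub_le (φ := φ) hne (hB h) hβ (hconf h) s a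
    (V := V) fun s' => ⟨hV0 s', hVH s'⟩)).1
  have e3 := modelMean_mono (𝓜 := 𝓜) (φ := φ) (θ h) s a hWV
  rw [modelMean_sub, modelMean_sub] at e1
  have d1 : optValue 𝓜 φ β θ B ξ h s - baseValue 𝓜 φ M β θ B h s
      ≤ modelMean 𝓜 φ (θ h) s a V - modelMean 𝓜 φ (θ h) s a W
        + noiseBonus 𝓜 φ (θ h) (ξ h) s a := by
    -- If the noiseless value is truncated, it equals the cap `H` and the noisy value cannot exceed
    -- it. Otherwise the deterministic bonuses cancel.
    rcases min_choice (𝓜.reward s a + modelMean 𝓜 φ (θ h) s a W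
      + 3 * H * β ^ 2 * maxSq 𝓜 φ (B h) s a) (H : ℝ) with hc | hc
    · rw [hc] at hBase
      have := min_le_left (𝓜.reward s a + modelMean 𝓜 φ (θ h) s a V
        + (noiseBonus 𝓜 φ (θ h) (ξ h) s a + 3 * H * β ^ 2 * maxSq 𝓜 φ (B h) s a)) (H : ℝ)
      linarith
    · rw [hc] at hBase
      linarith [optValue_le (𝓜 := 𝓜) (φ := φ) (β := β) (θ := θ) (B := B) ξ h s]
  have d2 : optValue 𝓜 φ β θ B ξ h s ≤ 𝓜.reward s a + modelMean 𝓜 φ (θ h) s a V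
      + (noiseBonus 𝓜 φ (θ h) (ξ h) s a + 3 * H * β ^ 2 * maxSq 𝓜 φ (B h) s a) :=
    hVal.le.trans (min_le_left _ _)
  have d3 := policyValue_of_lt hMNL π h.2 s
  have e4 : modelMean 𝓜 φ (θs h) s a (gapValue 𝓜 φ β θ B ξ π (h + 1))
      = 4 * (modelMean 𝓜 φ (θs h) s a V - modelMean 𝓜 φ (θs h) s a W)
        + (modelMean 𝓜 φ (θs h) s a V
          - modelMean 𝓜 φ (θs h) s a (policyValue 𝓜 π (h + 1))) := by
    rw [← modelMean_sub, ← modelMean_sub, ← modelMean_const_mul, ← modelMean_add]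
    rfl
  change policyValue 𝓜 π h s = 𝓜.reward s a
    + modelMean 𝓜 φ (θs h) s a (policyValue 𝓜 π (h + 1)) at d3
  -- The first difference enters four times and the second once, so the noise has coefficient `5`,
  -- the width `5/100 ≤ 1`, and `maxSq` has `5·3` from the model errors plus `3` from the bonus
  -- itself.
  rw [e4, gapValue, d3]
  have hw' : 0 ≤ H * β * width 𝓜 φ (B h) (θ h) s a := by positivity
  linarith

end Values

/-! ### Expected accumulated costs in the estimated model -/

section Rollout

variable {S A : Type*} {H d : ℕ} {𝓜 : EpisodicMDP S A H} {φ : S → A → S → Vec d}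
  {θ : Fin H → Vec d} {π : Policy S A H}

/-- The expected sum of the costs `c` from step `h` on along `π` in the model with parameters
`θ`. -/
def rollout (𝓜 : EpisodicMDP S A H) (φ : S → A → S → Vec d) (θ : Fin H → Vec d)
    (π : Policy S A H) (c : Fin H → S → ℝ) (h : ℕ) (s : S) : ℝ :=
  if hh : h < H then
    ∑ s' ∈ 𝓜.reach s (π ⟨h, hh⟩ s), mnlProb 𝓜 φ (θ ⟨h, hh⟩) s (π ⟨h, hh⟩ s) s' *
      rollout 𝓜 φ θ π c (h + 1) s' + c ⟨h, hh⟩ s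
  else 0
termination_by H - h

lemma rollout_of_lt (c : Fin H → S → ℝ) {h : ℕ} (hh : h < H) (s : S) :
    rollout 𝓜 φ θ π c h s = modelMean 𝓜 φ (θ ⟨h, hh⟩) s (π ⟨h, hh⟩ s) (rollout 𝓜 φ θ π c (h + 1))
      + c ⟨h, hh⟩ s := by
  rw [rollout, dif_pos hh, modelMean]

lemma rollout_of_ge (c : Fin H → S → ℝ) {h : ℕ} (hh : H ≤ h) (s : S) :
    rollout 𝓜 φ θ π c h s = 0 := by
  rw [rollout, dif_neg (by omega)]

lemma rollout_mono {c c' : Fin H → S → ℝ} (hc : ∀ h s, c h s ≤ c' h s) {h : ℕ} (hh : h ≤ H)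
    (s : S) : rollout 𝓜 φ θ π c h s ≤ rollout 𝓜 φ θ π c' h s := by
  induction hh using Nat.decreasingInduction generalizing s with
  | self => rw [rollout_of_ge _ le_rfl, rollout_of_ge _ le_rfl]
  | of_succ k hk ih =>
    rw [rollout_of_lt _ hk, rollout_of_lt _ hk]
    exact add_le_add (modelMean_mono _ _ _ ih) (hc _ _)

lemma rollout_sub (c c' : Fin H → S → ℝ) {h : ℕ} (hh : h ≤ H) (s : S) :
    rollout 𝓜 φ θ π (fun h s => c h s - c' h s) h s
      = rollout 𝓜 φ θ π c h s - rollout 𝓜 φ θ π c' h s := by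
  induction hh using Nat.decreasingInduction generalizing s with
  | self => simp [rollout_of_ge _ le_rfl]
  | of_succ k hk ih =>
    rw [rollout_of_lt _ hk, rollout_of_lt _ hk, rollout_of_lt _ hk, funext ih, modelMean_sub]
    ring

lemma rollout_const_mul (r : ℝ) (c : Fin H → S → ℝ) {h : ℕ} (hh : h ≤ H) (s : S) :
    rollout 𝓜 φ θ π (fun h s => r * c h s) h s = r * rollout 𝓜 φ θ π c h s := by
  induction hh using Nat.decreasingInduction generalizing s with
  | self => simp [rollout_of_ge _ le_rfl]
  | of_succ k hk ih =>
    rw [rollout_of_lt _ hk, rollout_of_lt _ hk, funext ih, modelMean_const_mul]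
    ring

lemma rollout_nonneg {c : Fin H → S → ℝ} (hc : ∀ h s, 0 ≤ c h s) {h : ℕ} (hh : h ≤ H) (s : S) :
    0 ≤ rollout 𝓜 φ θ π c h s := by
  induction hh using Nat.decreasingInduction generalizing s with
  | self => rw [rollout_of_ge _ le_rfl]
  | of_succ k hk ih =>
    rw [rollout_of_lt _ hk]
    exact add_nonneg (modelMean_nonneg _ _ _ ih) (hc _ _)

lemma rollout_le (hne : ∀ s a, (𝓜.reach s a).Nonempty) {c : Fin H → S → ℝ} {b : ℝ}
    (hc : ∀ h s, c h s ≤ b) {h : ℕ} (hh : h ≤ H) (s : S) :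
    rollout 𝓜 φ θ π c h s ≤ (H - h : ℝ) * b := by
  induction hh using Nat.decreasingInduction generalizing s with
  | self => rw [rollout_of_ge _ le_rfl]; simp
  | of_succ k hk ih =>
    rw [rollout_of_lt _ hk]
    have h1 := modelMean_le (φ := φ) hne (θ ⟨k, hk⟩) s (π ⟨k, hk⟩ s) ih
    have h2 := hc ⟨k, hk⟩ s
    push_cast at h1
    linarith

lemma modelMean_integral {X : Type*} [MeasurableSpace X] {ν : Measure X} (θ₀ : Vec d) (s : S)
    (a : A) {V : X → S → ℝ} (hV : ∀ s, Integrable (fun x => V x s) ν) :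
    Integrable (fun x => modelMean 𝓜 φ θ₀ s a (V x)) ν ∧
      ∫ x, modelMean 𝓜 φ θ₀ s a (V x) ∂ν = modelMean 𝓜 φ θ₀ s a (fun s => ∫ x, V x s ∂ν) := by
  constructor
  · exact integrable_finsetSum _ fun s' _ => (hV s').const_mul _
  · simp only [modelMean]
    rw [integral_finsetSum _ fun s' _ => (hV s').const_mul _]
    exact Finset.sum_congr rfl fun _ _ => integral_const_mul _ _

/-- The model is fixed while the costs depend on the noise, so the noise can be averaged out cost by
cost. -/
lemma rollout_integral {X : Type*} [MeasurableSpace X] {ν : Measure X}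
    {c : X → Fin H → S → ℝ} (hc : ∀ h s, Integrable (fun x => c x h s) ν) {h : ℕ} (hh : h ≤ H)
    (s : S) : Integrable (fun x => rollout 𝓜 φ θ π (c x) h s) ν ∧
      ∫ x, rollout 𝓜 φ θ π (c x) h s ∂ν
        = rollout 𝓜 φ θ π (fun h s => ∫ x, c x h s ∂ν) h s := by
  induction hh using Nat.decreasingInduction generalizing s with
  | self => simp [rollout_of_ge _ le_rfl]
  | of_succ k hk ih =>
    have h1 := modelMean_integral (𝓜 := 𝓜) (φ := φ) (θ ⟨k, hk⟩) s (π ⟨k, hk⟩ s)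
      (V := fun x s' => rollout 𝓜 φ θ π (c x) (k + 1) s') fun s' => (ih s').1
    simp_rw [rollout_of_lt _ hk]
    refine ⟨h1.1.add (hc _ _), ?_⟩
    rw [integral_add h1.1 (hc _ _), h1.2]
    simp_rw [(ih _).2]

end Rollout

/-! ### Optimism with constant probability -/

section Optimism

variable {S A : Type*} {H d : ℕ} {𝓜 : EpisodicMDP S A H} {φ : S → A → S → Vec d}
  {M : ℕ} {β : ℝ} {θ : Fin H → Vec d} {B : Fin H → Matrix (Fin d) (Fin d) ℝ}

lemma measurable_noiseBonus (θ₀ : Vec d) (h : Fin H) (s : S) (a : A) :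
    Measurable fun ξ : Fin H × Fin M → Vec d => noiseBonus 𝓜 φ θ₀ (fun m => ξ (h, m)) s a := by
  unfold noiseBonus
  refine Finset.measurable_sum _ fun s' _ => Measurable.const_mul (Measurable.iSup fun m => ?_) _
  exact (measurable_pi_apply (h, m)).const_inner

lemma measurable_optValue [Finite A] (β : ℝ) (θ : Fin H → Vec d)
    (B : Fin H → Matrix (Fin d) (Fin d) ℝ) (h : ℕ) (s : S) :
    Measurable fun ξ : Fin H × Fin M → Vec d =>
      optValue 𝓜 φ β θ B (fun h m => ξ (h, m)) h s := by
  rcases le_or_gt h H with hh | hh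
  · induction hh using Nat.decreasingInduction generalizing s with
    | self => simp only [optValue_of_ge _ le_rfl]; exact measurable_const
    | of_succ k hk ih =>
      simp only [optValue_of_lt _ hk, qStep_eq]
      refine Measurable.iSup fun a => Measurable.min ?_ measurable_const
      refine Measurable.add (measurable_const.add ?_)
        ((measurable_noiseBonus _ _ _ _).add measurable_const)
      exact Finset.measurable_sum _ fun s' _ => (ih s').const_mul _
  · simp only [optValue_of_ge _ hh.le]; exact measurable_const

/-- The noise fails to compensate the estimation error at `(s, a)`. -/
def badNoise (𝓜 : EpisodicMDP S A H) (φ : S → A → S → Vec d) (M : ℕ) (σ : ℝ)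
    (θ : Fin H → Vec d) (B : Fin H → Matrix (Fin d) (Fin d) ℝ) (h : Fin H) (s : S) (a : A) :
    Set (Fin H × Fin M → Vec d) :=
  ⋃ s' ∈ 𝓜.reach s a, {ξ | ∀ m, inner ℝ (centralFeature 𝓜 φ (θ h) s a s') (ξ (h, m))
    < 1 / 50 * (σ * √(sqNorm (B h)⁻¹ (centralFeature 𝓜 φ (θ h) s a s')))}

lemma measurableSet_badNoise (σ : ℝ) (h : Fin H) (s : S) (a : A) :
    MeasurableSet (badNoise 𝓜 φ M σ θ B h s a) := by
  refine Finset.measurableSet_biUnion _ fun s' _ => ?_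
  simp only [Set.ofPred_forall]
  refine MeasurableSet.iInter fun m => measurableSet_lt ?_ measurable_const
  exact (measurable_pi_apply (h, m)).const_inner

/-- The joint law of the noise vectors of an episode. -/
def noiseLaw (M : ℕ) (σ : ℝ) (B : Fin H → Matrix (Fin d) (Fin d) ℝ) :
    Measure (Fin H × Fin M → Vec d) :=
  Measure.pi fun i : Fin H × Fin M => multivariateGaussian (0 : Vec d) (σ ^ 2 • (B i.1)⁻¹)

instance (σ : ℝ) (B : Fin H → Matrix (Fin d) (Fin d) ℝ) :
    IsProbabilityMeasure (noiseLaw M σ B) := by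
  unfold noiseLaw; infer_instance

/-- The event is a rectangle restricting only the `M` coordinates of step `h`; independence gives
the power. -/
lemma noiseLaw_forall_le (σ : ℝ) (h : Fin H) {E : Set (Vec d)} {p : ℝ} (hp : 0 ≤ p)
    (hE : (multivariateGaussian (0 : Vec d) (σ ^ 2 • (B h)⁻¹)).real E ≤ p) :
    (noiseLaw M σ B).real {ξ | ∀ m, ξ (h, m) ∈ E} ≤ p ^ M := by
  have hset : {ξ : Fin H × Fin M → Vec d | ∀ m, ξ (h, m) ∈ E}
      = Set.univ.pi fun i : Fin H × Fin M => if i.1 = h then E else Set.univ := by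
    ext ξ
    simp only [Set.mem_ofPred_eq, Set.mem_univ_pi]
    refine ⟨fun hm i => ?_, fun hm m => by simpa using hm (h, m)⟩
    split_ifs with hi
    · subst hi; exact hm i.2
    · trivial
  have hE' : (multivariateGaussian (0 : Vec d) (σ ^ 2 • (B h)⁻¹)) E ≤ ENNReal.ofReal p := by
    rw [← ofReal_measureReal]; exact ENNReal.ofReal_le_ofReal hE
  rw [hset, measureReal_def, noiseLaw, Measure.pi_pi]
  refine ENNReal.toReal_le_of_le_ofReal (by positivity) ?_
  rw [Fintype.prod_prod_type, Finset.prod_eq_single h, ENNReal.ofReal_pow hp]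
  · simp only [if_true, Finset.prod_const, Finset.card_univ, Fintype.card_fin]
    gcongr
  · intro b _ hb; simp [hb]
  · simp

lemma noiseLaw_badNoise_le (hM : 0 < M) (hB : ∀ h, (B h).PosDef) {σ : ℝ} (hσ : 0 < σ) {U : ℕ}
    (hU : ∀ s a, (𝓜.reach s a).card ≤ U) (h : Fin H) (s : S) (a : A) :
    (noiseLaw M σ B).real (badNoise 𝓜 φ M σ θ B h s a) ≤ U * stdNormalCDF (1 / 50) ^ M := by
  have hΦ := stdNormalCDF_nonneg (1 / 50)
  refine (measureReal_biUnion_finset_le _ _).trans ?_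
  refine (Finset.sum_le_card_nsmul _ _ (stdNormalCDF (1 / 50) ^ M) fun s' _ => ?_).trans ?_
  · set x := centralFeature 𝓜 φ (θ h) s a s'
    -- A degenerate projection means `x = 0`; then the strict inequality `0 < 0` fails, and since `M
    -- > 0` the event is empty.
    rcases (sqNorm_nonneg (hB h).inv.posSemidef x).eq_or_lt with h0 | h0
    · have hx : x = 0 := by
        by_contra hx
        exact (sqNorm_pos (hB h).inv hx).ne h0
      have : {ξ : Fin H × Fin M → Vec d | ∀ m, inner ℝ x (ξ (h, m))
          < 1 / 50 * (σ * √(sqNorm (B h)⁻¹ x))} = ∅ := by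
        ext ξ
        simp only [Set.mem_ofPred_eq, Set.mem_empty_iff_false, iff_false, not_forall]
        exact ⟨⟨0, hM⟩, by rw [← h0, hx]; simp⟩
      rw [this, measureReal_empty]; positivity
    · exact noiseLaw_forall_le σ h hΦ (multivariateGaussian_inner_lt_le (hB h) hσ h0 _)
  · rw [nsmul_eq_mul]
    exact mul_le_mul_of_nonneg_right (by exact_mod_cast hU s a) (by positivity)

lemma le_noiseBonus_of_notMem_badNoise {σ : ℝ} {h : Fin H} {s : S} {a : A}
    {ξ : Fin H × Fin M → Vec d} (hξ : ξ ∉ badNoise 𝓜 φ M σ θ B h s a) :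
    1 / 50 * (σ * width 𝓜 φ (B h) (θ h) s a)
      ≤ noiseBonus 𝓜 φ (θ h) (fun m => ξ (h, m)) s a := by
  simp only [badNoise, Set.mem_iUnion, Set.mem_ofPred_eq, not_exists, not_forall, not_lt] at hξ
  rw [width, Finset.mul_sum, Finset.mul_sum]
  refine Finset.sum_le_sum fun s' hs' => ?_
  obtain ⟨m, hm⟩ := hξ s' hs'
  have h1 := le_ciSup (f := fun m => inner ℝ (centralFeature 𝓜 φ (θ h) s a s') (ξ (h, m)))
    (Set.finite_range _).bddAbove m
  calc _ = mnlProb 𝓜 φ (θ h) s a s'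
        * (1 / 50 * (σ * √(sqNorm (B h)⁻¹ (centralFeature 𝓜 φ (θ h) s a s')))) := by ring
    _ ≤ _ := mul_le_mul_of_nonneg_left (hm.trans h1) (mnlProb_nonneg _ _ _ _)

/-- Markov's inequality for half of a bound on the mean, including a vanishing bound. -/
lemma measureReal_gt_le_half {X : Type*} [MeasurableSpace X] {ν : Measure X}
    [IsProbabilityMeasure ν] {Y : X → ℝ} (hY : Integrable Y ν) (h0 : ∀ x, 0 ≤ Y x) {τ : ℝ}
    (hτ : ∫ x, Y x ∂ν ≤ τ / 2) : ν.real {x | τ < Y x} ≤ 1 / 2 := by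
  have hτ0 : 0 ≤ τ := by linarith [integral_nonneg (μ := ν) (f := Y) h0]
  rcases hτ0.eq_or_lt with h | h
  · have h1 : ∫ x, Y x ∂ν = 0 := le_antisymm (by linarith) (integral_nonneg h0)
    have h2 := (integral_eq_zero_iff_of_nonneg h0 hY).1 h1
    have h3 : ν {x | τ < Y x} = 0 := by
      refine measure_mono_null (fun x hx => ?_) (ae_iff.1 h2)
      simp only [Set.mem_ofPred_eq, Pi.zero_apply] at hx ⊢
      linarith
    rw [measureReal_def, h3]; norm_num
  · have h1 := mul_meas_ge_le_integral_of_nonneg (Filter.Eventually.of_forall h0) hY τ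
    have h2 : ν.real {x | τ < Y x} ≤ ν.real {x | τ ≤ Y x} :=
      measureReal_mono fun x (hx : τ < Y x) => hx.le
    have h3 : τ * ν.real {x | τ < Y x} ≤ τ * (1 / 2) := by nlinarith
    exact le_of_mul_le_mul_left h3 h

/-- With constant probability, the randomized value function dominates the value of a policy. -/
theorem quarter_le_noiseLaw_optValue [Finite A] [Nonempty A] {U : ℕ} (hH : 0 < H) (hU2 : 2 ≤ U)
    (hMU : M = numSamples H U)
    (hne : ∀ s a, (𝓜.reach s a).Nonempty) (hU : ∀ s a, (𝓜.reach s a).card ≤ U)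
    {θs : Fin H → Vec d} (hMNL : IsMNL 𝓜 φ θs) (hB : ∀ h, (B h).PosDef) (hβ : 0 < β)
    (hconf : ∀ h, √(sqNorm (B h) (θ h - θs h)) ≤ β / 50) (π : Policy S A H) (s : S) :
    1 / 4 ≤ (noiseLaw M (H * β) B).real
      {ξ | policyValue 𝓜 π 0 s ≤ optValue 𝓜 φ β θ B (fun h m => ξ (h, m)) 0 s} := by
  classical
  have hM : 0 < M := hMU ▸ numSamples_pos hH (by omega)
  have hH1 : (1 : ℝ) ≤ H := by exact_mod_cast hH
  set σ := H * β with hσ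
  have hσ0 : 0 < σ := by positivity
  set ν := noiseLaw M σ B
  set e : Fin H → S → ℝ := fun h s => 1 / 100 * (σ * width 𝓜 φ (B h) (θ h) s (π h s)) with he
  have he0 : ∀ h s, 0 ≤ e h s := fun h s => by
    have := width_nonneg (𝓜 := 𝓜) (φ := φ) (B h) (θ h) s (π h s)
    positivity
  -- The reserve: at most the surplus `e` left by good noise, and at most `1/H`, so that a whole
  -- episode accumulates at most `1`.
  set t : Fin H → S → ℝ := fun h s => min (e h s) H / H ^ 2 with ht
  have ht0 : ∀ h s, 0 ≤ t h s := fun h s =>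
    div_nonneg (le_min (he0 h s) (by positivity)) (by positivity)
  have htH : ∀ h s, (H : ℝ) ^ 2 * t h s = min (e h s) H := fun h s => by
    simp only [ht]; field_simp
  have hte : ∀ h s, t h s ≤ e h s := fun h s => by
    have h1 := htH h s
    have h2 := min_le_left (e h s) (H : ℝ)
    linarith [le_mul_of_one_le_left (ht0 h s) (one_le_pow₀ hH1 (n := 2))]
  have htle : ∀ h s, t h s ≤ 1 / H := fun h s => by
    rw [le_div_iff₀ (by linarith)]
    have h1 := htH h s
    have h2 := min_le_right (e h s) (H : ℝ)
    nlinarith [ht0 h s]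
  -- On bad noise the net cost `c - t` is `H² t = min e H`, the truncated deficit. Its mean is at
  -- most `t/2` because `(1 + H²)/(4H²) ≤ 1/2`.
  set c : (Fin H × Fin M → Vec d) → Fin H → S → ℝ := fun ξ h s =>
    (badNoise 𝓜 φ M σ θ B h s (π h s)).indicator (fun _ => (1 + (H : ℝ) ^ 2) * t h s) ξ with hc
  have hc0 : ∀ ξ h s, 0 ≤ c ξ h s := fun ξ h s =>
    Set.indicator_nonneg (fun _ _ => mul_nonneg (by positivity) (ht0 h s)) _
  have hcint : ∀ h s, Integrable (fun ξ => c ξ h s) ν := fun h s =>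
    (integrable_const _).indicator (measurableSet_badNoise _ _ _ _)
  have hbad : ∀ h s, ν.real (badNoise 𝓜 φ M σ θ B h s (π h s)) ≤ 1 / (4 * (H : ℝ) ^ 2) :=
    fun h s => (noiseLaw_badNoise_le hM hB hσ0 hU h s _).trans (hMU ▸ mul_pow_numSamples_le hH hU2)
  have hcmean : ∀ h s, ∫ ξ, c ξ h s ∂ν ≤ 1 / 2 * t h s := fun h s => by
    simp only [hc]
    rw [integral_indicator_const _ (measurableSet_badNoise _ _ _ _), smul_eq_mul]
    have h1 := mul_le_mul_of_nonneg_right (hbad h s)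
      (mul_nonneg (by positivity : (0 : ℝ) ≤ 1 + (H : ℝ) ^ 2) (ht0 h s))
    refine h1.trans ?_
    rw [← mul_assoc]
    refine mul_le_mul_of_nonneg_right ?_ (ht0 h s)
    rw [one_div_mul_eq_div, div_le_iff₀ (by positivity)]
    nlinarith
  set V := policyValue 𝓜 π with hV
  set W : (Fin H × Fin M → Vec d) → ℕ → S → ℝ := fun ξ =>
    optValue 𝓜 φ β θ B (fun h m => ξ (h, m)) with hW
  -- one backward step
  have hstep : ∀ ξ (h : Fin H) s, H ≤ W ξ h s ∨ V h s - W ξ h s ≤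
      modelMean 𝓜 φ (θ h) s (π h s) (fun s' => V (h + 1) s' - W ξ (h + 1) s')
      + e h s - noiseBonus 𝓜 φ (θ h) (fun m => ξ (h, m)) s (π h s) := by
    intro ξ h s
    have hq := qStep_le_optValue (𝓜 := 𝓜) (φ := φ) (β := β) (θ := θ) (B := B)
      (fun h m => ξ (h, m)) h.2 s (π h s)
    rw [qStep_eq] at hq
    rcases min_le_iff.1 hq with hq | hq
    · right
      have h1 := policyValue_of_lt hMNL π h.2 s
      have h2 := (abs_le.1 (abs_modelMean_sub_le (φ := φ) hne (hB h) hβ.le (hconf h) s (π h s)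
        (V := V (h + 1)) fun s' => by
          have := policyValue_mem hMNL hne π (h + 1) h.2 s'
          have h0 : (0 : ℝ) ≤ ((h + 1 : ℕ) : ℝ) := Nat.cast_nonneg _
          exact ⟨this.1, by linarith [this.2]⟩)).2
      change V h s = _ + modelMean 𝓜 φ (θs h) s (π h s) (V (h + 1)) at h1
      change _ + modelMean 𝓜 φ (θ h) s (π h s) (W ξ (h + 1)) + _ ≤ W ξ h s at hq
      rw [modelMean_sub]
      simp only [he]
      linarith
    · exact Or.inl hq
  have hnb : ∀ (ξ : Fin H × Fin M → Vec d) (h : Fin H) s,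
      0 ≤ noiseBonus 𝓜 φ (θ h) (fun m => ξ (h, m)) s (π h s) := fun ξ h s =>
    noiseBonus_nonneg hM hne _ _ _ _
  have hgood : ∀ (ξ : Fin H × Fin M → Vec d) (h : Fin H) s,
      ξ ∉ badNoise 𝓜 φ M σ θ B h s (π h s) →
      2 * e h s ≤ noiseBonus 𝓜 φ (θ h) (fun m => ξ (h, m)) s (π h s) := fun ξ h s hξ => by
    have := le_noiseBonus_of_notMem_badNoise hξ
    simp only [he]; linarith
  -- From step `1` on, `V ≤ H - 1`. This leaves room for the reserve: if `W` reaches the cap, the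
  -- gap is at most `-1`, which no rollout undercuts.
  have hdom : ∀ ξ (h : ℕ), h ≤ H → 1 ≤ h → ∀ s, V h s - W ξ h s
      ≤ rollout 𝓜 φ θ π (fun h s => c ξ h s - t h s) h s := by
    intro ξ h hh
    have hlow : ∀ h, h ≤ H → ∀ s, -1 ≤ rollout 𝓜 φ θ π (fun h s => c ξ h s - t h s) h s := by
      intro h hh s
      rw [rollout_sub _ _ hh]
      have h1 := rollout_nonneg (𝓜 := 𝓜) (φ := φ) (θ := θ) (π := π) (hc0 ξ) hh s
      have h2 := rollout_le (φ := φ) (θ := θ) (π := π) hne htle hh s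
      have h3 : (H - h : ℝ) * (1 / H) ≤ 1 := by
        rw [mul_one_div, div_le_one (by linarith)]
        linarith [(Nat.cast_nonneg h : (0 : ℝ) ≤ h)]
      linarith
    induction hh using Nat.decreasingInduction with
    | self =>
      intro _ s
      rw [rollout_of_ge _ le_rfl]
      simp only [hV, hW]
      rw [policyValue_of_ge _ le_rfl, optValue_of_ge _ le_rfl]; simp
    | of_succ k hk ih =>
      intro hk1 s
      have hk1' : (1 : ℝ) ≤ k := by exact_mod_cast hk1
      have hVk := (policyValue_mem hMNL hne π k hk.le s).2
      rcases hstep ξ ⟨k, hk⟩ s with h1 | h1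
      · have := hlow k hk.le s
        simp only at h1
        linarith
      · have h2 := modelMean_mono (𝓜 := 𝓜) (φ := φ) (θ ⟨k, hk⟩) s (π ⟨k, hk⟩ s) (ih (by omega))
        have h3 := le_modelMean (φ := φ) hne (θ ⟨k, hk⟩) s (π ⟨k, hk⟩ s) (hlow (k + 1) hk)
        rw [rollout_of_lt _ hk]
        simp only at h1
        have hW0 : 0 ≤ W ξ k s := optValue_nonneg hM hne hB _ k s
        by_cases hb : ξ ∈ badNoise 𝓜 φ M σ θ B ⟨k, hk⟩ s (π ⟨k, hk⟩ s)
        · simp only [hc, Set.indicator_of_mem hb]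
          simp only [hc] at h2 h3
          have h4 := htH ⟨k, hk⟩ s
          have h5 := hnb ξ ⟨k, hk⟩ s
          -- If the deficit was truncated to `H`, the rollout is at least `H - 1`, which bounds the
          -- gap trivially.
          rcases min_choice (e ⟨k, hk⟩ s) (H : ℝ) with h6 | h6
          · rw [h6] at h4; nlinarith
          · rw [h6] at h4; nlinarith
        · simp only [hc, Set.indicator_of_notMem hb]
          simp only [hc] at h2 h3
          have h4 := hgood ξ ⟨k, hk⟩ s hb
          have h5 := hte ⟨k, hk⟩ s
          linarith
  -- the two failure events
  set h₀ : Fin H := ⟨0, hH⟩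
  set Y : (Fin H × Fin M → Vec d) → ℝ := fun ξ =>
    modelMean 𝓜 φ (θ h₀) s (π h₀ s) (rollout 𝓜 φ θ π (c ξ) 1) with hY
  set τ := modelMean 𝓜 φ (θ h₀) s (π h₀ s) (rollout 𝓜 φ θ π t 1) with hτ
  have hr := fun s' => rollout_integral (𝓜 := 𝓜) (φ := φ) (θ := θ) (π := π) hcint
    (h := 1) hH s'
  have hYint := modelMean_integral (𝓜 := 𝓜) (φ := φ) (θ h₀) s (π h₀ s)
    (V := fun ξ s' => rollout 𝓜 φ θ π (c ξ) 1 s') fun s' => (hr s').1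
  have hYmean : ∫ ξ, Y ξ ∂ν ≤ τ / 2 := by
    have h1 : ∀ s', ∫ ξ, rollout 𝓜 φ θ π (c ξ) 1 s' ∂ν ≤ 1 / 2 * rollout 𝓜 φ θ π t 1 s' := by
      intro s'
      rw [(hr s').2, ← rollout_const_mul _ _ hH]
      exact rollout_mono hcmean hH s'
    have h2 := modelMean_mono (𝓜 := 𝓜) (φ := φ) (θ h₀) s (π h₀ s) h1
    rw [modelMean_const_mul] at h2
    calc _ = _ := hYint.2
      _ ≤ _ := h2
      _ = _ := by ring
  have hY0 : ∀ ξ, 0 ≤ Y ξ := fun ξ => modelMean_nonneg _ _ _ (rollout_nonneg (hc0 ξ) hH)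
  have hP2 := measureReal_gt_le_half hYint.1 hY0 hYmean
  -- Step `0` has no spare unit below the cap, so its bad event at the single state `s` is simply
  -- excluded. With Markov's `1/2` for the later costs, the failure probability is at most `3/4`.
  have hP1 : ν.real (badNoise 𝓜 φ M σ θ B h₀ s (π h₀ s)) ≤ 1 / 4 := by
    refine (hbad h₀ s).trans (one_div_le_one_div_of_le (by norm_num) ?_)
    nlinarith
  have hsub : {ξ | V 0 s ≤ W ξ 0 s}ᶜ ⊆ badNoise 𝓜 φ M σ θ B h₀ s (π h₀ s) ∪ {ξ | τ < Y ξ} := by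
    intro ξ hξ
    by_contra hcon
    simp only [Set.mem_union, Set.mem_ofPred_eq, not_or, not_lt] at hcon
    apply hξ
    simp only [Set.mem_ofPred_eq]
    rcases hstep ξ h₀ s with h1 | h1
    · refine le_trans ?_ h1
      simpa using (policyValue_mem hMNL hne π 0 hH.le s).2
    · have h2 := modelMean_mono (𝓜 := 𝓜) (φ := φ) (θ h₀) s (π h₀ s)
        fun s' => (hdom ξ 1 hH le_rfl s').trans (rollout_sub (c ξ) t (h := 1) hH s').le
      rw [modelMean_sub, modelMean_sub] at h2
      have h3 := hgood ξ h₀ s hcon.1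
      have h4 := he0 h₀ s
      have h5 := hcon.2
      simp only [hY, hτ] at h5
      change V 0 s - W ξ 0 s ≤ modelMean 𝓜 φ (θ h₀) s (π h₀ s)
        (fun s' => V 1 s' - W ξ 1 s') + _ - _ at h1
      rw [modelMean_sub] at h1
      linarith
  have hmeas : MeasurableSet {ξ | V 0 s ≤ W ξ 0 s} :=
    measurableSet_le measurable_const (measurable_optValue β θ B 0 s)
  have h1 := probReal_compl_eq_one_sub (μ := ν) hmeas
  have h2 := (measureReal_mono (μ := ν) hsub).trans (measureReal_union_le _ _)
  linarith

end Optimism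

/-! ### Discrete random variables -/

section Discrete

variable {Ω S T : Type*} {m m' : MeasurableSpace Ω} {X : Ω → S} {Y : Ω → T}

lemma IsDiscreteRV.mono (hm : m ≤ m') (hX : IsDiscreteRV m X) : IsDiscreteRV m' X :=
  ⟨hX.1, fun s => hm _ (hX.2 s)⟩

lemma IsDiscreteRV.measurableSet (hX : IsDiscreteRV m X) (E : Set S) :
    MeasurableSet[m] {ω | X ω ∈ E} := by
  have : {ω | X ω ∈ E} = ⋃ s ∈ E ∩ Set.range X, {ω | X ω = s} := by
    ext ω; simp
  rw [this]
  exact MeasurableSet.biUnion (hX.1.mono Set.inter_subset_right) fun s _ => hX.2 s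

/-- No measurability of `Y` is assumed: each of its level sets is a union of countably many level
sets of `X`. -/
lemma IsDiscreteRV.of_determined (hX : IsDiscreteRV m X)
    (h : ∀ ω ω', X ω = X ω' → Y ω = Y ω') : IsDiscreteRV m Y := by
  constructor
  · have : Set.range Y ⊆ ⋃ s ∈ Set.range X, Y '' {ω | X ω = s} := by
      rintro _ ⟨ω, rfl⟩
      simp only [Set.mem_iUnion]
      exact ⟨X ω, ⟨ω, rfl⟩, ω, rfl, rfl⟩
    refine (hX.1.biUnion fun s _ => Set.Subsingleton.countable ?_).mono this
    rintro _ ⟨ω, hω, rfl⟩ _ ⟨ω', hω', rfl⟩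
    exact h _ _ (hω.trans (Eq.symm hω'))
  · intro t
    have : {ω | Y ω = t} = {ω | X ω ∈ {s | ∃ ω', X ω' = s ∧ Y ω' = t}} := by
      ext ω
      refine ⟨fun hω => ⟨ω, rfl, hω⟩, ?_⟩
      rintro ⟨ω', h1, h2⟩
      exact (h _ _ h1).symm.trans h2
    rw [this]
    exact hX.measurableSet _

lemma IsDiscreteRV.comp (hX : IsDiscreteRV m X) (f : S → T) :
    IsDiscreteRV m fun ω => f (X ω) :=
  hX.of_determined fun _ _ h => congrArg f h

lemma IsDiscreteRV.prodMk (hX : IsDiscreteRV m X) (hY : IsDiscreteRV m Y) :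
    IsDiscreteRV m fun ω => (X ω, Y ω) := by
  constructor
  · refine (hX.1.prod hY.1).mono ?_
    rintro _ ⟨ω, rfl⟩
    exact ⟨⟨ω, rfl⟩, ⟨ω, rfl⟩⟩
  · rintro ⟨s, t⟩
    simp only [Prod.mk.injEq]
    exact (hX.2 s).inter (hY.2 t)

lemma IsDiscreteRV.pi {ι : Type*} [Finite ι] {T : ι → Type*} {X : ∀ i, Ω → T i}
    (hX : ∀ i, IsDiscreteRV m (X i)) : IsDiscreteRV m fun ω i => X i ω := by
  constructor
  · refine (Set.countable_univ_pi fun i => (hX i).1).mono ?_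
    rintro _ ⟨ω, rfl⟩ i _
    exact ⟨ω, rfl⟩
  · intro t
    simp only [funext_iff, Set.ofPred_forall]
    exact MeasurableSet.iInter fun i => (hX i).2 _

/-- Substituting a discrete variable glues countably many measurable functions along its level sets;
there need be no measurable structure on `S`. -/
lemma IsDiscreteRV.measurable_family [MeasurableSpace T] (hX : IsDiscreteRV m X)
    {G : S → Ω → T} (hG : ∀ s, Measurable[m] (G s)) : Measurable[m] fun ω => G (X ω) ω := by
  intro E hE
  have : (fun ω => G (X ω) ω) ⁻¹' E = ⋃ s ∈ Set.range X, {ω | X ω = s} ∩ G s ⁻¹' E := by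
    ext ω
    simp only [Set.mem_preimage, Set.mem_iUnion, Set.mem_inter_iff, Set.mem_ofPred_eq]
    exact ⟨fun h => ⟨X ω, ⟨ω, rfl⟩, rfl, h⟩, fun ⟨s, _, hs, h⟩ => by rwa [hs]⟩
  rw [this]
  exact MeasurableSet.biUnion hX.1 fun s _ => (hX.2 s).inter (hG s hE)

lemma IsDiscreteRV.measurable_comp [MeasurableSpace T] (hX : IsDiscreteRV m X) (f : S → T) :
    Measurable[m] fun ω => f (X ω) :=
  hX.measurable_family fun _ => measurable_const

end Discrete

/-! ### Conditional exponential moments -/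

section CondLE

open scoped ENNReal

variable {Ω S T : Type*} {m mΩ : MeasurableSpace Ω} {μ : Measure Ω}

/-- The conditional expectation of `f` given `m` is at most `1`. -/
def CondLE (μ : Measure Ω) (m : MeasurableSpace Ω) (f : Ω → ℝ≥0∞) : Prop :=
  ∀ E, MeasurableSet[m] E → ∫⁻ ω in E, f ω ∂μ ≤ μ E

lemma measure_eq_tsum_inter (hm : m ≤ mΩ) {X : Ω → T} (hX : IsDiscreteRV m X) (E : Set Ω) :
    μ E = ∑' t : Set.range X, μ (E ∩ {ω | X ω = t}) := by
  have := hX.1.to_subtype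
  have h := measure_iUnion (μ := μ.restrict E) (f := fun t : Set.range X => {ω | X ω = t})
    (fun t t' htt => Set.disjoint_left.2 fun ω h1 h2 =>
      htt (Subtype.ext ((Eq.symm h1).trans h2))) (fun t => hm _ (hX.2 t))
  have hU : (⋃ t : Set.range X, {ω | X ω = t}) = Set.univ := by
    ext ω; simp
  rw [hU, Measure.restrict_apply_univ] at h
  rw [h]
  refine tsum_congr fun t => ?_
  rw [Measure.restrict_apply (hm _ (hX.2 t)), Set.inter_comm]

lemma setLIntegral_eq_tsum_inter (hm : m ≤ mΩ) {X : Ω → T} (hX : IsDiscreteRV m X)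
    {E : Set Ω} (hE : MeasurableSet[mΩ] E) (f : Ω → ℝ≥0∞) :
    ∫⁻ ω in E, f ω ∂μ = ∑' t : Set.range X, ∫⁻ ω in E ∩ {ω | X ω = t}, f ω ∂μ := by
  have := hX.1.to_subtype
  rw [← lintegral_iUnion (fun t : Set.range X => hE.inter (hm _ (hX.2 t)))]
  · congr 2
    ext ω; simp
  · exact fun t t' htt => Set.disjoint_left.2 fun ω h1 h2 =>
      htt (Subtype.ext ((Eq.symm h1.2).trans h2.2))

lemma condLE_of_fibers (hm : m ≤ mΩ) {X : Ω → T} (hX : IsDiscreteRV m X) {f : Ω → ℝ≥0∞}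
    (h : ∀ t E, MeasurableSet[m] E → (∀ ω ∈ E, X ω = t) → ∫⁻ ω in E, f ω ∂μ ≤ μ E) :
    CondLE μ m f := by
  intro E hE
  rw [setLIntegral_eq_tsum_inter hm hX (hm _ hE), measure_eq_tsum_inter hm hX]
  exact ENNReal.tsum_le_tsum fun t => h t _ (hE.inter (hX.2 _)) fun ω hω => hω.2

/-- The hypothesis says that on `m` the measure with density `f` is dominated by `μ`; integrate `g`
against both. -/
lemma CondLE.lintegral_mul_le (hm : m ≤ mΩ) {f g : Ω → ℝ≥0∞} (hf : CondLE μ m f)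
    (hfm : Measurable f) (hg : Measurable[m] g) : ∫⁻ ω, g ω * f ω ∂μ ≤ ∫⁻ ω, g ω ∂μ := by
  have hle : (μ.withDensity f).trim hm ≤ μ.trim hm := by
    refine Measure.le_iff.2 fun E hE => ?_
    rw [trim_measurableSet_eq hm hE, trim_measurableSet_eq hm hE, withDensity_apply _ (hm _ hE)]
    exact hf E hE
  have h1 := lintegral_mono' hle (le_refl g)
  rw [lintegral_trim hm hg, lintegral_trim hm hg,
    lintegral_withDensity_eq_lintegral_mul _ hfm (hg.mono hm le_rfl)] at h1
  simpa [mul_comm] using h1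

/-- The product of factors with conditional means at most `1` has mean at most `1`. -/
lemma lintegral_prod_le [IsProbabilityMeasure μ] {G : ℕ → MeasurableSpace Ω} (hG : Monotone G)
    (hGm : ∀ k, G k ≤ mΩ) {Z : ℕ → Ω → ℝ≥0∞} {n : ℕ}
    (hZm : ∀ k < n, Measurable[G (k + 1)] (Z k)) (hZ : ∀ k < n, CondLE μ (G k) (Z k)) :
    ∫⁻ ω, ∏ k ∈ Finset.range n, Z k ω ∂μ ≤ 1 := by
  induction n with
  | zero => simp
  | succ n ih =>
    simp only [Finset.prod_range_succ]
    refine ((hZ n (by omega)).lintegral_mul_le (hGm n)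
      ((hZm n (by omega)).mono (hGm _) le_rfl) ?_).trans
      (ih (fun k hk => hZm k (by omega)) fun k hk => hZ k (by omega))
    refine Finset.measurable_fun_prod _ fun k hk => ?_
    rw [Finset.mem_range] at hk
    exact (hZm k (by omega)).mono (hG (by omega)) le_rfl

/-- Exponential Markov inequality for a sum of increments with conditional exponential moments at
most `1`. -/
lemma measure_sum_ge_le [IsProbabilityMeasure μ] {G : ℕ → MeasurableSpace Ω} (hG : Monotone G)
    (hGm : ∀ k, G k ≤ mΩ) {Z : ℕ → Ω → ℝ} {n : ℕ}
    (hZm : ∀ k < n, Measurable[G (k + 1)] (Z k))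
    (hZ : ∀ k < n, CondLE μ (G k) fun ω => ENNReal.ofReal (Real.exp (Z k ω)))
    {δ : ℝ} (hδ : 0 < δ) :
    μ {ω | Real.log (1 / δ) ≤ ∑ k ∈ Finset.range n, Z k ω} ≤ ENNReal.ofReal δ := by
  have hZm' : ∀ k < n, Measurable[G (k + 1)] fun ω => ENNReal.ofReal (Real.exp (Z k ω)) :=
    fun k hk => ENNReal.measurable_ofReal.comp (Real.measurable_exp.comp (hZm k hk))
  have h1 := lintegral_prod_le hG hGm hZm' hZ
  have hmeas : Measurable fun ω => ∏ k ∈ Finset.range n, ENNReal.ofReal (Real.exp (Z k ω)) :=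
    Finset.measurable_fun_prod _ fun k hk =>
      (hZm' k (Finset.mem_range.1 hk)).mono (hGm _) le_rfl
  have h2 := mul_meas_ge_le_lintegral (μ := μ) hmeas (ENNReal.ofReal (1 / δ))
  have hsub : {ω | Real.log (1 / δ) ≤ ∑ k ∈ Finset.range n, Z k ω}
      ⊆ {ω | ENNReal.ofReal (1 / δ) ≤ ∏ k ∈ Finset.range n, ENNReal.ofReal (Real.exp (Z k ω))} := by
    intro ω hω
    simp only [Set.mem_ofPred_eq] at hω ⊢
    rw [← ENNReal.ofReal_prod_of_nonneg fun _ _ => (Real.exp_pos _).le, ← Real.exp_sum]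
    refine ENNReal.ofReal_le_ofReal ?_
    rw [← Real.exp_log (show 0 < 1 / δ by positivity)]
    exact Real.exp_le_exp.2 hω
  have h3 : ENNReal.ofReal δ * (ENNReal.ofReal (1 / δ)) = 1 := by
    rw [← ENNReal.ofReal_mul hδ.le, mul_one_div_cancel hδ.ne', ENNReal.ofReal_one]
  calc _ ≤ μ _ := measure_mono hsub
    _ = ENNReal.ofReal δ * (ENNReal.ofReal (1 / δ) * μ _) := by rw [← mul_assoc, h3, one_mul]
    _ ≤ ENNReal.ofReal δ * 1 := mul_le_mul_right (h2.trans h1) _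
    _ = _ := mul_one _

/-- Translates the conditional laws of a run into a product formula on events of the past where the
conditional probability is constant, such as the fibres of discrete data. -/
lemma measure_inter_eq_of_condExp [IsProbabilityMeasure μ] (hm : m ≤ mΩ) {D : Set Ω}
    (hD : MeasurableSet[mΩ] D) {g : Ω → ℝ}
    (hg : μ[D.indicator (fun _ => (1 : ℝ)) | m] =ᵐ[μ] g) {E : Set Ω} (hE : MeasurableSet[m] E)
    {c : ℝ} (hc0 : 0 ≤ c) (hc : ∀ ω ∈ E, g ω = c) : μ (E ∩ D) = ENNReal.ofReal c * μ E := by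
  have h1 := setIntegral_condExp (μ := μ) hm
    ((integrable_const (1 : ℝ)).indicator hD) hE
  rw [setIntegral_congr_ae (hm _ hE) (g := fun _ => c)
    (hg.mono fun ω h hω => h.trans (hc ω hω)), setIntegral_const,
    setIntegral_indicator hD, setIntegral_const] at h1
  simp only [smul_eq_mul, mul_one] at h1
  rw [← ofReal_measureReal, ← h1, mul_comm, ENNReal.ofReal_mul hc0, ofReal_measureReal]

lemma setLIntegral_inter_eq_mul (hm : m ≤ mΩ) {E D : Set Ω} (hE : MeasurableSet[m] E)
    {q : ℝ≥0∞}
    (h : ∀ F, MeasurableSet[m] F → F ⊆ E → μ (F ∩ D) = q * μ F) {f : Ω → ℝ≥0∞}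
    (hf : Measurable[m] f) : ∫⁻ ω in E ∩ D, f ω ∂μ = q * ∫⁻ ω in E, f ω ∂μ := by
  have heq : (μ.restrict (E ∩ D)).trim hm = (q • μ.restrict E).trim hm := by
    refine @Measure.ext _ m _ _ fun F hF => ?_
    rw [trim_measurableSet_eq hm hF, trim_measurableSet_eq hm hF, Measure.smul_apply,
      Measure.restrict_apply (hm _ hF), Measure.restrict_apply (hm _ hF), ← Set.inter_assoc,
      h _ (hF.inter hE) Set.inter_subset_right, smul_eq_mul]
  rw [← lintegral_trim hm hf, heq, lintegral_trim hm hf, lintegral_smul_measure, smul_eq_mul]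

variable {X : Ω → S} {Y : Ω → T} {reach : T → Finset S} {P : T → S → ℝ≥0∞}

/-- A function of the next state `X` has conditional mean at most `1` if its mean under the
transition probabilities `P` of the current discrete data `Y` is at most `1`. -/
lemma condLE_of_transition (hm : m ≤ mΩ) (hY : IsDiscreteRV m Y) (hX : IsDiscreteRV mΩ X)
    (hP : ∀ t, ∀ s ∉ reach t, P t s = 0)
    (hlaw : ∀ t s E, MeasurableSet[m] E → (∀ ω ∈ E, Y ω = t) →
      μ (E ∩ {ω | X ω = s}) = P t s * μ E)
    {F : S → Ω → ℝ≥0∞} (hF : ∀ s, Measurable[m] (F s))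
    (hle : ∀ ω, ∑ s ∈ reach (Y ω), P (Y ω) s * F s ω ≤ 1) :
    CondLE μ m fun ω => F (X ω) ω := by
  classical
  refine condLE_of_fibers hm hY fun t E hE hEt => ?_
  rw [setLIntegral_eq_tsum_inter le_rfl hX (hm _ hE)]
  have h1 : ∀ s : Set.range X, ∫⁻ ω in E ∩ {ω | X ω = s}, F (X ω) ω ∂μ
      = P t s * ∫⁻ ω in E, F s ω ∂μ := by
    intro s
    rw [← setLIntegral_inter_eq_mul hm hE (q := P t s)
      (fun G hG hGE => hlaw t s G hG fun ω hω => hEt ω (hGE hω)) (hF s)]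
    refine setLIntegral_congr_fun ((hm _ hE).inter (hX.2 s)) fun ω hω => ?_
    have : X ω = s := hω.2
    simp only [this]
  simp only [h1]
  have h2 : ∑' s : Set.range X, P t s * ∫⁻ ω in E, F s ω ∂μ
      ≤ ∑ s ∈ reach t, P t s * ∫⁻ ω in E, F s ω ∂μ := by
    have h3 := ENNReal.tsum_comp_le_tsum_of_injective
      (f := fun s : Set.range X => (s : S)) Subtype.val_injective
      (fun s => P t s * ∫⁻ ω in E, F s ω ∂μ)
    refine h3.trans (le_of_eq ?_)
    exact tsum_eq_sum fun s hs => by rw [hP t s hs, zero_mul]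
  refine h2.trans ?_
  have hF' : ∀ s, Measurable (F s) := fun s => (hF s).mono hm le_rfl
  rw [← setLIntegral_one E]
  calc ∑ s ∈ reach t, P t s * ∫⁻ ω in E, F s ω ∂μ
      = ∫⁻ ω in E, ∑ s ∈ reach t, P t s * F s ω ∂μ := by
        rw [lintegral_finsetSum _ fun s _ => (hF' s).const_mul _]
        exact Finset.sum_congr rfl fun s _ => (lintegral_const_mul _ (hF' s)).symm
    _ ≤ ∫⁻ _ in E, 1 ∂μ := setLIntegral_mono' (hm _ hE) fun ω hω => by
        have := hle ω
        rwa [hEt ω hω] at this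

lemma measure_notMem_reach (hY : IsDiscreteRV m Y) (hX : IsDiscreteRV mΩ X)
    (hP : ∀ t, ∀ s ∉ reach t, P t s = 0)
    (hlaw : ∀ t s E, MeasurableSet[m] E → (∀ ω ∈ E, Y ω = t) →
      μ (E ∩ {ω | X ω = s}) = P t s * μ E) : μ {ω | X ω ∉ reach (Y ω)} = 0 := by
  classical
  have hsub : {ω | X ω ∉ reach (Y ω)} ⊆ ⋃ t ∈ Set.range Y, ⋃ s ∈ Set.range X,
      if s ∈ reach t then ∅ else {ω | Y ω = t} ∩ {ω | X ω = s} := by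
    intro ω hω
    simp only [Set.mem_iUnion]
    refine ⟨Y ω, ⟨ω, rfl⟩, X ω, ⟨ω, rfl⟩, ?_⟩
    rw [if_neg hω]
    exact ⟨rfl, rfl⟩
  refine measure_mono_null hsub ?_
  rw [measure_biUnion_null_iff hY.1]
  intro t _
  rw [measure_biUnion_null_iff hX.1]
  intro s _
  split_ifs with h
  · exact measure_empty
  · rw [hlaw t s _ (hY.2 t) fun ω hω => hω, hP t s h, zero_mul]

/-- Conditional probability bound for an event on fresh noise that depends on discrete data. -/
lemma measure_inter_le_of_fibers (hm : m ≤ mΩ) (hY : IsDiscreteRV m Y) {D : Set Ω} {q : ℝ≥0∞}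
    (h : ∀ t E, MeasurableSet[m] E → (∀ ω ∈ E, Y ω = t) → μ (E ∩ D) ≤ q * μ E) {E : Set Ω}
    (hE : MeasurableSet[m] E) : μ (E ∩ D) ≤ q * μ E := by
  rw [measure_eq_tsum_inter hm hY E, measure_eq_tsum_inter hm hY (E ∩ D), ← ENNReal.tsum_mul_left]
  refine ENNReal.tsum_le_tsum fun t => ?_
  rw [Set.inter_right_comm]
  exact h t _ (hE.inter (hY.2 t)) fun ω hω => hω.2

end CondLE

/-! ### Measurability and concentration along a run -/

section Run

open scoped ENNReal

variable {S A Ω : Type*} {H d : ℕ} {𝓜 : EpisodicMDP S A H} {φ : S → A → S → Vec d}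
  {Lφ Lθ : ℝ} {prm : Params} {K : ℕ} [mΩ : MeasurableSpace Ω] {μ : Measure Ω}
  (R : ORRLRun 𝓜 φ Lθ prm K μ)

/-- The action played in episode `k` at step `h`. -/
def ORRLRun.act (k : ℕ) (h : Fin H) (ω : Ω) : A := R.policy k ω h (R.state k h ω)

lemma ORRLRun.path (h : Fin H) (ω : Ω) :
    OMDPath 𝓜 φ Lθ prm.lam prm.eta K (fun k => R.theta k h ω) (fun k => R.gram k h ω)
      (fun k => R.state k h ω) (fun k => R.act k h ω) (fun k => R.state k (h + 1) ω) where
  theta_zero := R.theta_zero h ω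
  gram_zero := R.gram_zero h ω
  theta_mem k hk := R.theta_mem k hk h ω
  theta_min k hk := R.theta_min k hk h ω
  gram_succ k hk := R.gram_succ k hk h ω

lemma clock_mono {k j k' j' : ℕ} (h : clock H k j ≤ clock H k' j') :
    R.filt (clock H k j) ≤ R.filt (clock H k' j') := R.filt.mono h

lemma ORRLRun.isDiscreteRV_state {k : ℕ} (hk : k < K) (h : Fin H) :
    IsDiscreteRV (R.filt (clock H k (h + 1))) (R.state k h) := by
  obtain ⟨h, hh⟩ := h
  cases h with
  | zero => exact (R.state_initial k hk).mono (clock_mono R (by simp [clock]))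
  | succ j => exact R.state_next k hk ⟨j, by omega⟩

lemma ORRLRun.isDiscreteRV_policy [Finite A] {k : ℕ} (hk : k < K) (h : Fin H) (s : S) :
    IsDiscreteRV (R.filt (clock H k 1)) (fun ω => R.policy k ω h s) :=
  ⟨Set.to_countable _, fun a => R.policy_meas k hk h s a⟩

lemma ORRLRun.isDiscreteRV_act [Finite A] {k : ℕ} (hk : k < K) (h : Fin H) :
    IsDiscreteRV (R.filt (clock H k (h + 1))) (R.act k h) := by
  refine ⟨Set.to_countable _, fun a => ?_⟩
  have hX := R.isDiscreteRV_state hk h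
  -- The policy is measurable only state by state, so the event is split over the countable range of
  -- the current state.
  have : {ω | R.act k h ω = a}
      = ⋃ s ∈ Set.range (R.state k h), {ω | R.state k h ω = s} ∩ {ω | R.policy k ω h s = a} := by
    ext ω
    simp only [Set.mem_iUnion, Set.mem_inter_iff, Set.mem_ofPred_eq]
    exact ⟨fun hω => ⟨_, ⟨ω, rfl⟩, rfl, hω⟩, fun ⟨s, _, hs, hω⟩ => by subst hs; exact hω⟩
  rw [this]
  refine MeasurableSet.biUnion hX.1 fun s _ => (hX.2 s).inter ?_
  exact clock_mono R (by simp [clock]) _ (R.policy_meas k hk h s a)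

/-- The estimates of an episode are discrete random variables of the past. -/
lemma ORRLRun.isDiscreteRV_estimate [Finite A] (hlam : 0 < prm.lam) (hη : 0 < prm.eta) {k : ℕ}
    (hk : k ≤ K) (h : Fin H) :
    IsDiscreteRV (R.filt (clock H k 0)) (fun ω => (R.theta k h ω, R.gram k h ω)) := by
  have hle : ∀ i : Fin k, ∀ j ≤ H + 1, clock H i j ≤ clock H k 0 := fun i j hj => by
    have := Nat.mul_le_mul_right (H + 1) (Nat.succ_le_of_lt i.2)
    simp only [clock]
    rw [Nat.succ_mul] at this
    omega
  have hX : IsDiscreteRV (R.filt (clock H k 0)) (fun ω (i : Fin k) =>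
      (R.state i h ω, R.act i h ω, R.state i (h + 1) ω)) := by
    refine IsDiscreteRV.pi fun i => ?_
    have hi : (i : ℕ) < K := i.2.trans_le hk
    have h2 : (h : ℕ) + 2 ≤ H + 1 := by omega
    exact ((R.isDiscreteRV_state hi h).mono (clock_mono R (hle i _ (by omega)))).prodMk
      (((R.isDiscreteRV_act hi h).mono (clock_mono R (hle i _ (by omega)))).prodMk
        ((R.state_next i hi h).mono (clock_mono R (hle i _ h2))))
  -- Outcomes with equal observed transitions have equal estimates, by uniqueness of the mirror
  -- descent path.
  refine hX.of_determined fun ω ω' heq => ?_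
  have := (R.path h ω).unique (R.path h ω') hlam hη hk fun j hj => by
    have := congrFun heq ⟨j, hj⟩
    simpa only [Prod.mk.injEq] using this
  exact Prod.ext this.1 this.2

/-- The data of an episode that are known before its noise is sampled. -/
def ORRLRun.data (k : ℕ) (ω : Ω) : ((Fin H → Vec d) × (Fin H → Matrix (Fin d) (Fin d) ℝ)) × S :=
  ((fun h => R.theta k h ω, fun h => R.gram k h ω), R.state k 0 ω)

lemma ORRLRun.isDiscreteRV_data [Finite A] (hlam : 0 < prm.lam) (hη : 0 < prm.eta) {k : ℕ}
    (hk : k < K) : IsDiscreteRV (R.filt (clock H k 0)) (R.data k) := by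
  have h1 := IsDiscreteRV.pi fun h : Fin H => R.isDiscreteRV_estimate hlam hη hk.le h
  exact (h1.comp fun x => ((fun h => (x h).1, fun h => (x h).2) :
    (Fin H → Vec d) × (Fin H → Matrix (Fin d) (Fin d) ℝ))).prodMk (R.state_initial k hk)

lemma ORRLRun.posDef (hlam : 0 < prm.lam) {k : ℕ} (hk : k ≤ K) (h : Fin H) (ω : Ω) :
    (R.gram k h ω).PosDef ∧ ∀ x, prm.lam * ‖x‖ ^ 2 ≤ sqNorm (R.gram k h ω) x :=
  (R.path h ω).posDef hlam k hk

lemma ORRLRun.monotone_filt_step (h : Fin H) :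
    Monotone fun k => R.filt (clock H k (h + 1)) := fun k k' hkk =>
  clock_mono R (by simp only [clock]; gcongr)

lemma ORRLRun.filt_next_le (k : ℕ) (h : Fin H) :
    R.filt (clock H k (h + 2)) ≤ R.filt (clock H (k + 1) (h + 1)) :=
  clock_mono R (by simp only [clock, Nat.succ_mul]; omega)

lemma ORRLRun.isDiscreteRV_next {k : ℕ} (hk : k < K) (h : Fin H) :
    IsDiscreteRV (R.filt (clock H (k + 1) (h + 1))) (R.state k (h + 1)) :=
  (R.state_next k hk h).mono (R.filt_next_le k h)

lemma ORRLRun.measurable_noise {k : ℕ} (hk : k < K) :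
    Measurable[R.filt (clock H k 1)] fun ω (i : Fin H × Fin prm.M) => R.noise k i.1 i.2 ω :=
  (@measurable_pi_iff _ _ _ (R.filt (clock H k 1)) _ _).2 fun i => R.noise_meas k hk i.1 i.2

/-- The optimistic value function of an episode of the run. -/
def ORRLRun.optVal (k h : ℕ) (s : S) (ω : Ω) : ℝ :=
  optValue 𝓜 φ (prm.beta k) (fun h => R.theta k h ω) (fun h => R.gram k h ω)
    (fun h m => R.noise k h m ω) h s

lemma ORRLRun.measurable_optVal [Finite A] (hlam : 0 < prm.lam) (hη : 0 < prm.eta) {k : ℕ}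
    (hk : k < K) (h : ℕ) (s : S) : Measurable[R.filt (clock H k 1)] (R.optVal k h s) :=
  ((R.isDiscreteRV_data hlam hη hk).mono (clock_mono R (by simp [clock]))).measurable_family
    (G := fun x ω => optValue 𝓜 φ (prm.beta k) x.1.1 x.1.2 (fun h m => R.noise k h m ω) h s)
    fun x => (measurable_optValue (𝓜 := 𝓜) (φ := φ) (M := prm.M) (prm.beta k) x.1.1 x.1.2 h s).comp
      (R.measurable_noise hk)

lemma measurable_policyValue [Finite A] {X : Type*} {m : MeasurableSpace X} {π : X → Policy S A H}
    (hπ : ∀ h s, IsDiscreteRV m fun ω => π ω h s) (h : ℕ) (s : S) :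
    Measurable[m] fun ω => policyValue 𝓜 (π ω) h s := by
  rcases le_or_gt h H with hh | hh
  · induction hh using Nat.decreasingInduction generalizing s with
    | self => simp only [policyValue_of_ge _ le_rfl]; exact measurable_const
    | of_succ k hk ih =>
      have h1 := (hπ ⟨k, hk⟩ s).measurable_family (G := fun a ω => 𝓜.reward s a +
        ∑ s' ∈ 𝓜.reach s a, (𝓜.P ⟨k, hk⟩ s a s').toReal * policyValue 𝓜 (π ω) (k + 1) s')
        fun a => measurable_const.add (Finset.measurable_sum _ fun s' _ => (ih s').const_mul _)
      have h2 : (fun ω => policyValue 𝓜 (π ω) k s) = fun ω => 𝓜.reward s (π ω ⟨k, hk⟩ s) +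
          ∑ s' ∈ 𝓜.reach s (π ω ⟨k, hk⟩ s), (𝓜.P ⟨k, hk⟩ s (π ω ⟨k, hk⟩ s) s').toReal
            * policyValue 𝓜 (π ω) (k + 1) s' := by
        ext ω
        rw [policyValue, dif_pos hk]
      rw [h2]
      exact h1
  · simp only [policyValue_of_ge _ hh.le]; exact measurable_const

/-- The value function of an episode without exploration noise. -/
def ORRLRun.baseVal (k h : ℕ) (s : S) (ω : Ω) : ℝ :=
  baseValue 𝓜 φ prm.M (prm.beta k) (fun h => R.theta k h ω) (fun h => R.gram k h ω) h s

/-- The potential of the regret decomposition in an episode of the run. -/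
def ORRLRun.gap (k h : ℕ) (s : S) (ω : Ω) : ℝ :=
  gapValue 𝓜 φ (prm.beta k) (fun h => R.theta k h ω) (fun h => R.gram k h ω)
    (fun h m => R.noise k h m ω) (R.policy k ω) h s

lemma ORRLRun.measurable_gap [Finite A] (hlam : 0 < prm.lam) (hη : 0 < prm.eta) {k : ℕ}
    (hk : k < K) (h : ℕ) (s : S) : Measurable[R.filt (clock H k 1)] (R.gap k h s) := by
  have h1 := R.measurable_optVal hlam hη hk h s
  have h2 : Measurable[R.filt (clock H k 1)] (R.baseVal k h s) :=
    ((R.isDiscreteRV_data hlam hη hk).mono (clock_mono R (by simp [clock]))).measurable_comp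
      fun x => baseValue 𝓜 φ prm.M (prm.beta k) x.1.1 x.1.2 h s
  have h3 : Measurable[R.filt (clock H k 1)] fun ω => policyValue 𝓜 (R.policy k ω) h s :=
    measurable_policyValue (fun h s => R.isDiscreteRV_policy hk h s) h s
  exact ((h1.sub h2).const_mul 4).add (h1.sub h3)

variable [IsProbabilityMeasure μ]

lemma ORRLRun.transition_law {k : ℕ} (hk : k < K) (h : Fin H) (t : S × A) (s' : S) (E : Set Ω)
    (hE : MeasurableSet[R.filt (clock H k (h + 1))] E)
    (ht : ∀ ω ∈ E, (R.state k h ω, R.act k h ω) = t) :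
    μ (E ∩ {ω | R.state k (h + 1) ω = s'}) = 𝓜.P h t.1 t.2 s' * μ E := by
  rw [measure_inter_eq_of_condExp (R.filt.le _)
    (R.filt.le _ _ ((R.state_next k hk h).2 s')) (R.state_law k hk h s') hE
    (c := (𝓜.P h t.1 t.2 s').toReal) ENNReal.toReal_nonneg fun ω hω => ?_,
    ENNReal.ofReal_toReal (PMF.apply_ne_top _ _)]
  rw [← ht ω hω]; rfl

lemma ORRLRun.measure_state_notMem [Finite A] {k : ℕ} (hk : k < K) (h : Fin H) :
    μ {ω | R.state k (h + 1) ω ∉ 𝓜.reach (R.state k h ω) (R.act k h ω)} = 0 :=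
  measure_notMem_reach (μ := μ) (X := R.state k (h + 1))
    (Y := fun ω => (R.state k h ω, R.act k h ω))
    (reach := fun t => 𝓜.reach t.1 t.2) (P := fun t => 𝓜.P h t.1 t.2)
    ((R.isDiscreteRV_state hk h).prodMk (R.isDiscreteRV_act hk h))
    ((R.state_next k hk h).mono (R.filt.le _))
    (fun t s' hs' => by rwa [𝓜.mem_reach_iff h, not_not] at hs')
    (R.transition_law hk h)

lemma ORRLRun.condLE_next [Finite A] {θs : Fin H → Vec d} (hM : IsMNL 𝓜 φ θs) {k : ℕ}
    (hk : k < K) (h : Fin H) {f : S → Ω → ℝ}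
    (hf : ∀ s', Measurable[R.filt (clock H k (h + 1))] (f s'))
    (hle : ∀ ω, ∑ s' ∈ 𝓜.reach (R.state k h ω) (R.act k h ω),
      mnlProb 𝓜 φ (θs h) (R.state k h ω) (R.act k h ω) s' * Real.exp (f s' ω) ≤ 1) :
    CondLE μ (R.filt (clock H k (h + 1)))
      fun ω => ENNReal.ofReal (Real.exp (f (R.state k (h + 1) ω) ω)) := by
  refine condLE_of_transition (X := R.state k (h + 1))
    (Y := fun ω => (R.state k h ω, R.act k h ω))
    (reach := fun t => 𝓜.reach t.1 t.2) (P := fun t => 𝓜.P h t.1 t.2) (R.filt.le _)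
    ((R.isDiscreteRV_state hk h).prodMk (R.isDiscreteRV_act hk h))
    ((R.state_next k hk h).mono (R.filt.le _))
    (fun t s' hs' => by rwa [𝓜.mem_reach_iff h, not_not] at hs')
    (R.transition_law hk h)
    (F := fun s' ω => ENNReal.ofReal (Real.exp (f s' ω)))
    (fun s' => ENNReal.measurable_ofReal.comp (Real.measurable_exp.comp (hf s'))) fun ω => ?_
  rw [← ENNReal.ofReal_one]
  refine le_trans (le_of_eq ?_) (ENNReal.ofReal_le_ofReal (hle ω))
  rw [ENNReal.ofReal_sum_of_nonneg fun _ _ =>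
    mul_nonneg (mnlProb_nonneg _ _ _ _) (Real.exp_pos _).le]
  refine Finset.sum_congr rfl fun s' hs' => ?_
  rw [ENNReal.ofReal_mul (mnlProb_nonneg _ _ _ _), ← hM h _ _ _ hs',
    ENNReal.ofReal_toReal (PMF.apply_ne_top _ _)]

/-- Exponential tail bound for sums over the episodes of a function of the next state. -/
lemma ORRLRun.measure_sum_next_ge_le [Finite A] {θs : Fin H → Vec d} (hM : IsMNL 𝓜 φ θs)
    (h : Fin H) {n : ℕ} (hn : n ≤ K) {f : ℕ → S → Ω → ℝ}
    (hf : ∀ k < n, ∀ s', Measurable[R.filt (clock H k (h + 1))] (f k s'))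
    (hle : ∀ k < n, ∀ ω, ∑ s' ∈ 𝓜.reach (R.state k h ω) (R.act k h ω),
      mnlProb 𝓜 φ (θs h) (R.state k h ω) (R.act k h ω) s' * Real.exp (f k s' ω) ≤ 1)
    {δ : ℝ} (hδ : 0 < δ) :
    μ {ω | Real.log (1 / δ) ≤ ∑ k ∈ Finset.range n, f k (R.state k (h + 1) ω) ω}
      ≤ ENNReal.ofReal δ :=
  measure_sum_ge_le (R.monotone_filt_step h) (fun _ => R.filt.le _)
    (fun k hk => (R.isDiscreteRV_next (by omega) h).measurable_family fun s' =>
      (hf k hk s').mono (R.monotone_filt_step h (Nat.le_succ k)) le_rfl)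
    (fun k hk => R.condLE_next hM (by omega) h (hf k hk) (hle k hk)) hδ

/-- Tail bound for the likelihood ratio process. -/
lemma ORRLRun.measure_sum_logRatio_ge_le [Finite A] {θs : Fin H → Vec d} (hM : IsMNL 𝓜 φ θs)
    (hne : ∀ s a, (𝓜.reach s a).Nonempty)
    (hL : ∀ s a, ∀ s' ∈ 𝓜.reach s a, ‖φ s a s'‖ ≤ Lφ) (hlam : 0 < prm.lam) (hη : 0 < prm.eta)
    (hlam4 : 4 * prm.eta * Lφ ^ 2 ≤ prm.lam) (h : Fin H) {n : ℕ} (hn : n ≤ K) {δ : ℝ}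
    (hδ : 0 < δ) :
    μ {ω | Real.log (1 / δ) ≤ ∑ k ∈ Finset.range n, logRatio 𝓜 φ prm.eta (θs h) (R.gram k h ω)
      (R.theta k h ω) (R.state k h ω) (R.act k h ω) (R.state k (h + 1) ω)} ≤ ENNReal.ofReal δ := by
  refine R.measure_sum_next_ge_le hM h hn (f := fun k s' ω => logRatio 𝓜 φ prm.eta (θs h)
    (R.gram k h ω) (R.theta k h ω) (R.state k h ω) (R.act k h ω) s') (fun k hk s' => ?_)
    (fun k hk ω => ?_) hδ
  · have h1 := ((R.isDiscreteRV_estimate hlam hη (show k ≤ K by omega) h).mono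
      (clock_mono R (by simp [clock]))).prodMk ((R.isDiscreteRV_state (by omega) h).prodMk
        (R.isDiscreteRV_act (show k < K by omega) h))
    exact h1.measurable_comp fun x : (Vec d × Matrix (Fin d) (Fin d) ℝ) × S × A =>
      logRatio 𝓜 φ prm.eta (θs h) x.1.2 x.1.1 x.2.1 x.2.2 s'
  · have hB := R.posDef hlam (show k ≤ K by omega) h ω
    exact sum_mnlProb_exp_logRatio_le (hne _ _) (hL _ _) hη.le hlam hlam4 hB.1 hB.2 _ _

/-- Concentration of the potential at the next state around its mean. -/
lemma ORRLRun.measure_sum_gap_ge_le [Finite A] [Nonempty A] {θs : Fin H → Vec d}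
    (hM : IsMNL 𝓜 φ θs) (hne : ∀ s a, (𝓜.reach s a).Nonempty) (hMs : 0 < prm.M)
    (hlam : 0 < prm.lam) (hη : 0 < prm.eta) (h : Fin H) {c : ℝ} (hc : 0 ≤ c) {δ : ℝ}
    (hδ : 0 < δ) :
    μ {ω | Real.log (1 / δ) ≤ ∑ k ∈ Finset.range K,
      (c * (modelMean 𝓜 φ (θs h) (R.state k h ω) (R.act k h ω) (fun s' => R.gap k (h + 1) s' ω)
        - R.gap k (h + 1) (R.state k (h + 1) ω) ω) - (c * (10 * H)) ^ 2)} ≤ ENNReal.ofReal δ := by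
  refine R.measure_sum_next_ge_le hM h le_rfl (f := fun k s' ω =>
    c * (modelMean 𝓜 φ (θs h) (R.state k h ω) (R.act k h ω) (fun s' => R.gap k (h + 1) s' ω)
        - R.gap k (h + 1) s' ω) - (c * (10 * H)) ^ 2) (fun k hk s' => ?_) (fun k hk ω => ?_) hδ
  · have hg : ∀ s', Measurable[R.filt (clock H k (h + 1))] (R.gap k (h + 1) s') := fun s' =>
      (R.measurable_gap hlam hη hk (h + 1) s').mono (clock_mono R (by simp [clock])) le_rfl
    have h1 := ((R.isDiscreteRV_state hk h).prodMk (R.isDiscreteRV_act hk h)).measurable_family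
      (G := fun t ω => modelMean 𝓜 φ (θs h) t.1 t.2 (fun s' => R.gap k (h + 1) s' ω))
      fun t => Finset.measurable_sum _ fun s' _ => (hg s').const_mul _
    exact ((h1.sub (hg s')).const_mul c).sub measurable_const
  · set s := R.state k h ω
    set a := R.act k h ω
    set g := fun s' => R.gap k (h + 1) s' ω
    -- The deviation from the mean is therefore at most `10H`, which is the range subtracted in the
    -- exponent.
    have hgb : ∀ s', |g s'| ≤ 5 * H := fun s' =>
      abs_gapValue_le hMs hne hM (fun h => (R.posDef hlam hk.le h ω).1) _ _ h.2 s'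
    have hp1 := sum_mnlProb (φ := φ) (hne s a) (θs h)
    have hm : |modelMean 𝓜 φ (θs h) s a g| ≤ 5 * H := abs_le.2
      ⟨le_modelMean hne _ _ _ fun s' => (abs_le.1 (hgb s')).1,
        modelMean_le hne _ _ _ fun s' => (abs_le.1 (hgb s')).2⟩
    have hexp := sum_exp_le (I := 𝓜.reach s a) (p := mnlProb 𝓜 φ (θs h) s a)
      (z := fun s' => c * (modelMean 𝓜 φ (θs h) s a g - g s')) (c := c * (10 * H))
      (fun _ _ => mnlProb_nonneg _ _ _ _) hp1
      (fun s' _ => by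
        rw [abs_mul, abs_of_nonneg hc]
        refine mul_le_mul_of_nonneg_left ?_ hc
        have := abs_sub (modelMean 𝓜 φ (θs h) s a g) (g s')
        linarith [hgb s'])
      (by
        have : ∑ i ∈ 𝓜.reach s a, mnlProb 𝓜 φ (θs h) s a i
            * (c * (modelMean 𝓜 φ (θs h) s a g - g i))
            = c * (modelMean 𝓜 φ (θs h) s a g * (∑ i ∈ 𝓜.reach s a, mnlProb 𝓜 φ (θs h) s a i)
              - modelMean 𝓜 φ (θs h) s a g) := by
          conv_rhs => rw [show ∀ x y : ℝ, c * (modelMean 𝓜 φ (θs h) s a g * x - y)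
            = modelMean 𝓜 φ (θs h) s a g * (c * x) - c * y from fun x y => by ring]
          rw [show c * modelMean 𝓜 φ (θs h) s a g
            = ∑ i ∈ 𝓜.reach s a, c * (mnlProb 𝓜 φ (θs h) s a i * g i) from by
              rw [modelMean, Finset.mul_sum], Finset.mul_sum, Finset.mul_sum,
            ← Finset.sum_sub_distrib]
          exact Finset.sum_congr rfl fun i _ => by ring
        rw [this, hp1]; simp)
    simp_rw [Real.exp_sub, mul_div_assoc']
    rw [← Finset.sum_div]
    exact (div_le_one (Real.exp_pos _)).2 hexp

/-- The noise covariance is random; on a past event where the Gram matrices are constant, the noise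
has one fixed Gaussian product law, independent of that event. -/
lemma ORRLRun.noise_law_inter {k : ℕ} (hk : k < K) {Λ : Set (Fin H × Fin prm.M → Vec d)}
    (hΛ : MeasurableSet Λ) {E : Set Ω} (hE : MeasurableSet[R.filt (clock H k 0)] E)
    {B : Fin H → Matrix (Fin d) (Fin d) ℝ} (hB : ∀ ω ∈ E, ∀ h, R.gram k h ω = B h) :
    μ (E ∩ {ω | (fun i : Fin H × Fin prm.M => R.noise k i.1 i.2 ω) ∈ Λ})
      = ENNReal.ofReal ((noiseLaw prm.M (prm.sigma k) B).real Λ) * μ E := by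
  refine measure_inter_eq_of_condExp (R.filt.le _)
    (R.filt.le _ _ (R.measurable_noise hk hΛ)) (R.noise_law k hk Λ hΛ) hE
    measureReal_nonneg fun ω hω => ?_
  simp only [hB ω hω]
  rfl

lemma noiseLaw_eval (M : ℕ) (σ : ℝ) (B : Fin H → Matrix (Fin d) (Fin d) ℝ) (i : Fin H × Fin M)
    {E : Set (Vec d)} (hE : MeasurableSet E) :
    (noiseLaw M σ B).real {ξ | ξ i ∈ E}
      = (multivariateGaussian (0 : Vec d) (σ ^ 2 • (B i.1)⁻¹)).real E := by
  have := (measurePreserving_eval (fun i : Fin H × Fin M =>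
    multivariateGaussian (0 : Vec d) (σ ^ 2 • (B i.1)⁻¹)) i).measure_preimage hE.nullMeasurableSet
  rw [measureReal_def, measureReal_def, ← this]
  rfl

/-- Tail bound for the noise vectors. -/
lemma ORRLRun.measure_noise_gt_le [Finite A] (hlam : 0 < prm.lam) (hη : 0 < prm.eta) {k : ℕ}
    (hk : k < K) (hσ : 0 < prm.sigma k) (h : Fin H) (i : Fin prm.M) {r : ℝ} (hr : 0 ≤ r) :
    μ {ω | prm.sigma k ^ 2 * (d * r ^ 2) < sqNorm (R.gram k h ω) (R.noise k h i ω)}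
      ≤ ENNReal.ofReal (2 * d * Real.exp (-r ^ 2 / 2)) := by
  have key := measure_inter_le_of_fibers (μ := μ) (R.filt.le _)
    (R.isDiscreteRV_data hlam hη hk)
    (D := {ω | prm.sigma k ^ 2 * (d * r ^ 2) < sqNorm (R.gram k h ω) (R.noise k h i ω)})
    (q := ENNReal.ofReal (2 * d * Real.exp (-r ^ 2 / 2))) (fun t E hE ht => ?_)
    (MeasurableSet.univ)
  · simpa using key
  rcases E.eq_empty_or_nonempty with rfl | ⟨ω₀, hω₀⟩
  · simp
  have hB : ∀ ω ∈ E, ∀ h, R.gram k h ω = R.gram k h ω₀ := fun ω hω h' => by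
    have := (ht ω hω).trans (ht ω₀ hω₀).symm
    exact congrFun (congrArg (fun x => x.1.2) this) h'
  have hm : MeasurableSet {ξ : Vec d | prm.sigma k ^ 2 * (d * r ^ 2)
      < sqNorm (R.gram k h ω₀) ξ} := measurableSet_lt measurable_const (measurable_sqNorm _)
  have hΛ : MeasurableSet {ξ : Fin H × Fin prm.M → Vec d | ξ (h, i) ∈
      {ξ : Vec d | prm.sigma k ^ 2 * (d * r ^ 2) < sqNorm (R.gram k h ω₀) ξ}} :=
    measurable_pi_apply (h, i) hm
  have h1 := R.noise_law_inter hk hΛ hE hB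
  have hset : E ∩ {ω | prm.sigma k ^ 2 * (d * r ^ 2) < sqNorm (R.gram k h ω) (R.noise k h i ω)}
      ⊆ E ∩ {ω | (fun i : Fin H × Fin prm.M => R.noise k i.1 i.2 ω) ∈
        {ξ : Fin H × Fin prm.M → Vec d | ξ (h, i) ∈
      {ξ : Vec d | prm.sigma k ^ 2 * (d * r ^ 2) < sqNorm (R.gram k h ω₀) ξ}}} := by
    rintro ω ⟨hω, hω'⟩
    refine ⟨hω, ?_⟩
    simp only [Set.mem_ofPred_eq] at hω' ⊢
    rwa [hB ω hω h] at hω'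
  refine (measure_mono hset).trans (h1.le.trans ?_)
  refine mul_le_mul_left (ENNReal.ofReal_le_ofReal ?_) _
  rw [noiseLaw_eval _ _ _ _ hm]
  exact multivariateGaussian_sqNorm_gt_le (R.posDef hlam hk.le h ω₀).1 hσ hr

end Run

/-! ### Widths and squared feature norms against information gain -/

section Elliptical

variable {S A : Type*} {H d : ℕ} {𝓜 : EpisodicMDP S A H} {φ : S → A → S → Vec d}

/-- Nonnegativity of the variance of the centralized feature norms under the model. No `κ` enters.
-/
lemma width_sq_le (hne : ∀ s a, (𝓜.reach s a).Nonempty) {B : Matrix (Fin d) (Fin d) ℝ}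
    (hB : B.PosDef) (θ : Vec d) (s : S) (a : A) :
    width 𝓜 φ B θ s a ^ 2 ≤ infoGain 𝓜 φ B θ s a := by
  have h0 : 0 ≤ ∑ s' ∈ 𝓜.reach s a, mnlProb 𝓜 φ θ s a s'
      * (√(sqNorm B⁻¹ (centralFeature 𝓜 φ θ s a s')) - width 𝓜 φ B θ s a) ^ 2 :=
    Finset.sum_nonneg fun _ _ => mul_nonneg (mnlProb_nonneg _ _ _ _) (sq_nonneg _)
  have h1 : ∑ s' ∈ 𝓜.reach s a, mnlProb 𝓜 φ θ s a s'
      * (√(sqNorm B⁻¹ (centralFeature 𝓜 φ θ s a s')) - width 𝓜 φ B θ s a) ^ 2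
      = infoGain 𝓜 φ B θ s a - 2 * width 𝓜 φ B θ s a * width 𝓜 φ B θ s a
        + (∑ s' ∈ 𝓜.reach s a, mnlProb 𝓜 φ θ s a s') * width 𝓜 φ B θ s a ^ 2 := by
    conv_rhs => rw [infoGain]; arg 1; arg 2; arg 2; rw [width]
    rw [Finset.mul_sum, Finset.sum_mul, ← Finset.sum_sub_distrib, ← Finset.sum_add_distrib]
    refine Finset.sum_congr rfl fun s' _ => ?_
    nth_rewrite 2 [← Real.sq_sqrt (sqNorm_nonneg hB.inv.posSemidef
      (centralFeature 𝓜 φ θ s a s'))]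
    ring
  rw [h1, sum_mnlProb (hne s a) θ] at h0
  linarith

/-- The maximal squared feature norm is controlled by the information gain. -/
lemma maxSq_le (hne : ∀ s a, (𝓜.reach s a).Nonempty) (href : HasReferenceState 𝓜 φ) {Lθ κ : ℝ}
    (hκ : 0 < κ) (hK : IsKappa 𝓜 φ Lθ κ) {B : Matrix (Fin d) (Fin d) ℝ} (hB : B.PosDef)
    {θ : Vec d} (hθ : ‖θ‖ ≤ Lθ) (s : S) (a : A) :
    maxSq 𝓜 φ B s a ≤ κ⁻¹ * infoGain 𝓜 φ B θ s a := by
  classical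
  have hBi := hB.inv.posSemidef
  have hI0 : 0 ≤ infoGain 𝓜 φ B θ s a := infoGain_nonneg hB θ s a
  obtain ⟨r, hr, hr0⟩ := href s a
  have : Nonempty {x // x ∈ 𝓜.reach s a} := ⟨⟨r, hr⟩⟩
  refine ciSup_le fun ⟨s', hs'⟩ => ?_
  rcases eq_or_ne s' r with rfl | hne'
  · simp only [hr0]
    have : sqNorm B⁻¹ (0 : Vec d) = 0 := by simp [sqNorm]
    rw [this]; positivity
  rw [inv_mul_eq_div, le_div_iff₀ hκ, mul_comm]
  set p := mnlProb 𝓜 φ θ s a with hp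
  have hp0 : ∀ i, 0 ≤ p i := fun i => mnlProb_nonneg _ _ _ _
  set x := centralFeature 𝓜 φ θ s a s' with hx
  set y := centralFeature 𝓜 φ θ s a r with hy
  -- The reference state has feature zero, so centring shifts it to minus the mean, and the mean
  -- cancels in the difference.
  have hxy : φ s a s' = x - y := by
    simp only [hx, hy, centralFeature, hr0]; abel
  have hpair : p s' + p r ≤ 1 := by
    rw [← sum_mnlProb (φ := φ) (hne s a) θ, ← Finset.sum_pair hne']
    exact Finset.sum_le_sum_of_subset_of_nonneg
      (by intro i hi; simp only [Finset.mem_insert, Finset.mem_singleton] at hi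
          rcases hi with rfl | rfl <;> assumption) fun i _ _ => hp0 i
  have hinfo : p s' * sqNorm B⁻¹ x + p r * sqNorm B⁻¹ y ≤ infoGain 𝓜 φ B θ s a := by
    rw [infoGain, ← Finset.sum_pair
      (f := fun i => p i * sqNorm B⁻¹ (centralFeature 𝓜 φ θ s a i)) hne']
    exact Finset.sum_le_sum_of_subset_of_nonneg
      (by intro i hi; simp only [Finset.mem_insert, Finset.mem_singleton] at hi
          rcases hi with rfl | rfl <;> assumption)
      fun i _ _ => mul_nonneg (hp0 i) (sqNorm_nonneg hBi _)
  -- With `p + p' ≤ 1`, the difference of the two sides is `‖p x + p' y‖²` plus `(1 - p - p')(p ‖x‖²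
  -- + p' ‖y‖²)`. The product of probabilities is then bounded below by `κ`.
  have hquad : p s' * p r * sqNorm B⁻¹ (x - y) ≤ p s' * sqNorm B⁻¹ x + p r * sqNorm B⁻¹ y := by
    have h1 := sqNorm_nonneg hBi (p s' • x + p r • y)
    rw [sqNorm_add hBi.isHermitian, sqNorm_smul, sqNorm_smul, bilForm_smul_left,
      bilForm_smul_right] at h1
    rw [sqNorm_sub hBi.isHermitian]
    have h2 := mul_nonneg (mul_nonneg (hp0 s') (sqNorm_nonneg hBi x)) (sub_nonneg.2 hpair)
    have h3 := mul_nonneg (mul_nonneg (hp0 r) (sqNorm_nonneg hBi y)) (sub_nonneg.2 hpair)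
    nlinarith
  rw [hxy]
  refine le_trans ?_ (hquad.trans hinfo)
  exact mul_le_mul_of_nonneg_right (hK s a s' hs' r hr hne' θ hθ) (sqNorm_nonneg hBi _)

end Elliptical

/-! ### Optimism along a run -/

section Optimism

open scoped ENNReal

variable {S A Ω : Type*} {H d : ℕ} {𝓜 : EpisodicMDP S A H} {φ : S → A → S → Vec d}
  {Lφ Lθ : ℝ} {prm : Params} {K : ℕ} [mΩ : MeasurableSpace Ω] {μ : Measure Ω}
  (R : ORRLRun 𝓜 φ Lθ prm K μ)

/-- The estimates of the episode satisfy the confidence bound. -/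
def Confident (θs : Fin H → Vec d) (β : ℝ) (θ : Fin H → Vec d)
    (B : Fin H → Matrix (Fin d) (Fin d) ℝ) : Prop :=
  0 < β ∧ ∀ h, √(sqNorm (B h) (θ h - θs h)) ≤ β / 50

open Classical in
/-- The amount by which the noiseless value underestimates the value of `π`, in case the estimates
satisfy the confidence bound. -/
def pessimism (𝓜 : EpisodicMDP S A H) (φ : S → A → S → Vec d) (M : ℕ) (θs : Fin H → Vec d)
    (π : Policy S A H) (β : ℝ) (θ : Fin H → Vec d) (B : Fin H → Matrix (Fin d) (Fin d) ℝ)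
    (s : S) : ℝ :=
  if Confident θs β θ B then max 0 (policyValue 𝓜 π 0 s - baseValue 𝓜 φ M β θ B 0 s) else 0

lemma pessimism_nonneg (M : ℕ) (θs : Fin H → Vec d)
    (π : Policy S A H) (β : ℝ) (θ : Fin H → Vec d) (B : Fin H → Matrix (Fin d) (Fin d) ℝ)
    (s : S) : 0 ≤ pessimism 𝓜 φ M θs π β θ B s := by
  rw [pessimism]
  split_ifs
  · exact le_max_left _ _
  · exact le_rfl

lemma pessimism_le [Finite A] [Nonempty A] {M : ℕ} (hM : 0 < M)
    (hne : ∀ s a, (𝓜.reach s a).Nonempty) {θs : Fin H → Vec d}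
    (hMNL : IsMNL 𝓜 φ θs) (π : Policy S A H) (β : ℝ) (θ : Fin H → Vec d)
    {B : Fin H → Matrix (Fin d) (Fin d) ℝ} (hB : ∀ h, (B h).PosDef) (s : S) :
    pessimism 𝓜 φ M θs π β θ B s ≤ H := by
  rw [pessimism]
  split_ifs
  · refine max_le (Nat.cast_nonneg H) ?_
    have h1 := (policyValue_mem hMNL hne π 0 (Nat.zero_le H) s).2
    have h2 : 0 ≤ baseValue 𝓜 φ M β θ B 0 s := optValue_nonneg hM hne hB _ 0 s
    simp only [Nat.cast_zero, sub_zero] at h1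
    linarith
  · exact Nat.cast_nonneg H

/-- A variable equal to `-3x` with probability `q` and `x` otherwise has mean `x (1 - 4q) ≤ 0` and
range bounded by `b`. -/
lemma quarter_mul_exp_le {q x b : ℝ} (hq : 1 / 4 ≤ q) (hq1 : q ≤ 1) (hx : 0 ≤ x) (hxb : 3 * x ≤ b) :
    q * Real.exp (x * (1 - 4 * 1) - b ^ 2) + (1 - q) * Real.exp (x * (1 - 4 * 0) - b ^ 2) ≤ 1 := by
  have h1 := exp_le_add_exp_sq (x * (1 - 4 * 1))
  have h2 := exp_le_add_exp_sq (x * (1 - 4 * 0))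
  have h3 : Real.exp ((x * (1 - 4 * 1)) ^ 2) ≤ Real.exp (b ^ 2) :=
    Real.exp_le_exp.2 (by nlinarith)
  have h4 : Real.exp ((x * (1 - 4 * 0)) ^ 2) ≤ Real.exp (b ^ 2) :=
    Real.exp_le_exp.2 (by nlinarith)
  rw [Real.exp_sub, Real.exp_sub, mul_div_assoc', mul_div_assoc', ← add_div,
    div_le_one (Real.exp_pos _)]
  nlinarith [mul_le_mul_of_nonneg_left (h1.trans (add_le_add_right h3 _)) (by linarith : 0 ≤ q),
    mul_le_mul_of_nonneg_left (h2.trans (add_le_add_right h4 _)) (by linarith : 0 ≤ 1 - q),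
    mul_nonneg hx (by linarith : 0 ≤ 4 * q - 1)]

/-- The pessimism of an episode of the run. -/
def ORRLRun.pess (θs : Fin H → Vec d) (π : Policy S A H) (k : ℕ) (ω : Ω) : ℝ :=
  pessimism 𝓜 φ prm.M θs π (prm.beta k) (fun h => R.theta k h ω) (fun h => R.gram k h ω)
    (R.state k 0 ω)

/-- The noise vectors for which the optimistic value dominates the value of `π`. -/
def optimisticNoise (𝓜 : EpisodicMDP S A H) (φ : S → A → S → Vec d) (M : ℕ) (π : Policy S A H)
    (β : ℝ) (t : ((Fin H → Vec d) × (Fin H → Matrix (Fin d) (Fin d) ℝ)) × S) :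
    Set (Fin H × Fin M → Vec d) :=
  {ξ | policyValue 𝓜 π 0 t.2 ≤ optValue 𝓜 φ β t.1.1 t.1.2 (fun h m => ξ (h, m)) 0 t.2}

lemma measurableSet_optimisticNoise [Finite A] (M : ℕ) (π : Policy S A H) (β : ℝ)
    (t : ((Fin H → Vec d) × (Fin H → Matrix (Fin d) (Fin d) ℝ)) × S) :
    MeasurableSet (optimisticNoise 𝓜 φ M π β t) :=
  measurableSet_le measurable_const (measurable_optValue _ _ _ _ _)

/-- The event that the optimistic value of an episode dominates the value of `π`. -/
def ORRLRun.optimisticEvent (π : Policy S A H) (k : ℕ) : Set Ω :=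
  {ω | (fun i : Fin H × Fin prm.M => R.noise k i.1 i.2 ω)
    ∈ optimisticNoise 𝓜 φ prm.M π (prm.beta k) (R.data k ω)}

lemma ORRLRun.mem_optimisticEvent (π : Policy S A H) (k : ℕ) (ω : Ω) :
    ω ∈ R.optimisticEvent π k ↔
      policyValue 𝓜 π 0 (R.state k 0 ω) ≤ R.optVal k 0 (R.state k 0 ω) ω := Iff.rfl

lemma ORRLRun.measurableSet_optimisticEvent [Finite A] (hlam : 0 < prm.lam) (hη : 0 < prm.eta)
    (π : Policy S A H) {k : ℕ} (hk : k < K) :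
    MeasurableSet[R.filt (clock H k 1)] (R.optimisticEvent π k) := by
  have h0 := (R.state_initial k hk).mono (clock_mono R (show clock H k 0 ≤ clock H k 1 by
    simp [clock]))
  exact measurableSet_le (h0.measurable_comp fun s => policyValue 𝓜 π 0 s)
    (h0.measurable_family fun s => R.measurable_optVal hlam hη hk 0 s)

variable [IsProbabilityMeasure μ]

lemma ORRLRun.measure_inter_optimistic [Finite A] (π : Policy S A H) {k : ℕ} (hk : k < K)
    {t : ((Fin H → Vec d) × (Fin H → Matrix (Fin d) (Fin d) ℝ)) × S} {E : Set Ω}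
    (hE : MeasurableSet[R.filt (clock H k 0)] E) (ht : ∀ ω ∈ E, R.data k ω = t) :
    μ (E ∩ R.optimisticEvent π k) = ENNReal.ofReal ((noiseLaw prm.M (prm.sigma k) t.1.2).real
      (optimisticNoise 𝓜 φ prm.M π (prm.beta k) t)) * μ E ∧
    μ (E ∩ (R.optimisticEvent π k)ᶜ) = ENNReal.ofReal (1 - (noiseLaw prm.M (prm.sigma k) t.1.2).real
      (optimisticNoise 𝓜 φ prm.M π (prm.beta k) t)) * μ E := by
  have hm := measurableSet_optimisticNoise (𝓜 := 𝓜) (φ := φ) prm.M π (prm.beta k) t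
  have hg : ∀ ω ∈ E, ∀ h, R.gram k h ω = t.1.2 h := fun ω hω h => by
    rw [← ht ω hω]; rfl
  rw [← probReal_compl_eq_one_sub hm, ← R.noise_law_inter hk hm hE hg,
    ← R.noise_law_inter hk hm.compl hE hg]
  constructor
  · congr 1
    ext ω
    refine and_congr_right fun hω => ?_
    rw [ORRLRun.optimisticEvent, Set.mem_ofPred_eq, ht ω hω, Set.mem_ofPred_eq]
  · congr 1
    ext ω
    refine and_congr_right fun hω => ?_
    rw [ORRLRun.optimisticEvent, Set.mem_compl_iff, Set.mem_ofPred_eq, ht ω hω, Set.mem_ofPred_eq,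
      Set.mem_compl_iff]

-- The indicator of optimism plays the role of a next state with two values, so the transition lemma
-- applies. Without confidence the pessimism is zero by definition and nothing has to be shown about
-- `q`.
open Classical in
lemma ORRLRun.condLE_optimism [Finite A] [Nonempty A] {θs : Fin H → Vec d}
    (hM : IsMNL 𝓜 φ θs) (hne : ∀ s a, (𝓜.reach s a).Nonempty) {U : ℕ} (hH : 0 < H)
    (hU2 : 2 ≤ U) (hU : ∀ s a, (𝓜.reach s a).card ≤ U) (hMU : prm.M = numSamples H U)
    (hlam : 0 < prm.lam) (hη : 0 < prm.eta) (hσ : ∀ k, prm.sigma k = H * prm.beta k)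
    (π : Policy S A H) {k : ℕ} (hk : k < K) {c : ℝ} (hc : 0 ≤ c) :
    CondLE μ (R.filt (clock H k 0)) fun ω => ENNReal.ofReal (Real.exp
      (c * R.pess θs π k ω * (1 - 4 * (if decide (ω ∈ R.optimisticEvent π k) = true then 1 else 0))
        - (c * (3 * H)) ^ 2)) := by
  have hMs : 0 < prm.M := hMU ▸ numSamples_pos hH (by omega)
  have hdata := R.isDiscreteRV_data hlam hη hk
  have hO := R.filt.le _ _ (R.measurableSet_optimisticEvent hlam hη π hk)
  have hX : IsDiscreteRV mΩ fun ω => decide (ω ∈ R.optimisticEvent π k) := by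
    refine ⟨Set.to_countable _, fun b => ?_⟩
    cases b
    · have : {ω | decide (ω ∈ R.optimisticEvent π k) = false} = (R.optimisticEvent π k)ᶜ := by
        ext ω; simp
      rw [this]; exact hO.compl
    · have : {ω | decide (ω ∈ R.optimisticEvent π k) = true} = R.optimisticEvent π k := by
        ext ω; simp
      rw [this]; exact hO
  obtain ⟨q, hq⟩ : ∃ q : ((Fin H → Vec d) × (Fin H → Matrix (Fin d) (Fin d) ℝ)) × S → ℝ,
      ∀ t, q t = (noiseLaw prm.M (prm.sigma k) t.1.2).real
        (optimisticNoise 𝓜 φ prm.M π (prm.beta k) t) := ⟨_, fun _ => rfl⟩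
  have hq0 : ∀ t, 0 ≤ q t := fun t => by rw [hq]; exact measureReal_nonneg
  have hq1 : ∀ t, q t ≤ 1 := fun t => by rw [hq]; exact measureReal_le_one
  refine condLE_of_transition (μ := μ) (m := R.filt (clock H k 0)) (Y := R.data k)
    (X := fun ω => decide (ω ∈ R.optimisticEvent π k))
    (reach := fun _ => (Finset.univ : Finset Bool))
    (P := fun t b => ENNReal.ofReal (if b then q t else 1 - q t)) (R.filt.le _) hdata hX
    (fun t b hb => absurd (Finset.mem_univ b) hb) (fun t b E hE ht => ?_)
    (F := fun b ω => ENNReal.ofReal (Real.exp (c * R.pess θs π k ω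
      * (1 - 4 * if b = true then 1 else 0) - (c * (3 * H)) ^ 2))) (fun b => ?_) (fun ω => ?_)
  · have h1 := R.measure_inter_optimistic (μ := μ) π hk hE ht
    rw [← hq t] at h1
    cases b
    · have h2 : {ω | decide (ω ∈ R.optimisticEvent π k) = false} = (R.optimisticEvent π k)ᶜ := by
        ext ω; simp
      rw [h2, h1.2]; simp
    · have h2 : {ω | decide (ω ∈ R.optimisticEvent π k) = true} = R.optimisticEvent π k := by
        ext ω; simp
      rw [h2, h1.1]; simp
  · refine ENNReal.measurable_ofReal.comp (Real.measurable_exp.comp (Measurable.sub ?_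
      measurable_const))
    refine Measurable.mul_const (Measurable.const_mul ?_ c) _
    exact hdata.measurable_comp fun t => pessimism 𝓜 φ prm.M θs π (prm.beta k) t.1.1 t.1.2 t.2
  · have hB : ∀ h, (R.gram k h ω).PosDef := fun h => (R.posDef hlam hk.le h ω).1
    rw [Fintype.sum_bool, if_pos rfl, if_pos rfl, if_neg (by simp), if_neg (by simp),
      ← ENNReal.ofReal_mul (hq0 _), ← ENNReal.ofReal_mul (by linarith [hq1 (R.data k ω)]),
      ← ENNReal.ofReal_add (mul_nonneg (hq0 _) (Real.exp_pos _).le)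
        (mul_nonneg (by linarith [hq1 (R.data k ω)]) (Real.exp_pos _).le), ← ENNReal.ofReal_one]
    refine ENNReal.ofReal_le_ofReal ?_
    by_cases hcf : Confident θs (prm.beta k) (fun h => R.theta k h ω) (fun h => R.gram k h ω)
    · have hq4 : 1 / 4 ≤ q (R.data k ω) := by
        rw [hq, hσ]
        exact quarter_le_noiseLaw_optValue (M := prm.M) hH hU2 hMU hne hU hM hB hcf.1 hcf.2 π
          (R.state k 0 ω)
      have hv0 : 0 ≤ R.pess θs π k ω := pessimism_nonneg _ _ _ _ _ _ _
      have hv1 : R.pess θs π k ω ≤ H := pessimism_le hMs hne hM π _ _ hB _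
      have hcv := mul_le_mul_of_nonneg_left hv1 hc
      exact quarter_mul_exp_le hq4 (hq1 _) (mul_nonneg hc hv0) (by linarith)
    · have hv : R.pess θs π k ω = 0 := by rw [ORRLRun.pess, pessimism, if_neg hcf]
      have he : Real.exp (-(c * (3 * H)) ^ 2) ≤ 1 :=
        Real.exp_le_one_iff.2 (by linarith [sq_nonneg (c * (3 * H))])
      rw [hv]
      simp only [mul_zero, zero_mul, zero_sub]
      linarith

open Classical in
/-- Concentration of the pessimism. -/
lemma ORRLRun.measure_sum_pess_ge_le [Finite A] [Nonempty A] {θs : Fin H → Vec d}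
    (hM : IsMNL 𝓜 φ θs) (hne : ∀ s a, (𝓜.reach s a).Nonempty) {U : ℕ} (hH : 0 < H)
    (hU2 : 2 ≤ U) (hU : ∀ s a, (𝓜.reach s a).card ≤ U) (hMU : prm.M = numSamples H U)
    (hlam : 0 < prm.lam) (hη : 0 < prm.eta) (hσ : ∀ k, prm.sigma k = H * prm.beta k)
    (π : Policy S A H) {c : ℝ} (hc : 0 ≤ c) {δ : ℝ} (hδ : 0 < δ) :
    μ {ω | Real.log (1 / δ) ≤ ∑ k ∈ Finset.range K,
      (c * R.pess θs π k ω * (1 - 4 * (if decide (ω ∈ R.optimisticEvent π k) = true then 1 else 0))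
        - (c * (3 * H)) ^ 2)}
      ≤ ENNReal.ofReal δ := by
  refine measure_sum_ge_le (G := fun k => R.filt (clock H k 0))
    (fun k k' hkk => clock_mono R (by simp only [clock]; gcongr)) (fun _ => R.filt.le _)
    (fun k hk => ?_)
    (fun k hk => R.condLE_optimism hM hne hH hU2 hU hMU hlam hη hσ π hk hc) hδ
  have hle1 : R.filt (clock H k 1) ≤ R.filt (clock H (k + 1) 0) :=
    clock_mono R (by simp only [clock, Nat.succ_mul]; omega)
  have h1 : Measurable[R.filt (clock H (k + 1) 0)] (R.pess θs π k) :=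
    ((R.isDiscreteRV_data hlam hη hk).mono (clock_mono R (by
      simp only [clock, Nat.succ_mul]; omega))).measurable_comp
      fun t => pessimism 𝓜 φ prm.M θs π (prm.beta k) t.1.1 t.1.2 t.2
  have h2 : Measurable[R.filt (clock H (k + 1) 0)] fun ω =>
      (if decide (ω ∈ R.optimisticEvent π k) = true then (1 : ℝ) else 0) := by
    simp only [decide_eq_true_eq]
    exact Measurable.ite (hle1 _ (R.measurableSet_optimisticEvent hlam hη π hk)) measurable_const
      measurable_const
  exact ((h1.const_mul c).mul (measurable_const.sub (h2.const_mul 4))).sub measurable_const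

end Optimism

/-! ### Regret on the good event -/

section Regret

variable {S A Ω : Type*} {H d : ℕ} {𝓜 : EpisodicMDP S A H} {φ : S → A → S → Vec d}
  {Lφ Lθ : ℝ} {prm : Params} {K : ℕ} [mΩ : MeasurableSpace Ω] {μ : Measure Ω}
  (R : ORRLRun 𝓜 φ Lθ prm K μ)

lemma abs_gap_le [Finite A] [Nonempty A] {θs : Fin H → Vec d} (hM : IsMNL 𝓜 φ θs)
    (hne : ∀ s a, (𝓜.reach s a).Nonempty) (hMs : 0 < prm.M) (hlam : 0 < prm.lam) {k : ℕ}
    (hk : k ≤ K) {h : ℕ} (hh : h ≤ H) (s : S) (ω : Ω) : |R.gap k h s ω| ≤ 5 * H :=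
  abs_gapValue_le hMs hne hM (fun h => (R.posDef hlam hk h ω).1) _ _ hh s

/-- The bound for the one-step error of the potential. -/
def ORRLRun.stepError (ρ : ℝ) (k : ℕ) (h : Fin H) (ω : Ω) : ℝ :=
  H * prm.beta k * (5 * ρ + 1)
      * width 𝓜 φ (R.gram k h ω) (R.theta k h ω) (R.state k h ω) (R.act k h ω)
    + 18 * H * prm.beta k ^ 2 * maxSq 𝓜 φ (R.gram k h ω) (R.state k h ω) (R.act k h ω)

lemma ORRLRun.gap_step_le [Finite A] [Nonempty A] {θs : Fin H → Vec d} (hM : IsMNL 𝓜 φ θs)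
    (hne : ∀ s a, (𝓜.reach s a).Nonempty) (hMs : 0 < prm.M) (hlam : 0 < prm.lam) {k : ℕ}
    (hk : k < K) {ω : Ω}
    (hconf : Confident θs (prm.beta k) (fun h => R.theta k h ω) (fun h => R.gram k h ω)) {ρ : ℝ}
    (hnoise : ∀ h m, √(sqNorm (R.gram k h ω) (R.noise k h m ω)) ≤ H * prm.beta k * ρ)
    (h : Fin H) :
    R.gap k h (R.state k h ω) ω ≤
      modelMean 𝓜 φ (θs h) (R.state k h ω) (R.act k h ω) (fun s' => R.gap k (h + 1) s' ω)
        + R.stepError ρ k h ω := by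
  have hB : ∀ h, (R.gram k h ω).PosDef := fun h => (R.posDef hlam hk.le h ω).1
  have h1 := gapValue_le hMs hne hM hB hconf.1.le hconf.2 (fun h m => R.noise k h m ω)
    (R.policy_greedy k hk ω) h (R.state k h ω)
  have h2 := noiseBonus_le (𝓜 := 𝓜) (φ := φ) hMs (hB h) (R.theta k h ω) (hnoise h)
    (R.state k h ω) (R.act k h ω)
  have h3 : R.gap k h (R.state k h ω) ω ≤
      modelMean 𝓜 φ (θs h) (R.state k h ω) (R.act k h ω) (fun s' => R.gap k (h + 1) s' ω)
      + 5 * noiseBonus 𝓜 φ (R.theta k h ω) (fun m => R.noise k h m ω) (R.state k h ω)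
        (R.act k h ω)
      + H * prm.beta k * width 𝓜 φ (R.gram k h ω) (R.theta k h ω) (R.state k h ω) (R.act k h ω)
      + 18 * H * prm.beta k ^ 2 * maxSq 𝓜 φ (R.gram k h ω) (R.state k h ω) (R.act k h ω) := h1
  rw [ORRLRun.stepError]
  linarith

lemma ORRLRun.gap_eq_sum (k : ℕ) (ω : Ω) : R.gap k 0 (R.state k 0 ω) ω
    = ∑ h : Fin H, (R.gap k h (R.state k h ω) ω - R.gap k (h + 1) (R.state k (h + 1) ω) ω) := by
  have h1 := Finset.sum_range_sub' (fun h => R.gap k h (R.state k h ω) ω) H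
  have h2 : R.gap k H (R.state k H ω) ω = 0 := by
    rw [ORRLRun.gap, gapValue, baseValue, optValue_of_ge _ le_rfl, optValue_of_ge _ le_rfl,
      policyValue_of_ge _ le_rfl]
    simp
  rw [h2, sub_zero] at h1
  rw [← h1, Finset.sum_range]

open Classical in
/-- The regret of an episode in terms of the potential and the pessimism. -/
lemma ORRLRun.episode_regret_le [Finite A] [Nonempty A] {θs : Fin H → Vec d}
    (hne : ∀ s a, (𝓜.reach s a).Nonempty) (hMs : 0 < prm.M)
    {π : Policy S A H} {k : ℕ} {ω : Ω}
    (hconf : Confident θs (prm.beta k) (fun h => R.theta k h ω) (fun h => R.gram k h ω)) :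
    policyValue 𝓜 π 0 (R.state k 0 ω) - policyValue 𝓜 (R.policy k ω) 0 (R.state k 0 ω) ≤
      R.gap k 0 (R.state k 0 ω) ω + R.pess θs π k ω
        * (1 - 4 * (if decide (ω ∈ R.optimisticEvent π k) = true then 1 else 0)) := by
  set s := R.state k 0 ω
  have h1 : R.baseVal k 0 s ω ≤ R.optVal k 0 s ω := baseValue_le_optValue hMs hne _ _ _
  have h2 : R.pess θs π k ω = max 0 (policyValue 𝓜 π 0 s - R.baseVal k 0 s ω) := by
    rw [ORRLRun.pess, pessimism, if_pos hconf]; rfl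
  have h3 : R.gap k 0 s ω = 4 * (R.optVal k 0 s ω - R.baseVal k 0 s ω)
      + (R.optVal k 0 s ω - policyValue 𝓜 (R.policy k ω) 0 s) := rfl
  have h4 := le_max_right 0 (policyValue 𝓜 π 0 s - R.baseVal k 0 s ω)
  rw [← h2] at h4
  -- If optimistic, the regret is at most `opt - V^π`, and `4 (opt - base)` pays for the `-3·pess`.
  -- If not, the shortfall of `base` is at most `pess`, and `opt ≥ base` suffices.
  by_cases hO : ω ∈ R.optimisticEvent π k
  · have h5 := (R.mem_optimisticEvent π k ω).1 hO
    have h6 : R.pess θs π k ω ≤ R.optVal k 0 s ω - R.baseVal k 0 s ω := by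
      rw [h2]; exact max_le (by linarith) (by linarith)
    rw [if_pos (decide_eq_true hO), h3]
    linarith
  · rw [if_neg (by simp [hO]), h3]
    linarith

open Classical in
/-- The regret on the good event. -/
theorem ORRLRun.regret_le [Finite A] [Nonempty A] {θs : Fin H → Vec d}
    (hM : IsMNL 𝓜 φ θs) (hne : ∀ s a, (𝓜.reach s a).Nonempty) (hMs : 0 < prm.M)
    (hlam : 0 < prm.lam) (hH : 0 < H) {π : Policy S A H}
    (hπ : ∀ h s, optimalValue 𝓜 h s ≤ policyValue 𝓜 π h s) {ω : Ω} {ρ : ℝ} (hρ : 0 ≤ ρ)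
    (hβ : ∀ k < K, 0 ≤ prm.beta k)
    (hconf : ∀ k < K, 0 < prm.beta k →
      Confident θs (prm.beta k) (fun h => R.theta k h ω) (fun h => R.gram k h ω))
    (hnoise : ∀ k < K, 0 < prm.beta k →
      ∀ h m, √(sqNorm (R.gram k h ω) (R.noise k h m ω)) ≤ H * prm.beta k * ρ)
    {D E Z : ℝ}
    (hgap : ∀ h : Fin H, ∑ k ∈ Finset.range K,
      (modelMean 𝓜 φ (θs h) (R.state k h ω) (R.act k h ω) (fun s' => R.gap k (h + 1) s' ω)
        - R.gap k (h + 1) (R.state k (h + 1) ω) ω) ≤ D)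
    (hpess : ∑ k ∈ Finset.range K, R.pess θs π k ω
        * (1 - 4 * (if decide (ω ∈ R.optimisticEvent π k) = true then 1 else 0)) ≤ E)
    (hzero : ∑ k ∈ Finset.range K, (if 0 < prm.beta k then (0 : ℝ) else 16 * (H : ℝ) ^ 2) ≤ Z) :
    R.regret ω ≤ H * D + E + Z
      + ∑ h : Fin H, ∑ k ∈ Finset.range K, R.stepError ρ k h ω := by
  have hH1 : (1 : ℝ) ≤ H := by exact_mod_cast hH
  have herr : ∀ k < K, ∀ h, 0 ≤ R.stepError ρ k h ω := fun k hk h => by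
    have h1 := width_nonneg (𝓜 := 𝓜) (φ := φ) (R.gram k h ω) (R.theta k h ω) (R.state k h ω)
      (R.act k h ω)
    have h2 := maxSq_nonneg (𝓜 := 𝓜) (φ := φ) (R.posDef hlam hk.le h ω).1 (R.state k h ω)
      (R.act k h ω)
    have h3 := hβ k hk
    rw [ORRLRun.stepError]
    positivity
  have hk : ∀ k ∈ Finset.range K,
      optimalValue 𝓜 0 (R.state k 0 ω) - policyValue 𝓜 (R.policy k ω) 0 (R.state k 0 ω) ≤
      ∑ h : Fin H, (modelMean 𝓜 φ (θs h) (R.state k h ω) (R.act k h ω)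
          (fun s' => R.gap k (h + 1) s' ω) - R.gap k (h + 1) (R.state k (h + 1) ω) ω
          + R.stepError ρ k h ω)
        + R.pess θs π k ω
          * (1 - 4 * (if decide (ω ∈ R.optimisticEvent π k) = true then 1 else 0))
        + (if 0 < prm.beta k then (0 : ℝ) else 16 * (H : ℝ) ^ 2) := by
    intro k hk
    rw [Finset.mem_range] at hk
    have hopt := hπ 0 (R.state k 0 ω)
    rcases (hβ k hk).lt_or_eq with hb | hb
    · have h1 := R.episode_regret_le hne hMs (π := π) (hconf k hk hb)
      have h2 : R.gap k 0 (R.state k 0 ω) ω ≤ ∑ h : Fin H, (modelMean 𝓜 φ (θs h) (R.state k h ω)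
          (R.act k h ω) (fun s' => R.gap k (h + 1) s' ω)
          - R.gap k (h + 1) (R.state k (h + 1) ω) ω + R.stepError ρ k h ω) := by
        rw [R.gap_eq_sum]
        refine Finset.sum_le_sum fun h _ => ?_
        linarith [R.gap_step_le hM hne hMs hlam hk (hconf k hk hb) (hnoise k hk hb) h]
      rw [if_pos hb]
      linarith
    -- Without exploration (`β = 0`) the regret is at most `H`, while each of the `H` increments on
    -- the right is at least `-10H`; the allowance `16H²` covers both.
    · have hp : R.pess θs π k ω = 0 := by
        rw [ORRLRun.pess, pessimism, if_neg fun hc => hc.1.ne hb]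
      have h1 := (policyValue_mem hM hne π 0 (Nat.zero_le H) (R.state k 0 ω)).2
      have h2 := (policyValue_mem hM hne (R.policy k ω) 0 (Nat.zero_le H) (R.state k 0 ω)).1
      have h3 : ∑ _h : Fin H, (-(10 * H : ℝ)) ≤ ∑ h : Fin H, (modelMean 𝓜 φ (θs h)
          (R.state k h ω) (R.act k h ω) (fun s' => R.gap k (h + 1) s' ω)
          - R.gap k (h + 1) (R.state k (h + 1) ω) ω + R.stepError ρ k h ω) := by
        refine Finset.sum_le_sum fun h _ => ?_
        have hg := fun s' => abs_le.1 (abs_gap_le R hM hne hMs hlam hk.le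
          (show (h : ℕ) + 1 ≤ H from h.2) s' ω)
        have h4 := le_modelMean (φ := φ) hne (θs h) (R.state k h ω) (R.act k h ω)
          fun s' => (hg s').1
        linarith [(hg (R.state k (h + 1) ω)).2, herr k hk h]
      rw [hp, zero_mul, if_neg (hb ▸ lt_irrefl _)]
      simp only [Finset.sum_const, Finset.card_univ, Fintype.card_fin, nsmul_eq_mul] at h3
      simp only [Nat.cast_zero, sub_zero] at h1
      nlinarith
  have hsum := Finset.sum_le_sum hk
  rw [Finset.sum_add_distrib, Finset.sum_add_distrib, Finset.sum_comm] at hsum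
  have h3 : ∑ h : Fin H, ∑ k ∈ Finset.range K, (modelMean 𝓜 φ (θs h) (R.state k h ω)
      (R.act k h ω) (fun s' => R.gap k (h + 1) s' ω) - R.gap k (h + 1) (R.state k (h + 1) ω) ω
        + R.stepError ρ k h ω)
      ≤ H * D + ∑ h : Fin H, ∑ k ∈ Finset.range K, R.stepError ρ k h ω := by
    have : ∑ _h : Fin H, D = H * D := by simp
    rw [← this, ← Finset.sum_add_distrib]
    refine Finset.sum_le_sum fun h _ => ?_
    rw [Finset.sum_add_distrib]
    linarith [hgap h]
  have h4 : R.regret ω = ∑ k ∈ Finset.range K,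
    (optimalValue 𝓜 0 (R.state k 0 ω) - policyValue 𝓜 (R.policy k ω) 0 (R.state k 0 ω)) := rfl
  linarith

/-- The accumulated one-step errors of a step. -/
lemma ORRLRun.sum_stepError_le (hne : ∀ s a, (𝓜.reach s a).Nonempty)
    (href : HasReferenceState 𝓜 φ) {κ : ℝ} (hκ : 0 < κ) (hK : IsKappa 𝓜 φ Lθ κ)
    (hL : ∀ s a, ∀ s' ∈ 𝓜.reach s a, ‖φ s a s'‖ ≤ Lφ) (hL0 : 0 < Lφ) (hLθ : 0 < Lθ)
    (hlam : 0 < prm.lam) (hη : 0 < prm.eta) (hlam2 : 4 * Lφ ^ 2 ≤ prm.lam)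
    (hlam8 : 8 * prm.eta * Lφ ^ 2 ≤ prm.lam) {ω : Ω} {h : Fin H}
    (hy : ∀ k < K, R.state k (h + 1) ω ∈ 𝓜.reach (R.state k h ω) (R.act k h ω)) {ρ b : ℝ}
    (hρ : 0 ≤ ρ) (hβ : ∀ k < K, 0 ≤ prm.beta k) (hb : ∀ k < K, prm.beta k ≤ b) (hb0 : 0 ≤ b) :
    ∑ k ∈ Finset.range K, R.stepError ρ k h ω
      ≤ H * b * (5 * ρ + 1) * (√K * √(4 * d * Real.log (1 + K)))
        + 18 * H * b ^ 2 * (κ⁻¹ * (2 * d * Real.log (1 + K))) := by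
  set w : ℕ → ℝ := fun k =>
    width 𝓜 φ (R.gram k h ω) (R.theta k h ω) (R.state k h ω) (R.act k h ω)
  set g : ℕ → ℝ := fun k => maxSq 𝓜 φ (R.gram k h ω) (R.state k h ω) (R.act k h ω)
  have hw : ∀ k, 0 ≤ w k := fun k => width_nonneg _ _ _ _
  have hB : ∀ k < K, (R.gram k h ω).PosDef := fun k hk => (R.posDef hlam hk.le h ω).1
  have hg : ∀ k < K, 0 ≤ g k := fun k hk => maxSq_nonneg (hB k hk) _ _
  have hw2 : ∑ k ∈ Finset.range K, w k ^ 2 ≤ 4 * d * Real.log (1 + K) := by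
    refine le_trans (Finset.sum_le_sum fun k hk => ?_)
      ((R.path h ω).sum_infoGain_old_le hy hL0 hLθ.le hη hL hlam hlam2 hlam8 le_rfl)
    exact width_sq_le hne (hB k (Finset.mem_range.1 hk)) _ _ _
  have hws : ∑ k ∈ Finset.range K, w k ≤ √K * √(4 * d * Real.log (1 + K)) := by
    have h1 := sq_sum_le_card_mul_sum_sq (s := Finset.range K) (f := w)
    rw [Finset.card_range] at h1
    rw [← Real.sqrt_mul (Nat.cast_nonneg K)]
    refine Real.le_sqrt_of_sq_le (h1.trans ?_)
    exact mul_le_mul_of_nonneg_left hw2 (Nat.cast_nonneg K)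
  -- Any parameter in the ball may be used to bound `maxSq`; the new estimate matches the Gram
  -- update. This is the only place where `κ` enters the sum.
  have hgs : ∑ k ∈ Finset.range K, g k ≤ κ⁻¹ * (2 * d * Real.log (1 + K)) := by
    have h1 := (R.path h ω).sum_infoGain_le hy hL hlam hlam2 le_rfl
    refine le_trans ?_ (mul_le_mul_of_nonneg_left h1 (inv_nonneg.2 hκ.le))
    rw [Finset.mul_sum]
    refine Finset.sum_le_sum fun k hk => ?_
    rw [Finset.mem_range] at hk
    exact maxSq_le hne href hκ hK (hB k hk)
      ((R.path h ω).norm_theta_le hLθ.le (k + 1) (by omega)) _ _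
  have hH : (0 : ℝ) ≤ H := Nat.cast_nonneg H
  calc ∑ k ∈ Finset.range K, R.stepError ρ k h ω
      ≤ ∑ k ∈ Finset.range K, (H * b * (5 * ρ + 1) * w k + 18 * H * b ^ 2 * g k) := by
        refine Finset.sum_le_sum fun k hk => ?_
        rw [Finset.mem_range] at hk
        have h1 := hβ k hk
        have h2 := hb k hk
        have h3 := hw k
        have h4 := hg k hk
        change H * prm.beta k * (5 * ρ + 1) * w k + 18 * H * prm.beta k ^ 2 * g k ≤ _
        gcongr
    _ = H * b * (5 * ρ + 1) * ∑ k ∈ Finset.range K, w k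
        + 18 * H * b ^ 2 * ∑ k ∈ Finset.range K, g k := by
        rw [Finset.sum_add_distrib, Finset.mul_sum, Finset.mul_sum]
    _ ≤ _ := by gcongr

end Regret

/-! ### The high probability event -/

section Events

variable {S A Ω : Type*} {H d : ℕ} {𝓜 : EpisodicMDP S A H} {φ : S → A → S → Vec d}
  {Lφ Lθ : ℝ} {prm : Params} {K : ℕ} [mΩ : MeasurableSpace Ω] {μ : Measure Ω}
  (R : ORRLRun 𝓜 φ Lθ prm K μ)

/-- Telescoping weights that distribute the failure probability over the episodes, so that the
confidence radius of episode `k` does not depend on `K`. -/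
lemma sum_range_one_div_le (n : ℕ) :
    ∑ k ∈ Finset.range n, 1 / (((k : ℝ) + 1) * (k + 2)) ≤ 1 := by
  have : ∑ k ∈ Finset.range n, 1 / (((k : ℝ) + 1) * (k + 2)) = 1 - 1 / ((n : ℝ) + 1) := by
    induction n with
    | zero => simp
    | succ n ih =>
      rw [Finset.sum_range_succ, ih]
      push_cast
      field_simp
      ring
  rw [this]
  have : 0 ≤ 1 / ((n : ℝ) + 1) := by positivity
  linarith

lemma measureReal_le_of_le_ofReal {E : Set Ω} {δ : ℝ} (hδ : 0 ≤ δ)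
    (h : μ E ≤ ENNReal.ofReal δ) : μ.real E ≤ δ :=
  ENNReal.toReal_le_of_le_ofReal hδ h

open Classical in
/-- The high probability event on which the regret is bounded. -/
theorem ORRLRun.exists_good_event [IsProbabilityMeasure μ] [Finite A] [Nonempty A]
    {θs : Fin H → Vec d} (hM : IsMNL 𝓜 φ θs) (hne : ∀ s a, (𝓜.reach s a).Nonempty) {U : ℕ} (hH : 0 < H)
    (hU2 : 2 ≤ U) (hU : ∀ s a, (𝓜.reach s a).card ≤ U) (hMU : prm.M = numSamples H U)
    (hL : ∀ s a, ∀ s' ∈ 𝓜.reach s a, ‖φ s a s'‖ ≤ Lφ)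
    (hlam : 0 < prm.lam) (hη : 0 < prm.eta) (hlam4 : 4 * prm.eta * Lφ ^ 2 ≤ prm.lam)
    (hσ : ∀ k, prm.sigma k = H * prm.beta k) (π : Policy S A H) {c₁ c₂ : ℝ} (hc₁ : 0 ≤ c₁)
    (hc₂ : 0 ≤ c₂) {δ : ℝ} (hδ : 0 < δ) {r : ℝ} (hr : 0 ≤ r)
    (hrδ : K * (H * (prm.M * (2 * d * Real.exp (-r ^ 2 / 2)))) ≤ δ / 4) :
    ∃ N : Set Ω, μ.real N ≤ δ ∧ ∀ ω ∉ N,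
      (∀ k < K, ∀ h : Fin H,
        R.state k (h + 1) ω ∈ 𝓜.reach (R.state k h ω) (R.act k h ω)) ∧
      (∀ k < K, ∀ h : Fin H, ∑ j ∈ Finset.range k, logRatio 𝓜 φ prm.eta (θs h) (R.gram j h ω)
        (R.theta j h ω) (R.state j h ω) (R.act j h ω) (R.state j (h + 1) ω)
        ≤ Real.log (1 / (δ / (4 * H) * (1 / (((k : ℝ) + 1) * (k + 2)))))) ∧
      (∀ h : Fin H, ∑ k ∈ Finset.range K,
        (c₁ * (modelMean 𝓜 φ (θs h) (R.state k h ω) (R.act k h ω)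
            (fun s' => R.gap k (h + 1) s' ω) - R.gap k (h + 1) (R.state k (h + 1) ω) ω)
          - (c₁ * (10 * H)) ^ 2) ≤ Real.log (1 / (δ / (4 * H)))) ∧
      (∑ k ∈ Finset.range K, (c₂ * R.pess θs π k ω
          * (1 - 4 * (if decide (ω ∈ R.optimisticEvent π k) = true then 1 else 0))
        - (c₂ * (3 * H)) ^ 2) ≤ Real.log (1 / (δ / 4))) ∧
      (∀ k < K, 0 < prm.beta k → ∀ h m,
        sqNorm (R.gram k h ω) (R.noise k h m ω) ≤ (H * prm.beta k) ^ 2 * (d * r ^ 2)) := by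
  have hH0 : (0 : ℝ) < H := by exact_mod_cast hH
  have hMs : 0 < prm.M := hMU ▸ numSamples_pos hH (by omega)
  set N₁ : Set Ω := ⋃ k ∈ Finset.range K, ⋃ h : Fin H,
    {ω | R.state k (h + 1) ω ∉ 𝓜.reach (R.state k h ω) (R.act k h ω)} with hN₁
  set N₂ : Set Ω := ⋃ h : Fin H, ⋃ k ∈ Finset.range K,
    {ω | Real.log (1 / (δ / (4 * H) * (1 / (((k : ℝ) + 1) * (k + 2)))))
      ≤ ∑ j ∈ Finset.range k, logRatio 𝓜 φ prm.eta (θs h) (R.gram j h ω)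
        (R.theta j h ω) (R.state j h ω) (R.act j h ω) (R.state j (h + 1) ω)} with hN₂
  set N₃ : Set Ω := ⋃ h : Fin H, {ω | Real.log (1 / (δ / (4 * H))) ≤ ∑ k ∈ Finset.range K,
        (c₁ * (modelMean 𝓜 φ (θs h) (R.state k h ω) (R.act k h ω)
            (fun s' => R.gap k (h + 1) s' ω) - R.gap k (h + 1) (R.state k (h + 1) ω) ω)
          - (c₁ * (10 * H)) ^ 2)} with hN₃
  set N₄ : Set Ω := {ω | Real.log (1 / (δ / 4)) ≤ ∑ k ∈ Finset.range K, (c₂ * R.pess θs π k ω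
          * (1 - 4 * (if decide (ω ∈ R.optimisticEvent π k) = true then 1 else 0))
        - (c₂ * (3 * H)) ^ 2)} with hN₄
  set N₅ : Set Ω := ⋃ k ∈ Finset.range K, ⋃ h : Fin H, ⋃ m : Fin prm.M,
    {ω | 0 < prm.beta k ∧
      (H * prm.beta k) ^ 2 * (d * r ^ 2) < sqNorm (R.gram k h ω) (R.noise k h m ω)} with hN₅
  have h₁ : μ.real N₁ = 0 := by
    have : μ N₁ = 0 := by
      refine (measure_biUnion_null_iff (Finset.countable_toSet _)).2 fun k hk => ?_
      exact measure_iUnion_null_iff.2 fun h => R.measure_state_notMem (Finset.mem_range.1 hk) h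
    rw [measureReal_def, this, ENNReal.toReal_zero]
  have h₂ : μ.real N₂ ≤ δ / 4 := by
    refine (measureReal_iUnion_fintype_le _).trans ?_
    have hb : ∀ h : Fin H, μ.real (⋃ k ∈ Finset.range K,
        {ω | Real.log (1 / (δ / (4 * H) * (1 / (((k : ℝ) + 1) * (k + 2)))))
          ≤ ∑ j ∈ Finset.range k, logRatio 𝓜 φ prm.eta (θs h) (R.gram j h ω)
            (R.theta j h ω) (R.state j h ω) (R.act j h ω) (R.state j (h + 1) ω)})
        ≤ δ / (4 * H) := by
      intro h
      refine (measureReal_biUnion_finset_le _ _).trans ?_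
      calc _ ≤ ∑ k ∈ Finset.range K, δ / (4 * H) * (1 / (((k : ℝ) + 1) * (k + 2))) := by
            refine Finset.sum_le_sum fun k hk => measureReal_le_of_le_ofReal (by positivity) ?_
            exact R.measure_sum_logRatio_ge_le hM hne hL hlam hη hlam4 h
              (Finset.mem_range.1 hk).le (by positivity)
        _ ≤ δ / (4 * H) := by
            rw [← Finset.mul_sum]
            exact mul_le_of_le_one_right (by positivity) (sum_range_one_div_le K)
    refine (Finset.sum_le_sum fun h _ => hb h).trans (le_of_eq ?_)
    simp only [Finset.sum_const, Finset.card_univ, Fintype.card_fin, nsmul_eq_mul]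
    field_simp
  have h₃ : μ.real N₃ ≤ δ / 4 := by
    refine (measureReal_iUnion_fintype_le _).trans ?_
    refine (Finset.sum_le_sum fun h _ => measureReal_le_of_le_ofReal (by positivity)
      (R.measure_sum_gap_ge_le hM hne hMs hlam hη h hc₁ (δ := δ / (4 * H)) (by positivity))).trans
      (le_of_eq ?_)
    simp only [Finset.sum_const, Finset.card_univ, Fintype.card_fin, nsmul_eq_mul]
    field_simp
  have h₄ : μ.real N₄ ≤ δ / 4 := measureReal_le_of_le_ofReal (by positivity)
    (R.measure_sum_pess_ge_le hM hne hH hU2 hU hMU hlam hη hσ π hc₂ (by positivity))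
  have h₅ : μ.real N₅ ≤ δ / 4 := by
    refine le_trans ?_ hrδ
    have hb : ∀ k ∈ Finset.range K, μ.real (⋃ h : Fin H, ⋃ m : Fin prm.M, {ω | 0 < prm.beta k ∧
        (H * prm.beta k) ^ 2 * (d * r ^ 2) < sqNorm (R.gram k h ω) (R.noise k h m ω)})
        ≤ H * (prm.M * (2 * d * Real.exp (-r ^ 2 / 2))) := by
      intro k hk
      have hm : ∀ (h : Fin H) (m : Fin prm.M), μ.real {ω | 0 < prm.beta k ∧
          (H * prm.beta k) ^ 2 * (d * r ^ 2) < sqNorm (R.gram k h ω) (R.noise k h m ω)}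
          ≤ 2 * d * Real.exp (-r ^ 2 / 2) := by
        intro h m
        by_cases hβ : 0 < prm.beta k
        · refine measureReal_le_of_le_ofReal (by positivity) ?_
          refine le_trans (measure_mono fun ω hω => ?_) (R.measure_noise_gt_le hlam hη
            (Finset.mem_range.1 hk) (by rw [hσ]; positivity) h m hr)
          rw [Set.mem_ofPred_eq, hσ]
          exact hω.2
        · simp only [hβ, false_and, Set.ofPred_false, measureReal_empty]
          positivity
      refine (measureReal_iUnion_fintype_le _).trans ?_
      refine (Finset.sum_le_sum fun h _ => (measureReal_iUnion_fintype_le _).trans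
        (Finset.sum_le_sum fun m _ => hm h m)).trans (le_of_eq ?_)
      simp only [Finset.sum_const, Finset.card_univ, Fintype.card_fin, nsmul_eq_mul]
    refine (measureReal_biUnion_finset_le _ _).trans
      ((Finset.sum_le_sum hb).trans (le_of_eq ?_))
    simp only [Finset.sum_const, Finset.card_range, nsmul_eq_mul]
  refine ⟨N₁ ∪ (N₂ ∪ (N₃ ∪ (N₄ ∪ N₅))), ?_, fun ω hω => ?_⟩
  · have e₁ := measureReal_union_le (μ := μ) N₁ (N₂ ∪ (N₃ ∪ (N₄ ∪ N₅)))
    have e₂ := measureReal_union_le (μ := μ) N₂ (N₃ ∪ (N₄ ∪ N₅))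
    have e₃ := measureReal_union_le (μ := μ) N₃ (N₄ ∪ N₅)
    have e₄ := measureReal_union_le (μ := μ) N₄ N₅
    linarith
  · simp only [Set.mem_union, not_or] at hω
    obtain ⟨w₁, w₂, w₃, w₄, w₅⟩ := hω
    simp only [hN₁, hN₂, hN₃, hN₄, hN₅, Set.mem_iUnion, Finset.mem_range, Set.mem_ofPred_eq,
      not_exists, not_le, not_not, not_and, not_lt] at w₁ w₂ w₃ w₄ w₅
    exact ⟨w₁, fun k hk h => (w₂ h k hk).le, fun h => (w₃ h).le, w₄.le,
      fun k hk hβ h m => w₅ k hk h m hβ⟩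

end Events

/-! ### Confidence radius against exploration parameter -/

section Parameters

lemma half_le_log {n : ℝ} (hn : 2 ≤ n) : 1 / 2 ≤ Real.log n := by
  have := Real.log_le_log (by norm_num) hn
  linarith [Real.log_two_gt_d9]

/-- The logarithm of the inverse confidence level of an episode. -/
lemma log_confidence_le {H k : ℕ} (hH : 0 < H) (hN : 2 ≤ (k + 1) * H) {δ : ℝ} (hδ : 0 < δ)
    (hδ1 : δ ≤ 1) :
    Real.log (1 / (δ / (4 * H) * (1 / (((k : ℝ) + 1) * (k + 2)))))
      ≤ 6 * Real.log ((k + 1) * H) * (1 + Real.log (1 / δ)) := by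
  have hN' : (2 : ℝ) ≤ ((k : ℝ) + 1) * H := by exact_mod_cast hN
  have hH1 : (1 : ℝ) ≤ H := by exact_mod_cast hH
  have hk0 : (0 : ℝ) ≤ k := Nat.cast_nonneg k
  set N : ℝ := ((k : ℝ) + 1) * H with hNdef
  have hl := half_le_log hN'
  have hld : 0 ≤ Real.log (1 / δ) := Real.log_nonneg (by rw [le_div_iff₀ hδ]; linarith)
  -- The left side is `4N(k + 2)/δ ≤ 8N²/δ`, and `N ≥ 2` turns the constant into a power of `N`.
  have h1 : 1 / (δ / (4 * H) * (1 / (((k : ℝ) + 1) * (k + 2)))) ≤ N ^ 6 * (1 / δ) := by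
    have h2 : 1 / (δ / (4 * H) * (1 / (((k : ℝ) + 1) * (k + 2))))
        = 4 * (((k : ℝ) + 1) * H) * (k + 2) * (1 / δ) := by
      field_simp
    rw [h2, ← hNdef]
    refine mul_le_mul_of_nonneg_right ?_ (by positivity)
    have h3 : (k : ℝ) + 2 ≤ 2 * N := by nlinarith
    have h4 : 4 * N * ((k : ℝ) + 2) ≤ 4 * N * (2 * N) :=
      mul_le_mul_of_nonneg_left h3 (by linarith)
    have h5 : (2 : ℝ) ^ 4 ≤ N ^ 4 := pow_le_pow_left₀ (by norm_num) hN' 4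
    nlinarith [mul_le_mul_of_nonneg_right h5 (sq_nonneg N)]
  refine (Real.log_le_log (by positivity) h1).trans ?_
  rw [Real.log_mul (by positivity) (by positivity), Real.log_pow]
  push_cast
  nlinarith

/-- The confidence radius is dominated by the exploration parameter. -/
lemma radius_le {x y D d u l g b : ℝ} (hx : 1 ≤ x) (hy : 0 ≤ y) (hyx : y ≤ x) (hD : 1 ≤ D)
    (hd : 1 ≤ d) (hu : 1 / 2 ≤ u) (hl : 1 / 2 ≤ l) (hg : g ≤ 6 * l * D) (hb : b ≤ l) :
    6400 * x ^ 3 * (y ^ 2 * d * u) + 2 * (64 * x ^ 2 * u) * g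
      + 16 * (64 * x ^ 2 * u) ^ 2 * d * b
      ≤ (22000 * x ^ 3 * D * (√d * u * l) / 50) ^ 2 := by
  -- Here `(22000/50)² = 193600`, which exceeds the total `51200 + 3072 + 131072` of the three terms
  -- below.
  have hsq : (22000 * x ^ 3 * D * (√d * u * l) / 50) ^ 2
      = 193600 * (x ^ 6 * D ^ 2 * (d * u ^ 2 * l ^ 2)) := by
    rw [div_pow, mul_pow, mul_pow, mul_pow, mul_pow, mul_pow, Real.sq_sqrt (by linarith)]
    ring
  rw [hsq]
  have hu2 : u ≤ 2 * u ^ 2 := by nlinarith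
  have hl2 : 1 ≤ 4 * l ^ 2 := by nlinarith
  have hl1 : l ≤ 2 * l ^ 2 := by nlinarith
  have hDD : D ≤ D ^ 2 := by nlinarith
  have hD1 : 1 ≤ D ^ 2 := by nlinarith
  have e1 : 6400 * x ^ 3 * (y ^ 2 * d * u) ≤ 51200 * (x ^ 6 * D ^ 2 * (d * u ^ 2 * l ^ 2)) := by
    calc 6400 * x ^ 3 * (y ^ 2 * d * u)
        ≤ 6400 * x ^ 3 * (x ^ 2 * d * (2 * u ^ 2)) * 1 * 1 := by
          rw [mul_one, mul_one]; gcongr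
      _ ≤ 6400 * x ^ 3 * (x ^ 2 * d * (2 * u ^ 2)) * (4 * l ^ 2) * (x * D ^ 2) := by
          gcongr; nlinarith
      _ = _ := by ring
  have e2 : 2 * (64 * x ^ 2 * u) * g ≤ 3072 * (x ^ 6 * D ^ 2 * (d * u ^ 2 * l ^ 2)) := by
    calc 2 * (64 * x ^ 2 * u) * g ≤ 2 * (64 * x ^ 2 * (2 * u ^ 2)) * (6 * (2 * l ^ 2) * D ^ 2) := by
          refine (mul_le_mul_of_nonneg_left hg (by positivity)).trans ?_
          gcongr
      _ = 3072 * (x ^ 2 * D ^ 2 * (1 * u ^ 2 * l ^ 2)) := by ring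
      _ ≤ 3072 * (x ^ 6 * D ^ 2 * (d * u ^ 2 * l ^ 2)) := by
          gcongr
          norm_num
  have e3 : 16 * (64 * x ^ 2 * u) ^ 2 * d * b
      ≤ 131072 * (x ^ 6 * D ^ 2 * (d * u ^ 2 * l ^ 2)) := by
    calc 16 * (64 * x ^ 2 * u) ^ 2 * d * b ≤ 16 * (64 * x ^ 2 * u) ^ 2 * d * (2 * l ^ 2) := by
          gcongr; linarith
      _ = 131072 * (x ^ 4 * 1 * (d * u ^ 2 * l ^ 2)) := by ring
      _ ≤ 131072 * (x ^ 6 * D ^ 2 * (d * u ^ 2 * l ^ 2)) := by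
          gcongr
          norm_num
  have e4 : 0 ≤ x ^ 6 * D ^ 2 * (d * u ^ 2 * l ^ 2) := by positivity
  linarith

end Parameters

/-! ### Constants and the final bound -/

section Final

/-- The summands of the regret bound in terms of the leading orders. -/
lemma regret_terms_le {x Λ q H sK κi L : ℝ} (hx : 1 ≤ x) (hΛ : 1 ≤ Λ) (hq : 1 ≤ q) (hH : 1 ≤ H)
    (hsK : 1 ≤ sK) (hκi : 0 ≤ κi) (hL : L ≤ Λ) :
    H * (30 * H * sK * Λ) + 9 * H * sK * Λ + 16
      + H * (H * (22000 * x ^ 3 * q * Λ ^ 3) * (5 * (q * (5 * Λ)) + 1) * (sK * √(4 * q ^ 2 * L))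
        + 18 * H * (22000 * x ^ 3 * q * Λ ^ 3) ^ 2 * (κi * (2 * q ^ 2 * L)))
      ≤ 20000000000 * (x * Λ) ^ 7 * (q ^ 3 * H ^ 2 * sK + κi * q ^ 4 * H ^ 2) := by
  have hxΛ : 1 ≤ x * Λ := one_le_mul_of_one_le_of_one_le hx hΛ
  have hsqrt : √(4 * q ^ 2 * L) ≤ 2 * q * Λ := by
    rw [Real.sqrt_le_left (by positivity)]
    nlinarith [mul_le_mul_of_nonneg_left (hL.trans (by nlinarith : Λ ≤ Λ ^ 2))
      (by positivity : 0 ≤ 4 * q ^ 2)]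
  have hqΛ : 1 ≤ q * Λ := one_le_mul_of_one_le_of_one_le hq hΛ
  have h5 : 5 * (q * (5 * Λ)) + 1 ≤ 26 * (q * Λ) := by nlinarith
  have hHsK : 1 ≤ H * sK := one_le_mul_of_one_le_of_one_le hH hsK
  have hq3 : 1 ≤ q ^ 3 := one_le_pow₀ hq
  set T := q ^ 3 * H ^ 2 * sK with hT
  have hT1 : H ^ 2 * sK ≤ T := by
    rw [hT, mul_assoc]; exact le_mul_of_one_le_left (by positivity) hq3
  have hT2 : H * sK ≤ T := by nlinarith
  have hT3 : 1 ≤ T := hHsK.trans hT2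
  have hΛ7 : Λ ≤ (x * Λ) ^ 7 :=
    (le_mul_of_one_le_left (by linarith) hx).trans (le_self_pow₀ hxΛ (by norm_num))
  have e1 : H * (30 * H * sK * Λ) ≤ 30 * ((x * Λ) ^ 7 * T) := by
    calc H * (30 * H * sK * Λ) = 30 * (Λ * (H ^ 2 * sK)) := by ring
      _ ≤ _ := by gcongr
  have e2 : 9 * H * sK * Λ ≤ 9 * ((x * Λ) ^ 7 * T) := by
    calc 9 * H * sK * Λ = 9 * (Λ * (H * sK)) := by ring
      _ ≤ _ := by gcongr
  have e3 : (16 : ℝ) ≤ 16 * ((x * Λ) ^ 7 * T) := by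
    have := one_le_mul_of_one_le_of_one_le (one_le_pow₀ hxΛ (n := 7)) hT3
    linarith
  have hx7 : x ^ 3 * Λ ^ 5 ≤ (x * Λ) ^ 7 := by
    rw [mul_pow]
    exact mul_le_mul (pow_le_pow_right₀ hx (by norm_num)) (pow_le_pow_right₀ hΛ (by norm_num))
      (by positivity) (by positivity)
  have hx67 : x ^ 6 * Λ ^ 7 ≤ (x * Λ) ^ 7 := by
    rw [mul_pow]
    exact mul_le_mul_of_nonneg_right (pow_le_pow_right₀ hx (by norm_num)) (by positivity)
  have e4 : H * (H * (22000 * x ^ 3 * q * Λ ^ 3) * (5 * (q * (5 * Λ)) + 1)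
      * (sK * √(4 * q ^ 2 * L))) ≤ 1144000 * ((x * Λ) ^ 7 * T) := by
    calc _ ≤ H * (H * (22000 * x ^ 3 * q * Λ ^ 3) * (26 * (q * Λ)) * (sK * (2 * q * Λ))) := by
          gcongr
      _ = 1144000 * ((x ^ 3 * Λ ^ 5) * T) := by rw [hT]; ring
      _ ≤ _ := by gcongr
  have e5 : H * (18 * H * (22000 * x ^ 3 * q * Λ ^ 3) ^ 2 * (κi * (2 * q ^ 2 * L)))
      ≤ 17424000000 * ((x * Λ) ^ 7 * (κi * q ^ 4 * H ^ 2)) := by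
    calc _ ≤ H * (18 * H * (22000 * x ^ 3 * q * Λ ^ 3) ^ 2 * (κi * (2 * q ^ 2 * Λ))) := by gcongr
      _ = 17424000000 * ((x ^ 6 * Λ ^ 7) * (κi * q ^ 4 * H ^ 2)) := by ring
      _ ≤ _ := by gcongr
  have n1 : 0 ≤ (x * Λ) ^ 7 * T := by positivity
  have n2 : 0 ≤ (x * Λ) ^ 7 * (κi * q ^ 4 * H ^ 2) := by positivity
  have hexp : 20000000000 * (x * Λ) ^ 7 * (T + κi * q ^ 4 * H ^ 2)
      = 20000000000 * ((x * Λ) ^ 7 * T)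
        + 20000000000 * ((x * Λ) ^ 7 * (κi * q ^ 4 * H ^ 2)) := by ring
  rw [hexp, mul_add]
  linarith

/-- The conditions on `lam` all follow from `100 (1 + Lφ Lθ) η Lφ² ≤ lam` and `η ≥ 2`; the extra
factor `1 + Lφ Lθ` is needed only for the cubic error. -/
lemma parameter_conditions {Lφ Lθ d u lam η : ℝ} (hLφ : 0 < Lφ) (hLθ : 0 < Lθ) (hd : 1 ≤ d)
    (hu : 1 / 2 ≤ u) (hlam : lam = 6400 * (1 + Lφ * Lθ) ^ 3 * (Lφ ^ 2 * d * u))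
    (hη : η = 64 * (1 + Lφ * Lθ) ^ 2 * u) :
    0 < lam ∧ 0 < η ∧ 2 * (1 + 4 * Lφ * Lθ) ^ 2 ≤ η ∧ 4 * η * Lφ ^ 2 ≤ lam ∧
      8 * η * Lφ ^ 2 ≤ lam ∧ 4 * Lφ ^ 2 ≤ lam ∧ 96 * η * Lφ ^ 3 * Lθ ≤ lam := by
  have hy : 0 < Lφ * Lθ := mul_pos hLφ hLθ
  obtain ⟨x, hx⟩ : ∃ x, x = 1 + Lφ * Lθ := ⟨_, rfl⟩
  rw [← hx] at hlam hη
  have hx1 : 1 ≤ x := by linarith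
  have hlam0 : 0 < lam := by rw [hlam]; positivity
  have hη0 : 0 < η := by rw [hη]; positivity
  have hη1 : 2 * (1 + 4 * Lφ * Lθ) ^ 2 ≤ η := by
    have h1 : 1 + 4 * Lφ * Lθ ≤ 4 * x := by rw [hx]; linarith
    have h2 : (1 + 4 * Lφ * Lθ) ^ 2 ≤ (4 * x) ^ 2 := pow_le_pow_left₀ (by positivity) h1 2
    have h3 := mul_le_mul_of_nonneg_left hu (by positivity : 0 ≤ 64 * x ^ 2)
    rw [← hη] at h3
    linarith
  have hlam100 : 100 * x * (η * Lφ ^ 2) ≤ lam := by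
    rw [hη, hlam]
    have hdu : u ≤ d * u := le_mul_of_one_le_left (by linarith) hd
    calc 100 * x * (64 * x ^ 2 * u * Lφ ^ 2) = 6400 * x ^ 3 * (Lφ ^ 2 * u) := by ring
      _ ≤ 6400 * x ^ 3 * (Lφ ^ 2 * (d * u)) := by gcongr
      _ = _ := by ring
  have hηL : 0 < η * Lφ ^ 2 := by positivity
  have hlam100' : 100 * (η * Lφ ^ 2) ≤ lam := by
    refine le_trans (mul_le_mul_of_nonneg_right ?_ hηL.le) hlam100
    linarith
  have hη2 : 2 ≤ η := by
    have : (1 : ℝ) ≤ (1 + 4 * Lφ * Lθ) ^ 2 := one_le_pow₀ (by linarith)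
    linarith
  have hL2 : 2 * Lφ ^ 2 ≤ η * Lφ ^ 2 := mul_le_mul_of_nonneg_right hη2 (sq_nonneg _)
  refine ⟨hlam0, hη0, hη1, by linarith, by linarith, by linarith [sq_nonneg Lφ], ?_⟩
  calc 96 * η * Lφ ^ 3 * Lθ = 96 * (Lφ * Lθ) * (η * Lφ ^ 2) := by ring
    _ ≤ 100 * x * (η * Lφ ^ 2) := mul_le_mul_of_nonneg_right (by rw [hx]; linarith) hηL.le
    _ ≤ _ := hlam100

/-- With the scale `1/(b√n)` in the exponential inequality the variance proxies sum to exactly one,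
which gives the Azuma rate. -/
lemma sum_le_of_sum_sub_le {n : ℕ} (hn : 0 < n) {f : ℕ → ℝ} {b l : ℝ} (hb : 0 < b)
    (h : ∑ k ∈ Finset.range n, (1 / (b * √n) * f k - (1 / (b * √n) * b) ^ 2) ≤ l) :
    ∑ k ∈ Finset.range n, f k ≤ b * √n * (1 + l) := by
  have hn0 : (0 : ℝ) < n := by exact_mod_cast hn
  have hs : 0 < √(n : ℝ) := Real.sqrt_pos.2 hn0
  rw [Finset.sum_sub_distrib, ← Finset.mul_sum, Finset.sum_const, Finset.card_range,
    nsmul_eq_mul] at h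
  have h1 : (n : ℝ) * (1 / (b * √n) * b) ^ 2 = 1 := by
    have : 1 / (b * √n) * b = (√n)⁻¹ := by field_simp
    rw [this, inv_pow, Real.sq_sqrt hn0.le, mul_inv_cancel₀ hn0.ne']
  rw [h1, one_div, inv_mul_eq_div, sub_le_iff_le_add, div_le_iff₀ (by positivity)] at h
  linarith

variable {S A Ω : Type*} {H d : ℕ} {𝓜 : EpisodicMDP S A H} {φ : S → A → S → Vec d}
  [mΩ : MeasurableSpace Ω] {μ : Measure Ω}

set_option maxHeartbeats 1000000 in
/-- The regret bound for at least one episode. -/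
theorem regret_bound [IsProbabilityMeasure μ] [Finite A] [Nonempty A] {Lφ Lθ : ℝ}
    (hLφ : 0 < Lφ) (hLθ : 0 < Lθ) {δ : ℝ} (hδ : 0 < δ) (hδ1 : δ ≤ 1) {U K : ℕ} {κ : ℝ}
    {θs : Fin H → Vec d} (hd : 0 < d) (hH : 0 < H) (hU2 : 2 ≤ U) (hK : 0 < K) (hκ : 0 < κ)
    (hM : IsMNL 𝓜 φ θs) (hU : ∀ s a, (𝓜.reach s a).card ≤ U) (hB : IsBounded 𝓜 φ θs Lφ Lθ)
    (href : HasReferenceState 𝓜 φ) (hkap : IsKappa 𝓜 φ Lθ κ)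
    {prm : Params} (hlam_eq : prm.lam = 6400 * (1 + Lφ * Lθ) ^ 3 * (Lφ ^ 2 * d * Real.log U))
    (heta_eq : prm.eta = 64 * (1 + Lφ * Lθ) ^ 2 * Real.log U)
    (hbeta_eq : ∀ k : ℕ, prm.beta k = 22000 * (1 + Lφ * Lθ) ^ 3 * (1 + Real.log (1 / δ))
      * (√d * Real.log U * Real.log ((k + 1) * H)))
    (hσ : ∀ k, prm.sigma k = H * prm.beta k) (hMU : prm.M = numSamples H U)
    (R : ORRLRun 𝓜 φ Lθ prm K μ) :
    1 - δ ≤ μ.real {ω | R.regret ω ≤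
      20000000000 * ((1 + Lφ * Lθ) * (1 + Real.log (d * H * U * K / δ))) ^ 7 *
        (√d ^ 3 * (H : ℝ) ^ 2 * √K + κ⁻¹ * √d ^ 4 * (H : ℝ) ^ 2)} := by
  have hne : ∀ s a, (𝓜.reach s a).Nonempty := fun s a => by
    obtain ⟨r, hr, _⟩ := href s a
    exact ⟨r, hr⟩
  obtain ⟨π, hπ⟩ := exists_optimal_policy 𝓜
  set x : ℝ := 1 + Lφ * Lθ with hx
  have hy0 : 0 < Lφ * Lθ := mul_pos hLφ hLθ
  have hx1 : 1 ≤ x := by linarith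
  set D : ℝ := 1 + Real.log (1 / δ) with hD
  have hd1 : (1 : ℝ) ≤ d := by exact_mod_cast hd
  have hH1 : (1 : ℝ) ≤ H := by exact_mod_cast hH
  have hU2' : (2 : ℝ) ≤ U := by exact_mod_cast hU2
  have hU1 : (1 : ℝ) ≤ U := by linarith
  have hK1 : (1 : ℝ) ≤ K := by exact_mod_cast hK
  have hi1 : 1 ≤ 1 / δ := by rw [le_div_iff₀ hδ]; linarith
  have hD1 : 1 ≤ D := by linarith [Real.log_nonneg hi1]
  set u : ℝ := Real.log U with hu
  have hu2 : 1 / 2 ≤ u := half_le_log hU2'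
  set W : ℝ := d * H * U * K / δ with hW
  set Λ : ℝ := 1 + Real.log W with hΛ
  have hWeq : W = d * H * U * K * (1 / δ) := by rw [hW]; ring
  have hW1 : 1 ≤ W := by
    rw [hWeq]
    exact one_le_mul_of_one_le_of_one_le (one_le_mul_of_one_le_of_one_le
      (one_le_mul_of_one_le_of_one_le (one_le_mul_of_one_le_of_one_le hd1 hH1) hU1) hK1) hi1
  have hΛ1 : 1 ≤ Λ := by linarith [Real.log_nonneg hW1]
  have hlogW : ∀ y : ℝ, 0 < y → y ≤ W → Real.log y ≤ Λ - 1 := fun y hy0 hy => by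
    have := Real.log_le_log hy0 hy
    linarith
  have hDΛ : D ≤ Λ := by
    have := hlogW (1 / δ) (by positivity) (by
      rw [hWeq]
      refine le_mul_of_one_le_left (by positivity) ?_
      exact one_le_mul_of_one_le_of_one_le
        (one_le_mul_of_one_le_of_one_le (one_le_mul_of_one_le_of_one_le hd1 hH1) hU1) hK1)
    linarith
  have hHUW : (H : ℝ) * U ≤ W := by
    calc (H : ℝ) * U = 1 * H * U * 1 * 1 := by ring
      _ ≤ d * H * U * K * (1 / δ) := by gcongr
      _ = W := hWeq.symm
  have huΛ : u ≤ Λ := by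
    have := hlogW U (by linarith) (le_trans (le_mul_of_one_le_left (by linarith) hH1) hHUW)
    linarith
  have hKHW : (K : ℝ) * H ≤ W := by
    calc (K : ℝ) * H = 1 * H * 1 * K * 1 := by ring
      _ ≤ d * H * U * K * (1 / δ) := by gcongr
      _ = W := hWeq.symm
  have hHδW : (H : ℝ) / δ ≤ W := by
    calc (H : ℝ) / δ = 1 * H * 1 * 1 * (1 / δ) := by ring
      _ ≤ d * H * U * K * (1 / δ) := by gcongr
      _ = W := hWeq.symm
  have hdHKδW : (d : ℝ) * H * K / δ ≤ W := by
    calc (d : ℝ) * H * K / δ = d * H * 1 * K * (1 / δ) := by ring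
      _ ≤ d * H * U * K * (1 / δ) := by gcongr
      _ = W := hWeq.symm
  have hlog2 := Real.log_two_lt_d9
  have hlog4 : Real.log 4 ≤ 2 := by
    rw [show (4 : ℝ) = 2 ^ 2 by norm_num, Real.log_pow]; push_cast; linarith
  -- the parameters
  have hMs : 0 < prm.M := hMU ▸ numSamples_pos hH (by omega)
  obtain ⟨hlam, hη, hη1, hlam4, hlam8, hlam2, hlam96⟩ :=
    parameter_conditions hLφ hLθ hd1 hu2 hlam_eq heta_eq
  have hkH : ∀ k : ℕ, (1 : ℝ) ≤ ((k : ℝ) + 1) * H := fun k =>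
    one_le_mul_of_one_le_of_one_le (by linarith [(Nat.cast_nonneg k : (0 : ℝ) ≤ k)]) hH1
  have hβ0 : ∀ k, 0 ≤ prm.beta k := fun k => by
    rw [hbeta_eq]
    have := Real.log_nonneg (hkH k)
    positivity
  -- The radius vanishes exactly when `log ((k + 1) H) = 0`, that is, in the first episode with `H =
  -- 1`.
  have hβpos : ∀ k, 0 < prm.beta k ↔ 2 ≤ (k + 1) * H := fun k => by
    constructor
    · intro hb
      by_contra hlt
      have h1 : (k + 1) * H = 1 := by
        have : 0 < (k + 1) * H := by positivity
        omega
      have h2 : ((k : ℝ) + 1) * H = 1 := by exact_mod_cast h1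
      rw [hbeta_eq, h2, Real.log_one] at hb
      simp at hb
    · intro h2
      have h3 : (2 : ℝ) ≤ ((k : ℝ) + 1) * H := by exact_mod_cast h2
      have := half_le_log h3
      rw [hbeta_eq]
      have : 0 < √(d : ℝ) := Real.sqrt_pos.2 (by linarith)
      positivity
  have hβb : ∀ k < K, prm.beta k ≤ 22000 * x ^ 3 * √d * Λ ^ 3 := fun k hk => by
    have h1 : Real.log (((k : ℝ) + 1) * H) ≤ Λ := by
      have h2 : ((k : ℝ) + 1) ≤ K := by exact_mod_cast hk
      have := hlogW (((k : ℝ) + 1) * H) (by linarith [hkH k])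
        (le_trans (by gcongr) hKHW)
      linarith
    have h3 := Real.log_nonneg (hkH k)
    rw [hbeta_eq]
    calc 22000 * x ^ 3 * D * (√d * u * Real.log ((k + 1) * H))
        ≤ 22000 * x ^ 3 * Λ * (√d * Λ * Λ) := by gcongr
      _ = _ := by ring
  -- the noise level
  have hM1 : (1 : ℝ) ≤ prm.M := by exact_mod_cast hMs
  -- Chosen so that `exp (-r²/2) = 1/G` makes the union bound over all noise vectors equal to `δ/4`.
  set G : ℝ := 8 * d * H * prm.M * K / δ with hG
  have hG1 : 1 ≤ G := by
    have : G = 8 * d * H * prm.M * K * (1 / δ) := by rw [hG]; ring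
    rw [this]
    refine one_le_mul_of_one_le_of_one_le (one_le_mul_of_one_le_of_one_le
      (one_le_mul_of_one_le_of_one_le (one_le_mul_of_one_le_of_one_le ?_ hH1) hM1) hK1) hi1
    linarith
  set r : ℝ := √(2 * Real.log G) with hr
  have hr2 : r ^ 2 = 2 * Real.log G := Real.sq_sqrt (by linarith [Real.log_nonneg hG1])
  have hrδ : K * (H * (prm.M * (2 * d * Real.exp (-r ^ 2 / 2)))) ≤ δ / 4 := by
    have h1 : Real.exp (-r ^ 2 / 2) = G⁻¹ := by
      rw [hr2, show -(2 * Real.log G) / 2 = -Real.log G by ring, Real.exp_neg,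
        Real.exp_log (by linarith)]
    rw [h1, hG]
    apply le_of_eq
    field_simp
    ring
  have hr5 : r ≤ 5 * Λ := by
    have h1 : Real.log G ≤ 11 * Λ := by
      have h2 : G = 8 * (prm.M * (d * H * K / δ)) := by rw [hG]; ring
      rw [h2, Real.log_mul (by norm_num) (by positivity), Real.log_mul (by positivity)
        (by positivity)]
      have h3 : Real.log 8 ≤ 3 := by
        rw [show (8 : ℝ) = 2 ^ 3 by norm_num, Real.log_pow]; push_cast; linarith
      have h4 := Real.log_le_sub_one_of_pos (show (0 : ℝ) < prm.M by linarith)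
      have h5 : (prm.M : ℝ) ≤ 2 + 10 * Real.log (H * U) := by
        rw [hMU]; exact numSamples_le hH (by omega)
      have h6 := hlogW (H * U) (by positivity) hHUW
      have h7 := hlogW (d * H * K / δ) (by positivity) hdHKδW
      linarith
    refine Real.sqrt_le_iff.2 ⟨by linarith, ?_⟩
    nlinarith
  -- the good event
  have hb10 : (0 : ℝ) < 10 * H := by linarith
  have hb3 : (0 : ℝ) < 3 * H := by linarith
  obtain ⟨N, hN, hgood⟩ := R.exists_good_event hM hne hH hU2 hU hMU hB.1 hlam hη hlam4 hσ π
    (c₁ := 1 / (10 * H * √K)) (c₂ := 1 / (3 * H * √K)) (by positivity) (by positivity) hδ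
    (Real.sqrt_nonneg _) hrδ
  have hsub : Nᶜ ⊆ {ω | R.regret ω ≤ 20000000000 * (x * Λ) ^ 7 *
        (√d ^ 3 * (H : ℝ) ^ 2 * √K + κ⁻¹ * √d ^ 4 * (H : ℝ) ^ 2)} := by
    intro ω hω
    obtain ⟨hy, hlr, hgap, hpess, hnoise⟩ := hgood ω hω
    have hconf : ∀ k < K, 0 < prm.beta k →
        Confident θs (prm.beta k) (fun h => R.theta k h ω) (fun h => R.gram k h ω) := by
      intro k hk hb
      have hkH2 := (hβpos k).1 hb
      refine ⟨hb, fun h => Real.sqrt_le_iff.2 ⟨by linarith, ?_⟩⟩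
      have h1 := (R.path h ω).sqNorm_sub_le (fun k hk => hy k hk h) hLφ hLθ hB.1 hlam2 hlam8
        hlam96 hη1 (hB.2 h) hk.le
      have h2 := (hlr k hk h).trans (log_confidence_le hH hkH2 hδ hδ1)
      have h3 : Real.log (1 + k) ≤ Real.log (((k : ℝ) + 1) * H) :=
        Real.log_le_log (by positivity) (by
          rw [add_comm]; exact le_mul_of_one_le_right (by positivity) hH1)
      have h4 := radius_le (y := Lφ * Lθ) (d := d) (u := u) hx1 hy0.le
        (by rw [hx]; linarith) hD1 hd1 hu2 (half_le_log (by exact_mod_cast hkH2)) h2 h3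
      rw [hbeta_eq]
      refine le_trans (le_trans h1 (le_of_eq ?_)) h4
      rw [hlam_eq, heta_eq]
      ring
    have hnoise' : ∀ k < K, 0 < prm.beta k →
        ∀ h m, √(sqNorm (R.gram k h ω) (R.noise k h m ω)) ≤ H * prm.beta k * (√d * (5 * Λ)) := by
      intro k hk hb h m
      have h1 : 0 ≤ r := Real.sqrt_nonneg _
      refine Real.sqrt_le_iff.2 ⟨by positivity, (hnoise k hk hb h m).trans ?_⟩
      calc (H * prm.beta k) ^ 2 * (d * r ^ 2) ≤ (H * prm.beta k) ^ 2 * (d * (5 * Λ) ^ 2) := by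
            gcongr
        _ = _ := by rw [mul_pow _ (√(d : ℝ) * _), mul_pow (√(d : ℝ)), Real.sq_sqrt (by linarith)]
    have hgap' : ∀ h : Fin H, ∑ k ∈ Finset.range K,
        (modelMean 𝓜 φ (θs h) (R.state k h ω) (R.act k h ω) (fun s' => R.gap k (h + 1) s' ω)
          - R.gap k (h + 1) (R.state k (h + 1) ω) ω) ≤ 30 * H * √K * Λ := by
      intro h
      refine (sum_le_of_sum_sub_le hK hb10 (hgap h)).trans ?_
      have h1 : 1 / (δ / (4 * H)) = 4 * (H / δ) := by field_simp
      have h2 := hlogW (H / δ) (by positivity) hHδW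
      rw [h1, Real.log_mul (by norm_num) (by positivity)]
      calc 10 * H * √K * (1 + (Real.log 4 + Real.log (H / δ)))
          ≤ 10 * H * √K * (3 * Λ) := by gcongr; linarith
        _ = _ := by ring
    have hpess' : ∑ k ∈ Finset.range K, R.pess θs π k ω
        * (1 - 4 * (if @decide (ω ∈ R.optimisticEvent π k) (Classical.propDecidable _) = true
          then 1 else 0)) ≤ 9 * H * √K * Λ := by
      have h0 := hpess
      simp only [mul_assoc (1 / (3 * (H : ℝ) * √K)) (R.pess θs π _ ω)] at h0
      refine (sum_le_of_sum_sub_le hK hb3 h0).trans ?_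
      have h1 : 1 / (δ / 4) = 4 * (1 / δ) := by field_simp
      rw [h1, Real.log_mul (by norm_num) (by positivity)]
      calc 3 * H * √K * (1 + (Real.log 4 + Real.log (1 / δ)))
          ≤ 3 * H * √K * (3 * Λ) := by gcongr; linarith
        _ = _ := by ring
    have hzero : ∑ k ∈ Finset.range K, (if 0 < prm.beta k then (0 : ℝ) else 16 * (H : ℝ) ^ 2)
        ≤ 16 := by
      calc _ ≤ ∑ k ∈ Finset.range K, (if k = 0 then (16 : ℝ) else 0) := by
            refine Finset.sum_le_sum fun k _ => ?_
            by_cases hb : 0 < prm.beta k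
            · rw [if_pos hb]; split_ifs <;> norm_num
            · have h1 : ¬ 2 ≤ (k + 1) * H := fun h => hb ((hβpos k).2 h)
              have h2 : k = 0 := by
                by_contra hk0
                exact h1 (le_trans (by omega : 2 ≤ k + 1) (Nat.le_mul_of_pos_right _ hH))
              subst h2
              have h3 : H = 1 := by omega
              have h4 : (H : ℝ) = 1 := by exact_mod_cast h3
              rw [if_neg hb, if_pos rfl, h4]; norm_num
        _ ≤ 16 := by
            rw [Finset.sum_ite_eq']
            split_ifs <;> norm_num
    have hρ : 0 ≤ √d * (5 * Λ) := by positivity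
    have hmain := R.regret_le hM hne hMs hlam hH hπ hρ (fun k _ => hβ0 k) hconf hnoise'
      hgap' (by convert hpess' using 1) (by convert hzero using 1)
    have hstep : ∑ h : Fin H, ∑ k ∈ Finset.range K, R.stepError (√d * (5 * Λ)) k h ω
        ≤ H * (H * (22000 * x ^ 3 * √d * Λ ^ 3) * (5 * (√d * (5 * Λ)) + 1)
          * (√K * √(4 * d * Real.log (1 + K)))
          + 18 * H * (22000 * x ^ 3 * √d * Λ ^ 3) ^ 2 * (κ⁻¹ * (2 * d * Real.log (1 + K)))) := by
      refine (Finset.sum_le_sum fun h _ => R.sum_stepError_le hne href hκ hkap hB.1 hLφ hLθ hlam hη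
        hlam2 hlam8 (fun k hk => hy k hk h) hρ (fun k _ => hβ0 k) hβb (by positivity)).trans
        (le_of_eq ?_)
      rw [Finset.sum_const, Finset.card_univ, Fintype.card_fin, nsmul_eq_mul]
    have hLK : Real.log (1 + K) ≤ Λ := by
      have h1 : Real.log (1 + K) ≤ Real.log (2 * K) := Real.log_le_log (by positivity) (by linarith)
      rw [Real.log_mul (by norm_num) (by positivity)] at h1
      have h2 := hlogW K (by linarith) (le_trans (le_mul_of_one_le_right (by linarith) hH1) hKHW)
      linarith
    have hfin := regret_terms_le (q := √d) (sK := √K) (κi := κ⁻¹) (L := Real.log (1 + K)) hx1 hΛ1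
      (Real.one_le_sqrt.2 hd1) hH1 (Real.one_le_sqrt.2 hK1) (inv_nonneg.2 hκ.le)
      hLK
    rw [Real.sq_sqrt (by linarith : (0 : ℝ) ≤ d)] at hfin
    exact (hmain.trans (by linarith)).trans hfin
  -- The exceptional set is not known to be measurable, so subadditivity replaces the rule for
  -- complements.
  have h1 : (1 : ℝ) = μ.real Set.univ := probReal_univ.symm
  have h2 := (measureReal_mono (μ := μ) (Set.union_compl_self N).ge).trans
    (measureReal_union_le N Nᶜ)
  have h3 := measureReal_mono (μ := μ) hsub
  linarith

end Final

end MNLRL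

end

theorem theorem2 :
    ∃ (C : ℝ) (p : ℕ), 0 < C ∧
      ∀ Lφ Lθ : ℝ, 0 < Lφ → 0 < Lθ →
      ∃ c₁ c₂ : ℝ, 0 < c₁ ∧ 0 < c₂ ∧
      ∀ δ : ℝ, 0 < δ → δ < MNLRL.stdNormalCDF (-1) / 2 →
      ∃ c₃ : ℝ, 0 < c₃ ∧
      ∀ (S A Ω : Type*) [Finite A] [MeasurableSpace Ω] (μ : MeasureTheory.Measure Ω)
        [MeasureTheory.IsProbabilityMeasure μ]
        (d H U K : ℕ) (κ : ℝ)
        (𝓜 : MNLRL.EpisodicMDP S A H) (φ : S → A → S → MNLRL.Vec d)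
        (θstar : Fin H → MNLRL.Vec d),
        0 < d → 0 < H → 2 ≤ U → 0 < κ →
        MNLRL.IsMNL 𝓜 φ θstar → MNLRL.IsMaxReach 𝓜 U →
        MNLRL.IsBounded 𝓜 φ θstar Lφ Lθ → MNLRL.HasReferenceState 𝓜 φ →
        MNLRL.IsKappa 𝓜 φ Lθ κ →
        ∀ R : MNLRL.ORRLRun 𝓜 φ Lθ (MNLRL.orrlParams c₁ c₂ c₃ Lφ d H U) K μ,
          1 - δ ≤ μ.real {ω | R.regret ω ≤
            C * ((1 + Lφ * Lθ) * (1 + Real.log (d * H * U * K / δ))) ^ p *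
              ((d : ℝ) ^ (3 / 2 : ℝ) * (H : ℝ) ^ (3 / 2 : ℝ) * √((K : ℝ) * H)
                + κ⁻¹ * (d : ℝ) ^ 2 * (H : ℝ) ^ 2)} := by
  refine ⟨20000000000, 7, by norm_num, fun Lφ Lθ hLφ hLθ => ?_⟩
  have hx : 0 < 1 + Lφ * Lθ := by positivity
  refine ⟨6400 * (1 + Lφ * Lθ) ^ 3, 64 * (1 + Lφ * Lθ) ^ 2, by positivity, by positivity,
    fun δ hδ hδΦ => ?_⟩
  have hδ1 : δ ≤ 1 := by
    have := ProbabilityTheory.cdf_le_one (ProbabilityTheory.gaussianReal 0 1) (-1)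
    rw [MNLRL.stdNormalCDF] at hδΦ
    linarith
  have hlog : 0 ≤ Real.log (1 / δ) := Real.log_nonneg (by rw [le_div_iff₀ hδ]; linarith)
  refine ⟨22000 * (1 + Lφ * Lθ) ^ 3 * (1 + Real.log (1 / δ)), by positivity, ?_⟩
  intro S A Ω _ _ μ _ d H U K κ 𝓜 φ θstar hd hH hU hκ hM hmax hB href hkap R
  -- For `K = 0` the regret is an empty sum, and `Real.log 0 = 0` keeps the right side nonnegative.
  rcases Nat.eq_zero_or_pos K with rfl | hK
  · have huniv : {ω | R.regret ω ≤
        20000000000 * ((1 + Lφ * Lθ) * (1 + Real.log (d * H * U * (0 : ℕ) / δ))) ^ 7 *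
          ((d : ℝ) ^ (3 / 2 : ℝ) * (H : ℝ) ^ (3 / 2 : ℝ) * √(((0 : ℕ) : ℝ) * H)
            + κ⁻¹ * (d : ℝ) ^ 2 * (H : ℝ) ^ 2)} = Set.univ := by
      refine Set.eq_univ_of_forall fun ω => ?_
      simp only [Set.mem_ofPred_eq, MNLRL.ORRLRun.regret, Finset.range_zero, Finset.sum_empty,
        Nat.cast_zero, mul_zero, zero_div, Real.log_zero, add_zero, mul_one]
      positivity
    rw [huniv, MeasureTheory.probReal_univ]
    linarith
  · obtain ⟨s₀, a₀, -⟩ := hmax.1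
    have : Nonempty A := ⟨a₀⟩
    have hcard : ∀ s a, (𝓜.reach s a).card ≤ U := fun s a => hmax.2 ⟨s, a, rfl⟩
    have h := MNLRL.regret_bound hLφ hLθ hδ hδ1 hd hH hU hK hκ hM hcard hB href hkap rfl rfl
      (fun _ => rfl) (fun _ => rfl) rfl R
    have hH0 : (0 : ℝ) < H := by exact_mod_cast hH
    have hd0 : (0 : ℝ) < d := by exact_mod_cast hd
    have e1 : (d : ℝ) ^ (3 / 2 : ℝ) = √d ^ 3 := by
      rw [Real.sqrt_eq_rpow, ← Real.rpow_natCast, ← Real.rpow_mul hd0.le]; norm_num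
    -- One factor `√H` of `√T` completes `H^{3/2}` to the `H²` obtained per `√K`.
    have e2 : (H : ℝ) ^ (3 / 2 : ℝ) * √((K : ℝ) * H) = (H : ℝ) ^ 2 * √K := by
      rw [Real.sqrt_mul (Nat.cast_nonneg K), mul_left_comm, Real.sqrt_eq_rpow (H : ℝ),
        ← Real.rpow_add hH0, mul_comm]
      norm_num
    have e3 : (d : ℝ) ^ 2 = √d ^ 4 := by
      rw [show 4 = 2 * 2 from rfl, pow_mul, Real.sq_sqrt hd0.le]
    rw [mul_assoc ((d : ℝ) ^ (3 / 2 : ℝ)), e2, e1, e3, ← mul_assoc]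
    exact h
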